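/- **Setting.** Let $m\in\mathbb N$, $\mathbb R^n=\mathbb R^{n_1}\times\dots\times\mathbb R^{n_m}$, $\tau>0$, and consider the delay differential equation $$\dot x(t)=F(x(t))+\varepsilon\,G(X(t,\cdot)),\qquad X(t,s)=x(t+s),\ s\in[-\tau,0],$$ where $F(x)=(F_1(x_1),\dots,F_m(x_m))$ with $F_j:\mathbb R^{n_j}\to\mathbb R^{n_j}$ of class $C^\infty$, and $G:C([-\tau,0],\mathbb R^n)\to\mathbb R^n$ is $C^\infty$ (in the Fréchet sense). Assume that each $\dot x_j=F_j(x_j)$ has a nonconstant periodic solution $\Gamma_j$ of minimal period $T_j>0$ that is normally hyperbolic: its Floquet multiplier $1$ is algebraically simple and no other Floquet multiplier lies on the unit circle. Put $\omega_j=2\pi/T_j$, $\omega=(\omega_1,\dots,\omega_m)$, $\mathbb T^m=(\mathbb R/2\pi\mathbb Z)^m$ and $\partial_\omega u=\partial_\phi u\cdot\omega$. The *conjugacy equations* for $f^\varepsilon:\mathbb T^m\to\mathbb R^m$, $e^\varepsilon:\mathbb T^m\to\mathbb R^n$, $E^\varepsilon:\mathbb T^m\times[-\tau,0]\to\mathbb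 R^n$ are $$\partial_\phi e^\varepsilon\cdot f^\varepsilon=F(e^\varepsilon)+\varepsilon G(E^\varepsilon(\phi,\cdot)),\qquad \partial_\phi E^\varepsilon\cdot f^\varepsilon=\partial_sE^\varepsilon,\qquad e^\varepsilon(\phi)=E^\varepsilon(\phi,0).$$ Let $$f^0=\omega,\qquad e^0(\phi)=\bigl(\Gamma_j(\phi_j/\omega_j)\bigr)_j,\qquad E^0(\phi,s)=\bigl(\Gamma_j(\phi_j/\omega_j+s)\bigr)_j .$$ Below, an *expansion* is a sequence $(f^\ell,e^\ell,E^\ell)_{\ell\ge 0}$ of smooth functions on $\mathbb T^m$, $\mathbb T^m$, $\mathbb T^m\times[-\tau,0]$ that starts with these $f^0,e^0,E^0$. It *solves the conjugacy equations up to order $M$* if the truncations $\sum_{\ell\le M}\varepsilon^\ell f^\ell$, $\sum_{\ell\le M}\varepsilon^\ell e^\ell$, $\sum_{\ell\le M}\varepsilon^\ell E^\ell$ satisfy the three equations up to errors $O(\varepsilon^{M+1})$ as $\varepsilon\to0$, uniformly in $\phi$ and $s$. For $\ell\ge1$ let $$\eta^\ell=\frac1{\ell!}\frac{d^\ell}{d\varepsilon^\ell}\Big|_{\varepsilon=0}\Bigl[F\bigl(\textstyle\sum_{k<\ell}\varepsilon^ke^k\bigr)+\varepsilon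 G\bigl(\sum_{k<\ell}\varepsilon^kE^k(\phi,\cdot)\bigr)\Bigr]-\sum_{0<k<\ell}\partial_\phi e^k\cdot f^{\ell-k},\qquad H^\ell=-\sum_{0<k<\ell}\partial_\phi E^k\cdot f^{\ell-k};$$ these involve only coefficients of order $<\ell$. The *$\ell$-th order homological equations* are $$\partial_\omega e^\ell-F'(e^0)e^\ell+\partial_\phi e^0\cdot f^\ell=\eta^\ell,\qquad \partial_\omega E^\ell-\partial_sE^\ell+\partial_\phi E^0\cdot f^\ell=H^\ell,\qquad e^\ell(\phi)=E^\ell(\phi,0).$$ A function $f:\mathbb T^m\to\mathbb R^m$ is in *normal form up to order $K$* if its Fourier coefficients satisfy $\hat f_{\mathbf k}=0$ whenever $\langle\mathbf k,\omega\rangle\ne0$ and $|\mathbf k|=|k_1|+\dots+|k_m|\le K$. With $T(\phi)=\partial_\phi e^0(\phi)$, a *Floquet frame* is a smooth family $N(\phi):\mathbb C^{n-m}\to\mathbb C^n$, $\phi\in\mathbb T^m$, with a matrix $L\in\mathbb C^{(n-m)\times(n-m)}$ that is hyperbolic (no eigenvalue on the imaginary axis), such that $T(\phi)$ and $N(\phi)$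 are injective, $\operatorname{im}T(\phi)\oplus\operatorname{im}N(\phi)=\mathbb C^n$ (with $T(\phi)$ acting on complex vectors) and $\partial_\omega N+NL=F'(e^0)N$. Then $\pi(\phi)$ is the projection onto $\operatorname{im}T(\phi)$ along $\operatorname{im}N(\phi)$, and $T^+,N^+$ are the left inverses of $T,N$ that vanish on $\operatorname{im}N$, $\operatorname{im}T$ respectively. **Theorem.** 1. For every $K\in\mathbb N$ there is an expansion such that, for all $\ell\ge1$, the $\ell$-th order homological equations hold and $f^\ell$ is in normal form up to order $K$, and which solves the conjugacy equations up to every order $M$. 2. $e^0,E^0$ are smooth functions on $\mathbb T^m$, $\mathbb T^m\times[-\tau,0]$, and $f^0,e^0,E^0$ solve the conjugacy equations exactly for $\varepsilon=0$. For every expansion and every $M$, the expansion solves the conjugacy equations up to order $M$ if and only if the $\ell$-th order homological equations hold for all $1\le\ell\le M$. 3. A Floquet frame exists. For every Floquet frame and every smooth $\eta:\mathbb T^m\to\mathbb R^n$: - *(splitting)* if $f,g,h,e$ are smooth, $f,g$ with values in $\mathbb R^m$, $h$ in $\mathbb C^{n-m}$, $e$ in $\mathbb R^n$, and $e=Tg+Nh$,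 then $\partial_\omega e-F'(e^0)e+\partial_\phi e^0\cdot f=\eta$ is equivalent to the pair $T[\partial_\omega g+f]=\pi\eta$ (tangential) and $N[\partial_\omega h-Lh]=(I-\pi)\eta$ (normal); - *(tangential part)* for every $K$ the tangential equation has a smooth real solution $(g,f)$ with $f$ in normal form up to order $K$; with $\zeta=T^+\pi\eta$, it has $\hat g_{\mathbf k}=\hat\zeta_{\mathbf k}/(i\langle\mathbf k,\omega\rangle)$, $\hat f_{\mathbf k}=0$ if $|\mathbf k|\le K$ and $\langle\mathbf k,\omega\rangle\neq0$, and $\hat g_{\mathbf k}=0$, $\hat f_{\mathbf k}=\hat\zeta_{\mathbf k}$ for all other $\mathbf k$; - *(normal part)* the normal equation has a unique smooth solution $h$; the matrices $i\langle\mathbf k,\omega\rangle I-L$ are invertible and $\hat h_{\mathbf k}=(i\langle\mathbf k,\omega\rangle I-L)^{-1}\hat\kappa_{\mathbf k}$ with $\kappa=N^+(I-\pi)\eta$. 4. Let $\ell\ge1$, and let an expansion satisfy the $k$-th order homological equations for all $1\le k<\ell$. Then $\eta^\ell$ is a smooth function on $\mathbb T^m$, and: - *(transport part)* if smooth $f,e$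 satisfy $\partial_\omega e-F'(e^0)e+\partial_\phi e^0\cdot f=\eta^\ell$, then $$E(\phi,s)=e(\phi+s\omega)+\partial_\phi E^0(\phi,s)\cdot\int_0^sf(\phi+\omega(s-\zeta))\,d\zeta-\int_0^sH^\ell(\phi+\omega(s-\zeta),\zeta)\,d\zeta$$ is smooth on $\mathbb T^m\times[-\tau,0]$ and satisfies $\partial_\omega E-\partial_sE+\partial_\phi E^0\cdot f=H^\ell$ and $E(\phi,0)=e(\phi)$; - *(recursion)* for every Floquet frame, every smooth real solution $(g,f)$ of the tangential equation and every smooth solution $h$ of the normal equation with $\eta=\eta^\ell$, the function $e^\ell=Tg+Nh$ is real-valued and smooth, and replacing the order-$\ell$ coefficients by $f^\ell=f$, this $e^\ell$, and $E^\ell$ given by the integral formula with $e=e^\ell$ yields a solution of the $\ell$-th order homological equations. With the existence of $(g,f)$ and $h$ in part 3, this computes $f^\ell,e^\ell,E^\ell$ recursively to every order. -/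

import Mathlib

open Set
open scoped ContDiff

noncomputable section

namespace DelayPhase

/-! ### Normally hyperbolic periodic orbits -/

/-- `Φ` is the fundamental solution (with `Φ 0 = id`) of the variational equation
`y' = DF(γ t) y` along `γ`. -/
def IsFundamentalSolution {k : ℕ} (F : (Fin k → ℝ) → (Fin k → ℝ)) (γ : ℝ → (Fin k → ℝ))
    (Φ : ℝ → ((Fin k → ℝ) →L[ℝ] (Fin k → ℝ))) : Prop :=
  Φ 0 = ContinuousLinearMap.id ℝ (Fin k → ℝ) ∧
    ∀ t, HasDerivAt Φ ((fderiv ℝ F (γ t)).comp (Φ t)) t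

/-- Characteristic polynomial of an endomorphism of `ℝᵏ`. -/
def charpolyOf {k : ℕ} (M : (Fin k → ℝ) →L[ℝ] (Fin k → ℝ)) : Polynomial ℝ :=
  LinearMap.charpoly (M : (Fin k → ℝ) →ₗ[ℝ] (Fin k → ℝ))

/-- `γ` is a (nonconstant) periodic solution of `x' = F x` with minimal period `T`, and it is
normally hyperbolic: the Floquet multipliers are the complex roots of the characteristic polynomial
of the monodromy map `Φ T`; the multiplier `1` is algebraically simple, and no other multiplier lies
on the unit circle. -/
structure IsHyperbolicPeriodicOrbit {k : ℕ} (F : (Fin k → ℝ) → (Fin k → ℝ))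
    (γ : ℝ → (Fin k → ℝ)) (T : ℝ) : Prop where
  period_pos : 0 < T
  solution : ∀ t, HasDerivAt γ (F (γ t)) t
  periodic : Function.Periodic γ T
  minimal : ∀ t ∈ Ioo (0 : ℝ) T, γ t ≠ γ 0
  hyperbolic : ∃ Φ : ℝ → ((Fin k → ℝ) →L[ℝ] (Fin k → ℝ)), IsFundamentalSolution F γ Φ ∧
    (charpolyOf (Φ T)).rootMultiplicity 1 = 1 ∧
    ∀ μ : ℂ, ((charpolyOf (Φ T)).map (algebraMap ℝ ℂ)).IsRoot μ → ‖μ‖ = 1 → μ = 1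

/-! ### The delay system -/

/-- Coordinates of `ℝⁿ = ℝ^{d 0} × ⋯ × ℝ^{d (m-1)}`: the pair `⟨j, i⟩` is the `i`-th coordinate of
the `j`-th unit. -/
abbrev Coord {m : ℕ} (d : Fin m → ℕ) : Type := (j : Fin m) × Fin (d j)

/-- The delay equation `x'(t) = F(x(t)) + ε G(X(t,·))`, `X(t,s) = x(t+s)` for `s ∈ [-τ,0]`, where
`F = (F 0, …, F (m-1))` is uncoupled and the `j`-th uncoupled unit has the normally hyperbolic
periodic orbit `γ j` of period `T j`. The coupling strength `ε` is not part of the data. -/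
structure DelaySystem (m : ℕ) where
  d : Fin m → ℕ
  F : (j : Fin m) → (Fin (d j) → ℝ) → (Fin (d j) → ℝ)
  smooth_F : ∀ j, ContDiff ℝ ∞ (F j)
  γ : (j : Fin m) → ℝ → (Fin (d j) → ℝ)
  T : Fin m → ℝ
  orbit : ∀ j, IsHyperbolicPeriodicOrbit (F j) (γ j) (T j)
  τ : ℝ
  τ_pos : 0 < τ
  G : C(Icc (-τ) (0 : ℝ), Coord d → ℝ) → (Coord d → ℝ)
  smooth_G : ContDiff ℝ ∞ G

variable {m : ℕ}

/-- The state space `ℝⁿ`. -/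
abbrev DelaySystem.State (S : DelaySystem m) : Type := Coord S.d → ℝ

/-- The complexified state space `ℂⁿ`. -/
abbrev DelaySystem.CState (S : DelaySystem m) : Type := Coord S.d → ℂ

/-- The uncoupled vector field `F(x) = (F₁(x₁), …, F_m(x_m))` on `ℝⁿ`. -/
def DelaySystem.field (S : DelaySystem m) (x : S.State) : S.State :=
  fun p => S.F p.1 (fun i => x ⟨p.1, i⟩) p.2

/-- The frequencies `ω_j = 2π / T_j`. -/
def DelaySystem.freq (S : DelaySystem m) : Fin m → ℝ := fun j => 2 * Real.pi / S.T j

/-- The unperturbed torus `e⁰(φ) = (γ_j(φ_j / ω_j))_j`. -/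
def DelaySystem.e₀ (S : DelaySystem m) (φ : Fin m → ℝ) : S.State :=
  fun p => S.γ p.1 (φ p.1 / S.freq p.1) p.2

/-- Its history `E⁰(φ, s) = (γ_j(φ_j / ω_j + s))_j`. -/
def DelaySystem.E₀ (S : DelaySystem m) (φ : Fin m → ℝ) (s : ℝ) : S.State :=
  fun p => S.γ p.1 (φ p.1 / S.freq p.1 + s) p.2

/-- The history segment `s ↦ u s`, `s ∈ [-τ, 0]`, as an element of `C([-τ,0], ℝⁿ)` (it is `0` if `u`
is not continuous on `[-τ, 0]`, which does not occur below). -/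
def DelaySystem.hist (S : DelaySystem m) (u : ℝ → S.State) :
    C(Icc (-S.τ) (0 : ℝ), Coord S.d → ℝ) :=
  ContinuousMap.mkD ((Icc (-S.τ) (0 : ℝ)).domRestrict u) 0

/-! ### Functions on the torus, as `2π`-periodic functions of `φ ∈ ℝᵐ` -/

/-- `u` is `2π`-periodic in every variable, i.e. a function on the torus `(ℝ/2πℤ)ᵐ`. -/
def TorusPeriodic {β : Type*} (u : (Fin m → ℝ) → β) : Prop :=
  ∀ (φ : Fin m → ℝ) (k : Fin m → ℤ), u (fun j => φ j + 2 * Real.pi * (k j : ℝ)) = u φ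

/-- `u` is a smooth function on the torus. -/
def SmoothTorus {β : Type*} [NormedAddCommGroup β] [NormedSpace ℝ β]
    (u : (Fin m → ℝ) → β) : Prop :=
  ContDiff ℝ ∞ u ∧ TorusPeriodic u

/-- `E` is a smooth function on (torus) `× [-τ, 0]`; values outside `[-τ, 0]` are irrelevant. -/
def SmoothTorusHist {β : Type*} [NormedAddCommGroup β] [NormedSpace ℝ β] (τ : ℝ)
    (E : (Fin m → ℝ) → ℝ → β) : Prop :=
  ContDiffOn ℝ ∞ (fun q : (Fin m → ℝ) × ℝ => E q.1 q.2) (univ ×ˢ Icc (-τ) 0) ∧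
    ∀ s ∈ Icc (-τ) 0, TorusPeriodic (fun φ => E φ s)

/-- `⟨k, w⟩` for an integer vector `k`. -/
def resonance (w : Fin m → ℝ) (k : Fin m → ℤ) : ℝ := ∑ j, (k j : ℝ) * w j

/-- `k`-th Fourier coefficient
`(2π)⁻ᵐ ∫_{(0,2π]ᵐ} e^{-i⟨k,φ⟩} u(φ) dφ` of a vector-valued function on the torus. -/
def torusFourierCoeff {ι : Type*} (u : (Fin m → ℝ) → ι → ℂ) (k : Fin m → ℤ) : ι → ℂ :=
  fun i => (((2 * Real.pi) ^ m : ℝ) : ℂ)⁻¹ *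
    ∫ φ in Set.pi univ (fun _ : Fin m => Ioc (0 : ℝ) (2 * Real.pi)),
      Complex.exp (-(Complex.I * (resonance φ k : ℂ))) * u φ i

/-- A real vector, seen as a complex vector. -/
def toC {ι : Type*} (x : ι → ℝ) : ι → ℂ := fun i => (x i : ℂ)

/-- Complexification of a real linear map. -/
def complexify {ι κ : Type*} [Fintype ι] [Fintype κ] (A : (ι → ℝ) →L[ℝ] (κ → ℝ)) (z : ι → ℂ) :
    κ → ℂ :=
  toC (A fun i => (z i).re) + Complex.I • toC (A fun i => (z i).im)

/-- `f` is in normal form up to Fourier order `K`: `f̂_k = 0` whenever `⟨w,k⟩ ≠ 0` and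
`|k₁| + ⋯ + |k_m| ≤ K`. -/
def InNormalForm (w : Fin m → ℝ) (K : ℕ) (f : (Fin m → ℝ) → (Fin m → ℝ)) : Prop :=
  ∀ k : Fin m → ℤ, resonance w k ≠ 0 → ∑ j, |k j| ≤ (K : ℤ) →
    torusFourierCoeff (fun φ => toC (f φ)) k = 0

/-! ### The conjugacy equations -/

namespace DelaySystem

variable (S : DelaySystem m)

/-- Defect of `∂_φ e · f = F(e) + ε G(E(φ,·))`. -/
def defectFin (ε : ℝ) (f : (Fin m → ℝ) → (Fin m → ℝ)) (e : (Fin m → ℝ) → S.State)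
    (E : (Fin m → ℝ) → ℝ → S.State) (φ : Fin m → ℝ) : S.State :=
  fderiv ℝ e φ (f φ) - (S.field (e φ) + ε • S.G (S.hist (E φ)))

/-- Defect of `∂_φ E · f = ∂_s E`. -/
def defectTr (f : (Fin m → ℝ) → (Fin m → ℝ)) (E : (Fin m → ℝ) → ℝ → S.State)
    (φ : Fin m → ℝ) (s : ℝ) : S.State :=
  fderiv ℝ (fun ψ => E ψ s) φ (f φ) - derivWithin (E φ) (Icc (-S.τ) 0) s

/-- Defect of `e(φ) = E(φ, 0)`. -/
def defectBc (e : (Fin m → ℝ) → S.State) (E : (Fin m → ℝ) → ℝ → S.State)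
    (φ : Fin m → ℝ) : S.State :=
  e φ - E φ 0

/-- Coefficients of formal expansions `f^ε = ∑ ε^ℓ f^ℓ`, `e^ε = ∑ ε^ℓ e^ℓ`, `E^ε = ∑ ε^ℓ E^ℓ`. -/
structure Expansion where
  f : ℕ → (Fin m → ℝ) → (Fin m → ℝ)
  e : ℕ → (Fin m → ℝ) → S.State
  E : ℕ → (Fin m → ℝ) → ℝ → S.State

variable {S}

/-- All coefficients are smooth functions on the torus (times `[-τ,0]`), and the zeroth-order ones
are `f⁰ = ω`, `e⁰`, `E⁰`. -/
structure Expansion.Admissible (c : S.Expansion) : Prop where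
  smooth_f : ∀ ℓ, SmoothTorus (c.f ℓ)
  smooth_e : ∀ ℓ, SmoothTorus (c.e ℓ)
  smooth_E : ∀ ℓ, SmoothTorusHist S.τ (c.E ℓ)
  f_zero : ∀ φ, c.f 0 φ = S.freq
  e_zero : ∀ φ, c.e 0 φ = S.e₀ φ
  E_zero : ∀ φ, ∀ s ∈ Icc (-S.τ) 0, c.E 0 φ s = S.E₀ φ s

/-- Truncation at order `M`: `f^ε = ∑_{ℓ ≤ M} ε^ℓ f^ℓ`. -/
def Expansion.fTrunc (c : S.Expansion) (M : ℕ) (ε : ℝ) (φ : Fin m → ℝ) : Fin m → ℝ :=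
  ∑ ℓ ∈ Finset.range (M + 1), ε ^ ℓ • c.f ℓ φ

/-- Truncation at order `M`: `e^ε = ∑_{ℓ ≤ M} ε^ℓ e^ℓ`. -/
def Expansion.eTrunc (c : S.Expansion) (M : ℕ) (ε : ℝ) (φ : Fin m → ℝ) : S.State :=
  ∑ ℓ ∈ Finset.range (M + 1), ε ^ ℓ • c.e ℓ φ

/-- Truncation at order `M`: `E^ε = ∑_{ℓ ≤ M} ε^ℓ E^ℓ`. -/
def Expansion.ETrunc (c : S.Expansion) (M : ℕ) (ε : ℝ) (φ : Fin m → ℝ) (s : ℝ) : S.State :=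
  ∑ ℓ ∈ Finset.range (M + 1), ε ^ ℓ • c.E ℓ φ s

/-- The expansion solves the three conjugacy equations up to order `M`: the truncations at order `M`
satisfy them up to an error `O(ε^{M+1})`, uniformly on the torus and on `[-τ,0]`. -/
def Expansion.SolvesUpTo (c : S.Expansion) (M : ℕ) : Prop :=
  ∃ C δ : ℝ, 0 < δ ∧ ∀ ε : ℝ, |ε| < δ → ∀ φ : Fin m → ℝ,
    ‖S.defectFin ε (c.fTrunc M ε) (c.eTrunc M ε) (c.ETrunc M ε) φ‖ ≤ C * |ε| ^ (M + 1) ∧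
    (∀ s ∈ Icc (-S.τ) 0,
      ‖S.defectTr (c.fTrunc M ε) (c.ETrunc M ε) φ s‖ ≤ C * |ε| ^ (M + 1)) ∧
    ‖S.defectBc (c.eTrunc M ε) (c.ETrunc M ε) φ‖ ≤ C * |ε| ^ (M + 1)

/-! ### The homological equations -/

/-- The right-hand side `η^ℓ`: the `ε^ℓ`-coefficient of
`F(∑_{k<ℓ} ε^k e^k) + ε G(∑_{k<ℓ} ε^k E^k)`, minus `∑_{0<k<ℓ} ∂_φ e^k · f^{ℓ-k}`.
It involves only coefficients of order less than `ℓ`. -/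
def Expansion.eta (c : S.Expansion) (ℓ : ℕ) (φ : Fin m → ℝ) : S.State :=
  (Nat.factorial ℓ : ℝ)⁻¹ • iteratedDeriv ℓ (fun ε : ℝ =>
      S.field (∑ k ∈ Finset.range ℓ, ε ^ k • c.e k φ) +
        ε • S.G (∑ k ∈ Finset.range ℓ, ε ^ k • S.hist (c.E k φ))) 0
    - ∑ k ∈ Finset.Ico 1 ℓ, fderiv ℝ (c.e k) φ (c.f (ℓ - k) φ)

/-- The right-hand side `H^ℓ = -∑_{0<k<ℓ} ∂_φ E^k · f^{ℓ-k}`. -/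
def Expansion.Hrhs (c : S.Expansion) (ℓ : ℕ) (φ : Fin m → ℝ) (s : ℝ) : S.State :=
  -∑ k ∈ Finset.Ico 1 ℓ, fderiv ℝ (fun ψ => c.E k ψ s) φ (c.f (ℓ - k) φ)

variable (S)

/-- `∂_ω e - F'(e⁰) e + ∂_φ e⁰ · f = η` on the torus. -/
def HomFin (f : (Fin m → ℝ) → (Fin m → ℝ)) (e η : (Fin m → ℝ) → S.State) : Prop :=
  ∀ φ, fderiv ℝ e φ S.freq - fderiv ℝ S.field (S.e₀ φ) (e φ) + fderiv ℝ S.e₀ φ (f φ) = η φ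

/-- `∂_ω E - ∂_s E + ∂_φ E⁰ · f = H` on the torus times `[-τ,0]`. -/
def HomTr (f : (Fin m → ℝ) → (Fin m → ℝ)) (E H : (Fin m → ℝ) → ℝ → S.State) : Prop :=
  ∀ φ, ∀ s ∈ Icc (-S.τ) 0,
    fderiv ℝ (fun ψ => E ψ s) φ S.freq - derivWithin (E φ) (Icc (-S.τ) 0) s
      + fderiv ℝ (fun ψ => S.E₀ ψ s) φ (f φ) = H φ s

variable {S}

/-- The `ℓ`-th order homological equations, with the boundary condition `e^ℓ(φ) = E^ℓ(φ,0)`. -/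
def Expansion.Homological (c : S.Expansion) (ℓ : ℕ) : Prop :=
  S.HomFin (c.f ℓ) (c.e ℓ) (c.eta ℓ) ∧ S.HomTr (c.f ℓ) (c.E ℓ) (c.Hrhs ℓ) ∧
    ∀ φ, c.e ℓ φ = c.E ℓ φ 0

variable (S)

/-- The explicit solution of the transport equation:
`e(φ+sω) + ∂_φ E⁰(φ,s) · ∫₀ˢ f(φ+ω(s-ζ)) dζ - ∫₀ˢ H(φ+ω(s-ζ), ζ) dζ`. -/
def transportSolution (f : (Fin m → ℝ) → (Fin m → ℝ)) (e : (Fin m → ℝ) → S.State)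
    (H : (Fin m → ℝ) → ℝ → S.State) (φ : Fin m → ℝ) (s : ℝ) : S.State :=
  e (φ + s • S.freq)
    + fderiv ℝ (fun ψ => S.E₀ ψ s) φ (∫ ζ in (0 : ℝ)..s, f (φ + (s - ζ) • S.freq))
    - ∫ ζ in (0 : ℝ)..s, H (φ + (s - ζ) • S.freq) ζ

/-! ### Tangential and normal coordinates -/

/-- `T(φ) = ∂_φ e⁰(φ)`, acting on complex vectors. -/
def tangent (φ : Fin m → ℝ) (v : Fin m → ℂ) : S.CState := complexify (fderiv ℝ S.e₀ φ) v

/-- The dimension `n - m` of the normal directions. -/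
abbrev codim : ℕ := (∑ j, S.d j) - m

/-- A Floquet frame of the unperturbed torus: a smooth family `N(φ) : ℂ^{n-m} → ℂⁿ` on the torus and
a hyperbolic matrix `L`, such that `T(φ)` and `N(φ)` are injective with `im T(φ) ⊕ im N(φ) = ℂⁿ`,
and `∂_ω N + N L = F'(e⁰) N`. -/
structure FloquetFrame where
  N : (Fin m → ℝ) → ((Fin S.codim → ℂ) →L[ℂ] S.CState)
  L : Matrix (Fin S.codim) (Fin S.codim) ℂ
  smooth : SmoothTorus N
  hyperbolic : ∀ μ ∈ spectrum ℂ L, μ.re ≠ 0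
  transverse : ∀ φ, Function.Bijective
    (fun q : (Fin m → ℂ) × (Fin S.codim → ℂ) => S.tangent φ q.1 + N φ q.2)
  floquet : ∀ φ (w : Fin S.codim → ℂ), fderiv ℝ N φ S.freq w + N φ (L.mulVec w) =
    complexify (fderiv ℝ S.field (S.e₀ φ)) (N φ w)

variable {S}

/-- The coordinates `(v, w)` of `z = T(φ) v + N(φ) w`. -/
def FloquetFrame.coords (A : S.FloquetFrame) (φ : Fin m → ℝ) :
    S.CState ≃ (Fin m → ℂ) × (Fin S.codim → ℂ) :=
  (Equiv.ofBijective _ (A.transverse φ)).symm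

/-- `T(φ)⁺`, the left inverse of `T(φ)` that vanishes on `im N(φ)`. -/
def FloquetFrame.tangentInv (A : S.FloquetFrame) (φ : Fin m → ℝ) (z : S.CState) : Fin m → ℂ :=
  (A.coords φ z).1

/-- `N(φ)⁺`, the left inverse of `N(φ)` that vanishes on `im T(φ)`. -/
def FloquetFrame.normalInv (A : S.FloquetFrame) (φ : Fin m → ℝ) (z : S.CState) :
    Fin S.codim → ℂ :=
  (A.coords φ z).2

/-- The projection `π(φ)` onto `im T(φ)` along `im N(φ)`. -/
def FloquetFrame.proj (A : S.FloquetFrame) (φ : Fin m → ℝ) (z : S.CState) : S.CState :=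
  S.tangent φ (A.tangentInv φ z)

/-- `e = T g + N h`. -/
def FloquetFrame.Decomposes (A : S.FloquetFrame) (e : (Fin m → ℝ) → S.State)
    (g : (Fin m → ℝ) → (Fin m → ℝ)) (h : (Fin m → ℝ) → (Fin S.codim → ℂ)) : Prop :=
  ∀ φ, toC (e φ) = S.tangent φ (toC (g φ)) + A.N φ (h φ)

/-- The tangential equation `T [∂_ω g + f] = π η`. -/
def FloquetFrame.HomTangent (A : S.FloquetFrame) (g f : (Fin m → ℝ) → (Fin m → ℝ))
    (η : (Fin m → ℝ) → S.State) : Prop :=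
  ∀ φ, S.tangent φ (toC (fderiv ℝ g φ S.freq + f φ)) = A.proj φ (toC (η φ))

/-- The normal equation `N [∂_ω h - L h] = (I - π) η`. -/
def FloquetFrame.HomNormal (A : S.FloquetFrame) (h : (Fin m → ℝ) → (Fin S.codim → ℂ))
    (η : (Fin m → ℝ) → S.State) : Prop :=
  ∀ φ, A.N φ (fderiv ℝ h φ S.freq - A.L.mulVec (h φ)) = toC (η φ) - A.proj φ (toC (η φ))

/-- Fourier coefficients of `ζ = T⁺ π η`. -/
def FloquetFrame.zetaHat (A : S.FloquetFrame) (η : (Fin m → ℝ) → S.State) (k : Fin m → ℤ) :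
    Fin m → ℂ :=
  torusFourierCoeff (fun φ => A.tangentInv φ (A.proj φ (toC (η φ)))) k

/-- Fourier coefficients of `κ = N⁺ (I - π) η`. -/
def FloquetFrame.kappaHat (A : S.FloquetFrame) (η : (Fin m → ℝ) → S.State) (k : Fin m → ℤ) :
    Fin S.codim → ℂ :=
  torusFourierCoeff (fun φ => A.normalInv φ (toC (η φ) - A.proj φ (toC (η φ)))) k

end DelaySystem

end DelayPhase

end

/-! For an admissible expansion every defect of a truncation is, at fixed `φ` and `s`, a smooth
function of `ε`, and its `ℓ`-th Taylor coefficient at `0` is the defect of the `ℓ`-th homological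
equation for `1 ≤ ℓ ≤ M`. The products contribute Cauchy sums. In the forcing, the top coefficient
`e^ℓ` enters only through `F'(e⁰)`, because `E^ℓ` comes with an additional factor `ε`
(`iteratedDeriv_forcing`). A smooth function of `ε` is `O(ε^{M+1})` exactly when its Taylor
coefficients up to `M` vanish; joint smoothness and compactness make the bound uniform in `φ` and
`s`. This is `Admissible.solvesUpTo_iff`.

The finite-dimensional homological equation is solved in a Floquet frame. For a single orbit,
simplicity of the multiplier `1` gives a complement of the velocity that is invariant under the
monodromy map. A complex logarithm of the restricted map (`exists_exp_eq`) turns the transported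
complement into a periodic frame with constant matrix (`exists_floquet`), and the blocks of all
units together form a frame. In this frame `∂_ω - F'(e⁰)` becomes `∂_ω` on tangential and `∂_ω - L`
on normal coordinates (`variational_combine`).

Tangentially, only finitely many Fourier modes have to be removed from `f`. Hence `g` is a
trigonometric polynomial, and small divisors play no role (`exists_normalForm`). In the normal
directions, the Cayley-Hamilton theorem factors `L` into scalar problems `∂_ω - μ` with `Re μ ≠ 0`.
Each is inverted by an exponentially convergent integral along the linear flow, and boundedness on
the torus gives uniqueness (`system_exists`, `system_unique`).

The frame is complex but the solution has to be real. The tangential components of the conjugated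
columns of `N` satisfy a hyperbolic linear system and therefore vanish, so `im N` is stable under
conjugation (`tangentInv_star_normal`). With uniqueness for the normal equation, `Tg + Nh` is real.

The transport equation is integrated along characteristics. The coefficients `E^k` are given only on
`[-τ, 0]`, but uniqueness identifies them with the integral formula, which extends smoothly to all
times (`eq_transportExt`, `Admissible.exists_extends`). Therefore `φ ↦ E^k(φ, ·)` is smooth with
values in `C([-τ, 0], ℝⁿ)` (`contDiff_curryIcc`), `η^ℓ` is smooth, and the recursion can continue.
-/

namespace DelayPhase

open Filter Topology

/-! ### Smooth families of continuous functions and parametric integrals -/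

section Curry

universe u
variable {E : Type u} [NormedAddCommGroup E] [NormedSpace ℝ E]

/-- The section `s ↦ g (x, s)` as a continuous function on `[a, b]`. -/
noncomputable def curryIcc {V : Type*} [NormedAddCommGroup V] (a b : ℝ) (g : E × ℝ → V)
    (hg : Continuous g) (x : E) : C(Icc a b, V) :=
  ⟨fun s => g (x, s), by fun_prop⟩

/-- Pointwise evaluation of a continuous family of linear maps, as a continuous linear map. -/
noncomputable def evalFamily (a b : ℝ) (V : Type*) [NormedAddCommGroup V] [NormedSpace ℝ V] :
    C(Icc a b, E →L[ℝ] V) →L[ℝ] E →L[ℝ] C(Icc a b, V) :=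
  LinearMap.mkContinuous₂
    (LinearMap.mk₂ ℝ (fun (A : C(Icc a b, E →L[ℝ] V)) (h : E) =>
        (⟨fun s => A s h, by fun_prop⟩ : C(Icc a b, V)))
      (fun _ _ _ => by ext; simp) (fun _ _ _ => by ext; simp)
      (fun _ _ _ => by ext; simp) (fun _ _ _ => by ext; simp)) 1
    (fun A h => by
      rw [ContinuousMap.norm_le _ (by positivity)]
      intro s
      rw [one_mul]
      exact (ContinuousLinearMap.le_opNorm _ _).trans
        (mul_le_mul_of_nonneg_right (A.norm_coe_le_norm s) (norm_nonneg _)))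

/-- Compactness of `[a, b]` makes the oscillation of the partial derivative near `x` small uniformly
in `s`; the mean value inequality on a ball then bounds the remainder in the sup norm. -/
theorem hasFDerivAt_curryIcc {V : Type*} [NormedAddCommGroup V] [NormedSpace ℝ V] (a b : ℝ)
    {g : E × ℝ → V} (hg : Continuous g) {g' : E × ℝ → E →L[ℝ] V} (hg' : Continuous g')
    (h : ∀ x s, HasFDerivAt (fun y => g (y, s)) (g' (x, s)) x) (x : E) :
    HasFDerivAt (curryIcc a b g hg) (evalFamily a b V (curryIcc a b g' hg' x)) x := by
  rw [hasFDerivAt_iff_isLittleO, Asymptotics.isLittleO_iff]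
  intro c hc
  have key : ∀ᶠ y in 𝓝 x, ∀ s ∈ Icc a b, ‖g' (y, s) - g' (x, s)‖ < c := by
    have := (isCompact_Icc (a := a) (b := b)).eventually_forall_of_forall_eventually
      (x₀ := x) (P := fun y s => ‖g' (y, s) - g' (x, s)‖ < c) (by
        intro s _
        have hcont : Continuous fun z : E × ℝ => ‖g' (z.1, z.2) - g' (x, z.2)‖ := by fun_prop
        exact hcont.continuousAt.eventually_lt continuousAt_const (by simpa using hc))
    exact this
  obtain ⟨r, hr, hball⟩ := Metric.eventually_nhds_iff_ball.1 key
  filter_upwards [Metric.ball_mem_nhds x hr] with y hy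
  rw [ContinuousMap.norm_le _ (by positivity)]
  intro s
  have := (convex_ball x r).norm_image_sub_le_of_norm_hasFDerivWithin_le'
    (f := fun y => g (y, (s : ℝ))) (f' := fun y => g' (y, (s : ℝ))) (φ := g' (x, s)) (C := c)
    (fun z _ => (h z s).hasFDerivWithinAt) (fun z hz => (hball z hz s s.2).le)
    (Metric.mem_ball_self hr) hy
  simpa [curryIcc, evalFamily] using this

/-- The derivative is the fixed bounded operator `evalFamily` applied to the curried partial
derivative, so each induction step gains one order. The target changes from `V` to `E →L[ℝ] V`,
hence the quantification over `V` inside the induction and the common universe of `E` and `V`. -/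
theorem contDiff_curryIcc_nat (a b : ℝ) (n : ℕ) : ∀ {V : Type u} [NormedAddCommGroup V]
    [NormedSpace ℝ V] {g : E × ℝ → V} (hg : ContDiff ℝ ∞ g),
    ContDiff ℝ n (curryIcc a b g hg.continuous) := by
  induction n with
  | zero =>
    intro V _ _ g hg
    simp only [Nat.cast_zero, contDiff_zero]
    have h0 := hg.differentiable (by simp)
    refine continuous_iff_continuousAt.2 fun x => (hasFDerivAt_curryIcc a b hg.continuous
      (g' := fun p => (fderiv ℝ g p).comp (ContinuousLinearMap.inl ℝ E ℝ)) ?_ ?_ x).continuousAt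
    · have := hg.continuous_fderiv (by simp)
      fun_prop
    · intro x s
      exact (h0 (x, s)).hasFDerivAt.comp x (hasFDerivAt_prodMk_left x s)
  | succ n ih =>
    intro V _ _ g hg
    have h0 := hg.differentiable (by simp)
    have hg' : ContDiff ℝ ∞ fun p => (fderiv ℝ g p).comp (ContinuousLinearMap.inl ℝ E ℝ) :=
      (hg.fderiv_right (m := ∞) (by simp)).clm_comp contDiff_const
    have hd := hasFDerivAt_curryIcc a b hg.continuous hg'.continuous (fun x s =>
      (h0 (x, s)).hasFDerivAt.comp x (hasFDerivAt_prodMk_left x s))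
    push_cast
    rw [contDiff_succ_iff_fderiv]
    refine ⟨fun x => (hd x).differentiableAt, by simp, ?_⟩
    have : fderiv ℝ (curryIcc a b g hg.continuous) =
        fun x => evalFamily a b V (curryIcc a b _ hg'.continuous x) :=
      funext fun x => (hd x).fderiv
    rw [this]
    have hΛ : ContDiff ℝ n (evalFamily (E := E) a b V) := by
      refine ContinuousLinearMap.contDiff (𝕜 := ℝ) (E := C(Icc a b, E →L[ℝ] V))
        (F := E →L[ℝ] C(Icc a b, V)) (n := n) ?_
    exact hΛ.comp (ih hg')

theorem contDiff_curryIcc {V : Type u} [NormedAddCommGroup V] [NormedSpace ℝ V] (a b : ℝ)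
    {g : E × ℝ → V} (hg : ContDiff ℝ ∞ g) :
    ContDiff ℝ ∞ (curryIcc a b g hg.continuous) :=
  contDiff_infty.2 fun n => contDiff_curryIcc_nat a b n hg

/-- Integration over `[0, 1]` is a bounded linear map on `C([0, 1], V)`, so differentiation under
the integral is the chain rule for the curried map. -/
theorem contDiff_integral_unit {V : Type u} [NormedAddCommGroup V] [NormedSpace ℝ V]
    [CompleteSpace V] {g : E × ℝ → V} (hg : ContDiff ℝ ∞ g) :
    ContDiff ℝ ∞ fun x => ∫ θ in (0 : ℝ)..1, g (x, θ) := by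
  let J : C(Icc (0 : ℝ) 1, V) →L[ℝ] V := LinearMap.mkContinuous
    { toFun := fun u => ∫ θ : Icc (0 : ℝ) 1, u θ
      map_add' := fun u v => MeasureTheory.integral_add
        (u.continuous.integrable_of_hasCompactSupport (HasCompactSupport.of_compactSpace _))
        (v.continuous.integrable_of_hasCompactSupport (HasCompactSupport.of_compactSpace _))
      map_smul' := fun c u => MeasureTheory.integral_smul c _ } 1 (fun u => by
        have := MeasureTheory.norm_integral_le_of_norm_le_const
          (μ := (MeasureTheory.volume : MeasureTheory.Measure (Icc (0 : ℝ) 1))) (f := u) (C := ‖u‖)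
          (Eventually.of_forall fun x => u.norm_coe_le_norm x)
        simpa [MeasureTheory.Measure.real, mul_comm] using this)
  have : (fun x => ∫ θ in (0 : ℝ)..1, g (x, θ)) = fun x => J (curryIcc 0 1 g hg.continuous x) := by
    funext x
    rw [intervalIntegral.integral_of_le zero_le_one, ← MeasureTheory.integral_Icc_eq_integral_Ioc]
    exact (MeasureTheory.integral_subtype measurableSet_Icc (fun θ => g (x, θ))).symm
  rw [this]
  exact J.contDiff.comp (contDiff_curryIcc 0 1 hg)

/-- Rescaling to the unit interval moves the variable endpoint into the integrand. -/
theorem contDiff_integral_upper {V : Type u} [NormedAddCommGroup V] [NormedSpace ℝ V]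
    [CompleteSpace V] {g : E × ℝ → V} (hg : ContDiff ℝ ∞ g) {t : E → ℝ} (ht : ContDiff ℝ ∞ t) :
    ContDiff ℝ ∞ fun x => ∫ θ in (0 : ℝ)..t x, g (x, θ) := by
  have : (fun x => ∫ θ in (0 : ℝ)..t x, g (x, θ)) =
      fun x => t x • ∫ θ in (0 : ℝ)..1, g (x, t x * θ) := by
    funext x
    have := intervalIntegral.smul_integral_comp_mul_left (a := 0) (b := 1)
      (fun θ => g (x, θ)) (t x)
    simpa using this.symm
  rw [this]
  refine ht.smul (contDiff_integral_unit (g := fun p : E × ℝ => g (p.1, t p.1 * p.2)) ?_)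
  exact hg.comp (contDiff_fst.prodMk ((ht.comp contDiff_fst).mul contDiff_snd))

end Curry

/-! ### Taylor coefficients in a parameter -/

section Taylor

variable {V : Type*} [NormedAddCommGroup V] [NormedSpace ℝ V]

theorem contDiff_iteratedDeriv {n : ℕ} {g : ℝ → V} (hg : ContDiff ℝ ∞ g) :
    ContDiff ℝ ∞ (iteratedDeriv n g) := by
  induction n with
  | zero => simpa using hg
  | succ n ih =>
    rw [iteratedDeriv_succ]
    exact (contDiff_infty_iff_deriv.1 ih).2

theorem contDiff_iteratedDeriv_param {X : Type*} [NormedAddCommGroup X] [NormedSpace ℝ X]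
    {Ψ : ℝ × X → V} (hΨ : ContDiff ℝ ∞ Ψ) (n : ℕ) :
    ContDiff ℝ ∞ fun p : ℝ × X => iteratedDeriv n (fun ε => Ψ (ε, p.2)) p.1 := by
  induction n with
  | zero => simpa using hΨ
  | succ n ih =>
    set Θ : ℝ × X → V := fun p : ℝ × X => iteratedDeriv n (fun ε => Ψ (ε, p.2)) p.1 with hΘ
    have : (fun p : ℝ × X => iteratedDeriv (n + 1) (fun ε => Ψ (ε, p.2)) p.1) =
        fun p => fderiv ℝ Θ p (1, 0) := by
      funext p
      rw [iteratedDeriv_succ]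
      have h1 : HasFDerivAt Θ (fderiv ℝ Θ p) (p.1, p.2) :=
        (ih.differentiable (by simp) p).hasFDerivAt
      have h2 : HasDerivAt (fun ε : ℝ => (ε, p.2)) ((1 : ℝ), (0 : X)) p.1 :=
        (hasDerivAt_id p.1).prodMk (hasDerivAt_const _ _)
      exact (h1.comp_hasDerivAt p.1 h2).deriv
    rw [this]
    exact (ih.fderiv_right (m := ∞) (by simp)).clm_apply contDiff_const

/-- The mean value inequality is applied from `0` once per order, with `g` replaced by `deriv g`.
The factor `1/(M+1)!` is discarded since only the order in `x` matters. -/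
theorem norm_le_of_iteratedDeriv_eq_zero {C : ℝ} : ∀ (M : ℕ) {g : ℝ → V} {r : ℝ},
    ContDiff ℝ ∞ g → (∀ k ≤ M, iteratedDeriv k g 0 = 0) →
    (∀ x, |x| ≤ r → ‖iteratedDeriv (M + 1) g x‖ ≤ C) →
    ∀ x, |x| ≤ r → ‖g x‖ ≤ C * |x| ^ (M + 1) := by
  have mv : ∀ {g : ℝ → V} {x B : ℝ}, ContDiff ℝ ∞ g → g 0 = 0 →
      (∀ y, |y| ≤ |x| → ‖deriv g y‖ ≤ B) → ‖g x‖ ≤ B * |x| := by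
    intro g x B hg h0 hB
    have := (convex_Icc (-|x|) |x|).norm_image_sub_le_of_norm_deriv_le (f := g) (C := B)
      (fun y _ => hg.differentiable (by simp) y) (fun y hy => hB y (abs_le.2 hy))
      (x := 0) (y := x) ⟨by simp, abs_nonneg x⟩ ⟨neg_abs_le x, le_abs_self x⟩
    simpa [h0] using this
  intro M
  induction M with
  | zero =>
    intro g r hg h0 hC x hx
    have := mv (x := x) (B := C) hg (by simpa using h0 0 le_rfl)
      (fun y hy => by simpa [iteratedDeriv_one] using hC y (hy.trans hx))
    simpa using this
  | succ M ih =>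
    intro g r hg h0 hC x hx
    have hd : ∀ y, |y| ≤ r → ‖deriv g y‖ ≤ C * |y| ^ (M + 1) :=
      ih (g := deriv g) (contDiff_infty_iff_deriv.1 hg).2
        (fun k hk => by rw [← iteratedDeriv_succ']; exact h0 (k + 1) (by omega))
        (fun y hy => by rw [← iteratedDeriv_succ']; exact hC y hy)
    have hC0 : 0 ≤ C := (norm_nonneg _).trans (hC x hx)
    have := mv (x := x) (B := C * |x| ^ (M + 1)) hg (by simpa using h0 0 (by omega))
      (fun y hy => (hd y (hy.trans hx)).trans (by gcongr))
    calc ‖g x‖ ≤ C * |x| ^ (M + 1) * |x| := this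
      _ = C * |x| ^ (M + 1 + 1) := by ring

/-- Joint smoothness bounds the `(M+1)`-st `ε`-derivative on the compact set `[-1, 1] × K`, which
makes the constant independent of `x`. -/
theorem exists_uniform_bound_of_iteratedDeriv_eq_zero {X : Type*} [NormedAddCommGroup X]
    [NormedSpace ℝ X] {Ψ : ℝ × X → V} (hΨ : ContDiff ℝ ∞ Ψ) {K : Set X} (hK : IsCompact K)
    (M : ℕ) (h0 : ∀ x ∈ K, ∀ k ≤ M, iteratedDeriv k (fun ε => Ψ (ε, x)) 0 = 0) :
    ∃ C, ∀ ε : ℝ, |ε| ≤ 1 → ∀ x ∈ K, ‖Ψ (ε, x)‖ ≤ C * |ε| ^ (M + 1) := by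
  obtain ⟨C, hC⟩ := ((isCompact_Icc (a := (-1 : ℝ)) (b := 1)).prod hK).exists_bound_of_continuousOn
    (contDiff_iteratedDeriv_param hΨ (M + 1)).continuous.continuousOn
  refine ⟨C, fun ε hε x hx => ?_⟩
  exact norm_le_of_iteratedDeriv_eq_zero (C := C) M (g := fun ε => Ψ (ε, x)) (r := 1)
    (hΨ.comp (contDiff_id.prodMk contDiff_const)) (h0 x hx)
    (fun y hy => hC (y, x) ⟨abs_le.1 hy, hx⟩) ε hε

open Asymptotics in
-- Once all lower derivatives vanish, `g` agrees with its monomial of order `k` up to `O(x^{k+1})`.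
-- That monomial is then `o(x^k)`, which forces its coefficient to be zero.
theorem iteratedDeriv_eq_zero_of_isLittleO {g : ℝ → V} (hg : ContDiff ℝ ∞ g) {M : ℕ}
    (h : g =o[𝓝 0] fun x : ℝ => x ^ M) : ∀ k ≤ M, iteratedDeriv k g 0 = 0 := by
  intro k
  induction k using Nat.strong_induction_on with
  | _ k ih =>
    intro hk
    set v := iteratedDeriv k g 0 with hv
    -- subtract the Taylor monomial of order `k`
    set q : ℝ → V := fun x => x ^ k • ((k.factorial : ℝ)⁻¹ • v) with hq
    have hqs : ContDiff ℝ ∞ q := by fun_prop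
    have hqd : ∀ j ≤ k, iteratedDeriv j q 0 = if j = k then v else 0 := by
      intro j hj
      have h1 : iteratedDeriv j q 0
          = (iteratedDeriv j (fun x : ℝ => x ^ k) 0) • ((k.factorial : ℝ)⁻¹ • v) := by
        simp only [hq]
        exact iteratedDeriv_smul_const (by fun_prop) _
      rw [h1, iteratedDeriv_fun_pow_zero]
      split_ifs with hjk
      · subst hjk
        have : (j.factorial : ℝ) ≠ 0 := by positivity
        simp [smul_smul, this]
      · simp
    have hgq : ∀ j ≤ k, iteratedDeriv j (g - q) 0 = 0 := by
      intro j hj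
      rw [iteratedDeriv_sub (hg.contDiffAt.of_le (by exact_mod_cast le_top))
        (hqs.contDiffAt.of_le (by exact_mod_cast le_top)), hqd j hj]
      split_ifs with hjk
      · simp [hjk, hv]
      · rw [ih j (by omega) (by omega), sub_zero]
    obtain ⟨C, hC⟩ := (isCompact_Icc (a := (-1 : ℝ)) (b := 1)).exists_bound_of_continuousOn
      (contDiff_iteratedDeriv (n := k + 1) (hg.sub hqs)).continuous.continuousOn
    have hb := norm_le_of_iteratedDeriv_eq_zero (C := C) k (hg.sub hqs) hgq (r := 1)
      (fun x hx => hC x (abs_le.1 hx))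
    have hO : (g - q) =o[𝓝 0] fun x : ℝ => x ^ k := by
      have : (g - q) =O[𝓝 0] fun x : ℝ => x ^ (k + 1) := by
        refine IsBigO.of_bound C ?_
        filter_upwards [Metric.closedBall_mem_nhds (0 : ℝ) one_pos] with x hx
        have := hb x (by simpa using hx)
        simpa using this
      exact this.trans_isLittleO (isLittleO_pow_pow (by omega))
    have hgo : g =o[𝓝 0] fun x : ℝ => x ^ k := by
      refine h.trans_isBigO ?_
      rcases hk.eq_or_lt with rfl | hlt
      · exact isBigO_refl _ _
      · exact (isLittleO_pow_pow hlt).isBigO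
    have hqo : q =o[𝓝 0] fun x : ℝ => x ^ k := by
      have := hgo.sub hO
      simpa using this
    have hne : (k.factorial : ℝ)⁻¹ ≠ 0 := by positivity
    have hw : (k.factorial : ℝ)⁻¹ • v = 0 := by
      by_contra hne'
      have hpos : 0 < ‖(k.factorial : ℝ)⁻¹ • v‖ := norm_pos_iff.2 hne'
      -- With half the norm of the coefficient as constant, the little-o bound fails at every
      -- nonzero point; `r / 2` serves as such a point.
      have h1 := (isLittleO_iff.1 hqo) (half_pos hpos)
      obtain ⟨r, hr, hball⟩ := Metric.eventually_nhds_iff.1 h1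
      have h2 := hball (y := r / 2) (by rw [Real.dist_eq, sub_zero, abs_of_pos (by linarith)]; linarith)
      simp only [hq, norm_smul (_ ^ _)] at h2
      have h3 : 0 < ‖(r / 2) ^ k‖ := norm_pos_iff.2 (by positivity)
      nlinarith
    exact (smul_eq_zero.1 hw).resolve_left hne

end Taylor

end DelayPhase

namespace DelayPhase

open Filter Topology

/-! ### Smooth functions on the torus -/

section Torus

variable {m : ℕ}

theorem exists_mem_box (φ : Fin m → ℝ) : ∃ k : Fin m → ℤ,
    (fun j => φ j + 2 * Real.pi * (k j : ℝ)) ∈ Set.pi univ fun _ : Fin m => Icc 0 (2 * Real.pi) := by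
  have h2 : (0 : ℝ) < 2 * Real.pi := by positivity
  refine ⟨fun j => -⌊φ j / (2 * Real.pi)⌋, fun j _ => ?_⟩
  have h := Int.floor_le (φ j / (2 * Real.pi))
  have h' := (Int.lt_floor_add_one (φ j / (2 * Real.pi))).le
  rw [le_div_iff₀ h2] at h
  rw [div_le_iff₀ h2] at h'
  push_cast
  constructor <;> linarith

theorem isCompact_box : IsCompact (Set.pi univ fun _ : Fin m => Icc (0 : ℝ) (2 * Real.pi)) :=
  isCompact_univ_pi fun _ => isCompact_Icc

/-- Reduction to a compact fundamental box: every bound uniform on the torus is obtained through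
this. -/
theorem TorusPeriodic.forall {β : Type*} {u : (Fin m → ℝ) → β} (hu : TorusPeriodic u)
    {p : β → Prop} (h : ∀ φ ∈ Set.pi univ fun _ : Fin m => Icc (0 : ℝ) (2 * Real.pi), p (u φ))
    (φ : Fin m → ℝ) : p (u φ) := by
  obtain ⟨k, hk⟩ := exists_mem_box φ
  rw [← hu φ k]
  exact h _ hk

theorem TorusPeriodic.exists_bound {β : Type*} [SeminormedAddCommGroup β] {u : (Fin m → ℝ) → β}
    (hu : TorusPeriodic u) (hc : Continuous u) : ∃ C, ∀ φ, ‖u φ‖ ≤ C := by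
  obtain ⟨C, hC⟩ := isCompact_box.exists_bound_of_continuousOn hc.continuousOn
  exact ⟨C, hu.forall (p := fun x => ‖x‖ ≤ C) hC⟩

theorem TorusPeriodic.comp {β γ : Type*} {u : (Fin m → ℝ) → β} (hu : TorusPeriodic u)
    (g : β → γ) : TorusPeriodic fun φ => g (u φ) := fun φ k => congrArg g (hu φ k)

theorem TorusPeriodic.comp₂ {β γ δ : Type*} {u : (Fin m → ℝ) → β} {v : (Fin m → ℝ) → γ}
    (hu : TorusPeriodic u) (hv : TorusPeriodic v) (g : β → γ → δ) :
    TorusPeriodic fun φ => g (u φ) (v φ) := fun φ k => congrArg₂ g (hu φ k) (hv φ k)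

theorem TorusPeriodic.translate {β : Type*} {u : (Fin m → ℝ) → β} (hu : TorusPeriodic u)
    (a : Fin m → ℝ) : TorusPeriodic fun φ => u (φ + a) := by
  intro φ k
  change _ = u (φ + a)
  rw [← hu (φ + a) k]
  change u _ = u _
  congr 1
  ext j
  simp only [Pi.add_apply]
  ring

section Normed

variable {β : Type*} [NormedAddCommGroup β] [NormedSpace ℝ β]

theorem TorusPeriodic.fderiv {u : (Fin m → ℝ) → β} (hu : TorusPeriodic u) :
    TorusPeriodic (fderiv ℝ u) := by
  intro φ k
  have h : u = fun ψ => u (ψ + fun j => 2 * Real.pi * (k j : ℝ)) :=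
    funext fun ψ => (hu ψ k).symm
  conv_rhs => rw [h]
  rw [fderiv_comp_add_right]
  rfl

theorem TorusPeriodic.iteratedFDeriv {u : (Fin m → ℝ) → β} (hu : TorusPeriodic u) (n : ℕ) :
    TorusPeriodic (iteratedFDeriv ℝ n u) := by
  intro φ k
  have h : u = fun ψ => u (ψ + fun j => 2 * Real.pi * (k j : ℝ)) :=
    funext fun ψ => (hu ψ k).symm
  conv_rhs => rw [h]
  rw [iteratedFDeriv_comp_add_right]
  rfl

theorem SmoothTorus.differentiable {u : (Fin m → ℝ) → β} (hu : SmoothTorus u) :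
    Differentiable ℝ u := hu.1.differentiable (by simp)

theorem SmoothTorus.fderiv {u : (Fin m → ℝ) → β} (hu : SmoothTorus u) :
    SmoothTorus (fderiv ℝ u) :=
  ⟨hu.1.fderiv_right (m := ∞) (by simp), hu.2.fderiv⟩

theorem SmoothTorus.comp {γ : Type*} [NormedAddCommGroup γ] [NormedSpace ℝ γ]
    {u : (Fin m → ℝ) → β} (hu : SmoothTorus u) {g : β → γ} (hg : ContDiff ℝ ∞ g) :
    SmoothTorus fun φ => g (u φ) := ⟨hg.comp hu.1, hu.2.comp g⟩

theorem SmoothTorus.const (c : β) : SmoothTorus fun _ : Fin m → ℝ => c :=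
  ⟨contDiff_const, fun _ _ => rfl⟩

theorem SmoothTorus.add {u v : (Fin m → ℝ) → β} (hu : SmoothTorus u) (hv : SmoothTorus v) :
    SmoothTorus fun φ => u φ + v φ := ⟨hu.1.add hv.1, hu.2.comp₂ hv.2 _⟩

theorem SmoothTorus.sub {u v : (Fin m → ℝ) → β} (hu : SmoothTorus u) (hv : SmoothTorus v) :
    SmoothTorus fun φ => u φ - v φ := ⟨hu.1.sub hv.1, hu.2.comp₂ hv.2 _⟩

theorem SmoothTorus.neg {u : (Fin m → ℝ) → β} (hu : SmoothTorus u) :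
    SmoothTorus fun φ => -u φ := ⟨hu.1.neg, hu.2.comp _⟩

theorem SmoothTorus.sum {α : Type*} {s : Finset α} {u : α → (Fin m → ℝ) → β}
    (hu : ∀ i ∈ s, SmoothTorus (u i)) : SmoothTorus fun φ => ∑ i ∈ s, u i φ :=
  ⟨ContDiff.sum fun i hi => (hu i hi).1, fun φ k => Finset.sum_congr rfl fun i hi => (hu i hi).2 φ k⟩

theorem SmoothTorus.clm_apply {γ : Type*} [NormedAddCommGroup γ] [NormedSpace ℝ γ]
    {A : (Fin m → ℝ) → β →L[ℝ] γ} {u : (Fin m → ℝ) → β} (hA : SmoothTorus A)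
    (hu : SmoothTorus u) : SmoothTorus fun φ => A φ (u φ) :=
  ⟨hA.1.clm_apply hu.1, hA.2.comp₂ hu.2 _⟩

theorem SmoothTorus.dirDeriv {u : (Fin m → ℝ) → β} (hu : SmoothTorus u) (w : Fin m → ℝ) :
    SmoothTorus fun φ => _root_.fderiv ℝ u φ w := hu.fderiv.clm_apply (SmoothTorus.const w)

end Normed

theorem hasDerivAt_line {β : Type*} [NormedAddCommGroup β] [NormedSpace ℝ β]
    {E : Type*} [NormedAddCommGroup E] [NormedSpace ℝ E]
    {u : E → β} (hu : Differentiable ℝ u) (φ w : E) (r : ℝ) :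
    HasDerivAt (fun r : ℝ => u (φ + r • w)) (fderiv ℝ u (φ + r • w) w) r := by
  have h : HasDerivAt (fun r : ℝ => φ + r • w) w r := by
    simpa using ((hasDerivAt_id r).smul_const w).const_add φ
  exact (hu _).hasFDerivAt.comp_hasDerivAt r h

theorem fderiv_apply_eq_of_hasDerivAt_line {β : Type*} [NormedAddCommGroup β] [NormedSpace ℝ β]
    {E : Type*} [NormedAddCommGroup E] [NormedSpace ℝ E]
    {u : E → β} (hu : Differentiable ℝ u) {φ w : E} {v : β}
    (h : HasDerivAt (fun r : ℝ => u (φ + r • w)) v 0) : fderiv ℝ u φ w = v := by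
  have := (hasDerivAt_line hu φ w 0).unique h
  simpa using this

end Torus

/-! ### Linear equations with constant coefficients along a linear flow on the torus -/

section Linear

variable {m : ℕ} {ι : Type} [Fintype ι]

/-- Along each line in direction `w` the solution is a multiple of `e^{μ r}`, which is unbounded as
`r / Re μ → ∞` or in the reverse time if `Re μ < 0`, whereas a continuous function on the torus is
bounded. -/
theorem scalar_unique {w : Fin m → ℝ} {μ : ℂ} (hμ : μ.re ≠ 0) {u : (Fin m → ℝ) → ι → ℂ}
    (hu : SmoothTorus u) (h : ∀ φ, fderiv ℝ u φ w = μ • u φ) : ∀ φ, u φ = 0 := by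
  intro φ
  by_contra hne
  obtain ⟨C, hC⟩ := hu.2.exists_bound hu.1.continuous
  have hd : ∀ r : ℝ, HasDerivAt (fun r : ℝ => Complex.exp (-(μ * r)) • u (φ + r • w)) 0 r := by
    intro r
    have h1 : HasDerivAt (fun r : ℝ => Complex.exp (-(μ * r)))
        (Complex.exp (-(μ * r)) * -(μ * 1)) r :=
      (((Complex.ofRealCLM.hasDerivAt (x := r)).const_mul μ).neg).cexp
    have := h1.smul (hasDerivAt_line hu.differentiable φ w r)
    rw [h] at this
    refine this.congr_deriv ?_
    rw [smul_smul]
    simp only [mul_one, mul_neg, neg_smul]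
    exact add_neg_cancel _
  have hcst : ∀ r : ℝ, Complex.exp (-(μ * r)) • u (φ + r • w) = u φ := by
    intro r
    have := is_const_of_deriv_eq_zero (fun r => (hd r).differentiableAt) (fun r => (hd r).deriv) r 0
    simpa using this
  have hb : ∀ t : ℝ, Real.exp t * ‖u φ‖ ≤ C := by
    intro t
    have h1 := hcst (t / μ.re)
    have h2 : ‖Complex.exp (-(μ * ((t / μ.re : ℝ) : ℂ)))‖ = Real.exp (-t) := by
      rw [Complex.norm_exp]
      congr 1
      simp only [Complex.neg_re, Complex.re_mul_ofReal]
      field_simp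
    have h3 : Real.exp (-t) * ‖u (φ + (t / μ.re) • w)‖ = ‖u φ‖ := by
      rw [← h2, ← norm_smul, h1]
    rw [← h3, ← mul_assoc, ← Real.exp_add]
    simpa using hC _
  have hpos : 0 < ‖u φ‖ := norm_pos_iff.2 hne
  have := (Real.tendsto_exp_atTop.atTop_mul_const hpos).eventually (eventually_gt_atTop C)
  obtain ⟨t, ht⟩ := this.exists
  exact absurd (hb t) (not_le.2 ht)

/-- The bounded solution is `-∫₀^∞ e^{-μt} κ(φ + tw) dt`. Cutting the half-line into unit intervals
writes it as the series `-∑ cⁿ u(φ + nw)` with `c = e^{-μ}`, `|c| < 1`, so that smoothness follows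
from termwise bounds on derivatives. -/
theorem scalar_exists_of_pos (w : Fin m → ℝ) {μ : ℂ} (hμ : 0 < μ.re) {κ : (Fin m → ℝ) → ι → ℂ}
    (hκ : SmoothTorus κ) :
    ∃ h : (Fin m → ℝ) → ι → ℂ, SmoothTorus h ∧ ∀ φ, fderiv ℝ h φ w - μ • h φ = κ φ := by
  have hexp : ContDiff ℝ ∞ fun t : ℝ => Complex.exp (-(μ * t)) :=
    ((contDiff_const.mul Complex.ofRealCLM.contDiff).neg).cexp
  set u : (Fin m → ℝ) → ι → ℂ :=
    fun φ => ∫ t in (0 : ℝ)..1, Complex.exp (-(μ * t)) • κ (φ + t • w) with hu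
  have hus : SmoothTorus u := by
    refine ⟨contDiff_integral_unit
      (g := fun p : (Fin m → ℝ) × ℝ => Complex.exp (-(μ * p.2)) • κ (p.1 + p.2 • w)) ?_, ?_⟩
    · exact (hexp.comp contDiff_snd).smul (hκ.1.comp (by fun_prop))
    · intro φ k
      simp only [hu]
      congr 1
      ext t i
      have := hκ.2.translate (t • w) φ k
      simp only at this
      rw [this]
  -- The integral over one unit of time solves the equation up to boundary terms at its two ends;
  -- these telescope in the series.
  have hud : ∀ φ, fderiv ℝ u φ w =
      μ • u φ + (Complex.exp (-μ) • κ (φ + w) - κ φ) := by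
    intro φ
    refine fderiv_apply_eq_of_hasDerivAt_line hus.differentiable ?_
    set k : ℝ → ι → ℂ := fun t => Complex.exp (-(μ * t)) • κ (φ + t • w) with hk
    have hkc : Continuous k :=
      hexp.continuous.smul (hκ.1.continuous.comp (by fun_prop))
    -- Translation along the flow only shifts the window of integration, so the derivative follows
    -- from the fundamental theorem of calculus and costs no derivative of `κ`.
    have heq : ∀ r : ℝ, u (φ + r • w) =
        Complex.exp (μ * r) • ((∫ t in (0 : ℝ)..r + 1, k t) - ∫ t in (0 : ℝ)..r, k t) := by
      intro r
      rw [intervalIntegral.integral_interval_sub_left (hkc.intervalIntegrable _ _)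
        (hkc.intervalIntegrable _ _), ← intervalIntegral.integral_smul]
      have := intervalIntegral.integral_comp_add_right (a := 0) (b := 1)
        (fun t => Complex.exp (μ * r) • k t) r
      rw [zero_add, add_comm 1 r] at this
      rw [← this]
      simp only [hu, hk]
      congr 1
      ext1 t
      rw [smul_smul, ← Complex.exp_add, add_assoc, ← add_smul]
      congr 3
      · push_cast; ring
      · rw [add_comm]
    have hF : ∀ x : ℝ, HasDerivAt (fun r : ℝ => ∫ t in (0 : ℝ)..r, k t) (k x) x := fun x =>
      intervalIntegral.integral_hasDerivAt_right (hkc.intervalIntegrable _ _)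
        (hkc.stronglyMeasurableAtFilter _ _) hkc.continuousAt
    have h1 : HasDerivAt (fun r : ℝ => Complex.exp (μ * r))
        (Complex.exp (μ * (0 : ℝ)) * (μ * 1)) 0 :=
      ((Complex.ofRealCLM.hasDerivAt (x := 0)).const_mul μ).cexp
    have h2 : HasDerivAt (fun r : ℝ => (∫ t in (0 : ℝ)..r + 1, k t) - ∫ t in (0 : ℝ)..r, k t)
        (k (0 + 1) - k 0) 0 := ((hF (0 + 1)).comp_add_const 0 1).sub (hF 0)
    have h3 := h1.smul h2
    rw [show (fun r : ℝ => u (φ + r • w)) = _ from funext heq]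
    refine h3.congr_deriv ?_
    have h0 := heq 0
    simp only [zero_smul, add_zero, Complex.ofReal_zero, mul_zero, Complex.exp_zero, one_smul,
      zero_add] at h0
    rw [zero_add]
    simp only [hk, Complex.ofReal_zero, mul_zero, Complex.exp_zero, one_smul, zero_smul, add_zero,
      one_mul, mul_one, Complex.ofReal_one, neg_zero]
    simp only [hk] at h0
    rw [h0, add_comm]
  set c : ℂ := Complex.exp (-μ) with hc
  have hc1 : ‖c‖ < 1 := by
    rw [hc, Complex.norm_exp]
    simpa using hμ
  have hgs : Summable fun n : ℕ => ‖c‖ ^ n := summable_geometric_of_lt_one (norm_nonneg c) hc1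
  have htr : ∀ (n : ℕ), SmoothTorus fun φ => u (φ + (n : ℝ) • w) := fun n =>
    ⟨hus.1.comp (by fun_prop), hus.2.translate _⟩
  set f : ℕ → (Fin m → ℝ) → ι → ℂ := fun n φ => c ^ n • u (φ + (n : ℝ) • w) with hf
  have hfs : ∀ n, SmoothTorus (f n) := fun n =>
    (htr n).comp (g := fun x => c ^ n • x) (by fun_prop)
  -- Periodicity bounds each derivative of `u` globally, and translates share the bound; the series
  -- of `k`-th derivatives is dominated by a geometric one.
  choose B hB using fun k : ℕ =>
    (hus.2.iteratedFDeriv k).exists_bound (hus.1.continuous_iteratedFDeriv (by exact_mod_cast le_top))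
  have hbound : ∀ (k n : ℕ) (φ : Fin m → ℝ), ‖iteratedFDeriv ℝ k (f n) φ‖ ≤ ‖c‖ ^ n * B k := by
    intro k n φ
    have : iteratedFDeriv ℝ k (f n) φ =
        c ^ n • iteratedFDeriv ℝ k (fun φ => u (φ + (n : ℝ) • w)) φ := by
      change iteratedFDeriv ℝ k (c ^ n • fun φ => u (φ + (n : ℝ) • w)) φ = _
      exact iteratedFDeriv_const_smul_apply ((htr n).1.of_le (by exact_mod_cast le_top)).contDiffAt
    rw [this, norm_smul, norm_pow, iteratedFDeriv_comp_add_right]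
    exact mul_le_mul_of_nonneg_left (hB k _) (by positivity)
  have hsum : ContDiff ℝ ∞ fun φ => ∑' n, f n φ :=
    contDiff_tsum (v := fun k n => ‖c‖ ^ n * B k) (fun n => (hfs n).1)
      (fun k _ => hgs.mul_right _) (fun k n φ _ => hbound k n φ)
  have hfsum : ∀ φ, Summable fun n => f n φ := fun φ =>
    Summable.of_norm_bounded (hgs.mul_right (B 0)) fun n => by simpa using hbound 0 n φ
  have hd1 : ∀ n φ, ‖fderiv ℝ (f n) φ‖ ≤ ‖c‖ ^ n * B 1 := fun n φ => by
    rw [← norm_iteratedFDeriv_one]; exact hbound 1 n φ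
  have hfd : ∀ φ, fderiv ℝ (fun φ => ∑' n, f n φ) φ w = ∑' n, fderiv ℝ (f n) φ w := by
    intro φ
    rw [fderiv_tsum_apply (hgs.mul_right (B 1)) (fun n => (hfs n).differentiable)
      (fun n x => hd1 n x) (hfsum 0) φ]
    have hs : Summable fun n => fderiv ℝ (f n) φ :=
      Summable.of_norm_bounded (hgs.mul_right (B 1)) fun n => hd1 n φ
    exact (ContinuousLinearMap.apply ℝ (ι → ℂ) w).map_tsum hs
  refine ⟨fun φ => -∑' n, f n φ, (SmoothTorus.neg ⟨hsum, fun φ k => ?_⟩), fun φ => ?_⟩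
  · exact tsum_congr fun n => (hfs n).2 φ k
  · have hterm : ∀ n, fderiv ℝ (f n) φ w - μ • f n φ =
        c ^ (n + 1) • κ (φ + ((n + 1 : ℕ) : ℝ) • w) - c ^ n • κ (φ + (n : ℝ) • w) := by
      intro n
      have h1 : fderiv ℝ (f n) φ w = c ^ n • fderiv ℝ u (φ + (n : ℝ) • w) w := by
        have : fderiv ℝ (f n) φ = c ^ n • fderiv ℝ (fun φ => u (φ + (n : ℝ) • w)) φ :=
          fderiv_const_smul ((htr n).differentiable φ) (c ^ n)
        rw [this, fderiv_comp_add_right]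
        rfl
      rw [h1, hud]
      simp only [hf]
      push_cast
      rw [add_smul, one_smul, pow_succ, ← add_assoc]
      module
    have hds : Summable fun n => fderiv ℝ (f n) φ w :=
      Summable.of_norm_bounded (hgs.mul_right (B 1 * ‖w‖)) fun n => by
        rw [← mul_assoc]
        exact (ContinuousLinearMap.le_opNorm _ _).trans
          (mul_le_mul_of_nonneg_right (hd1 n φ) (norm_nonneg _))
    have htel : HasSum (fun n : ℕ => c ^ (n + 1) • κ (φ + ((n + 1 : ℕ) : ℝ) • w)
        - c ^ n • κ (φ + (n : ℝ) • w)) (-κ φ) := by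
      obtain ⟨Cκ, hCκ⟩ := hκ.2.exists_bound hκ.1.continuous
      have hks : Summable fun n : ℕ => c ^ n • κ (φ + (n : ℝ) • w) :=
        Summable.of_norm_bounded (hgs.mul_right Cκ) fun n => by
          rw [norm_smul, norm_pow]
          exact mul_le_mul_of_nonneg_left (hCκ _) (by positivity)
      have h0 := ((summable_nat_add_iff 1).2 hks).hasSum.sub hks.hasSum
      have h1 := hks.tsum_eq_zero_add
      simp only [pow_zero, one_smul, Nat.cast_zero, zero_smul, add_zero] at h1
      rwa [h1, sub_add_cancel_right] at h0
    have hneg : fderiv ℝ (fun φ => -∑' n, f n φ) φ w = -∑' n, fderiv ℝ (f n) φ w := by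
      rw [fderiv_fun_neg, ← hfd]; rfl
    rw [hneg, smul_neg, sub_neg_eq_add, ← (hfsum φ).tsum_const_smul μ, neg_add_eq_sub, ← neg_sub,
      ← (hds.tsum_sub ((hfsum φ).const_smul μ))]
    simp_rw [hterm]
    rw [htel.tsum_eq, neg_neg]

/-- Reversing the direction of the flow exchanges the signs of `Re μ`. -/
theorem scalar_exists (w : Fin m → ℝ) {μ : ℂ} (hμ : μ.re ≠ 0) {κ : (Fin m → ℝ) → ι → ℂ}
    (hκ : SmoothTorus κ) :
    ∃ h : (Fin m → ℝ) → ι → ℂ, SmoothTorus h ∧ ∀ φ, fderiv ℝ h φ w - μ • h φ = κ φ := by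
  rcases hμ.lt_or_gt with hneg | hpos
  · obtain ⟨h, hs, hh⟩ := scalar_exists_of_pos (-w) (μ := -μ) (by simpa using hneg) hκ.neg
    refine ⟨h, hs, fun φ => ?_⟩
    have := hh φ
    rw [map_neg, neg_smul, sub_neg_eq_add] at this
    rw [← neg_inj, ← this]
    abel
  · exact scalar_exists_of_pos w hpos hκ

/-- Multiplication by a matrix, as a real continuous linear map. -/
noncomputable def mulVecCLM {κ : Type*} [Fintype κ] (M : Matrix κ ι ℂ) :
    (ι → ℂ) →L[ℝ] (κ → ℂ) :=
  (LinearMap.toContinuousLinearMap (Matrix.mulVecLin M)).restrictScalars ℝ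

theorem fderiv_mulVec {κ : Type*} [Fintype κ] (M : Matrix κ ι ℂ) {u : (Fin m → ℝ) → ι → ℂ}
    (hu : SmoothTorus u) (φ w : Fin m → ℝ) :
    fderiv ℝ (fun φ => M.mulVec (u φ)) φ w = M.mulVec (fderiv ℝ u φ w) := by
  have := ((mulVecCLM M).hasFDerivAt.comp φ (hu.differentiable φ).hasFDerivAt).fderiv
  exact congrArg (fun A => A w) this

theorem SmoothTorus.mulVec {κ : Type*} [Fintype κ] (M : Matrix κ ι ℂ) {u : (Fin m → ℝ) → ι → ℂ}
    (hu : SmoothTorus u) : SmoothTorus fun φ => M.mulVec (u φ) :=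
  hu.comp (mulVecCLM M).contDiff

variable [DecidableEq ι]

/-- The product of the factors `L - μ` over a list of numbers `μ`. -/
noncomputable def factorProd (L : Matrix ι ι ℂ) : List ℂ → Matrix ι ι ℂ
  | [] => 1
  | μ :: l => (L - μ • (1 : Matrix ι ι ℂ)) * factorProd L l

theorem factorProd_commute (L : Matrix ι ι ℂ) (l : List ℂ) : Commute L (factorProd L l) := by
  induction l with
  | nil => exact Commute.one_right L
  | cons μ l ih =>
    exact ((Commute.refl L).sub_right ((Commute.one_right L).smul_right μ)).mul_right ih

/-- Cayley-Hamilton over `ℂ`: the list consists of the roots of the characteristic polynomial with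
multiplicity. It takes the place of a Jordan form. -/
theorem exists_factorProd_eq_zero {L : Matrix ι ι ℂ} (hL : ∀ μ ∈ spectrum ℂ L, μ.re ≠ 0) :
    ∃ l : List ℂ, (∀ μ ∈ l, μ.re ≠ 0) ∧ factorProd L l = 0 := by
  refine ⟨L.charpoly.roots.toList, fun μ hμ => hL μ ?_, ?_⟩
  · rw [Multiset.mem_toList, Polynomial.mem_roots (Matrix.charpoly_monic L).ne_zero] at hμ
    exact Matrix.mem_spectrum_iff_isRoot_charpoly.2 hμ
  · have h1 : ∀ l : List ℂ, factorProd L l =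
        Polynomial.aeval L (l.map fun a => Polynomial.X - Polynomial.C a).prod := by
      intro l
      induction l with
      | nil => simp [factorProd]
      | cons μ l ih => simp [factorProd, ih, Algebra.algebraMap_eq_smul_one]
    rw [h1]
    have h2 := (IsAlgClosed.splits L.charpoly).eq_prod_roots_of_monic (Matrix.charpoly_monic L)
    have h3 : (L.charpoly.roots.toList.map fun a => Polynomial.X - Polynomial.C a).prod
        = L.charpoly := by
      conv_rhs => rw [h2]
      rw [← Multiset.prod_coe, ← Multiset.map_coe, Multiset.coe_toList]
    rw [h3, Matrix.aeval_self_charpoly]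

/-- If `(L - μ) P u = 0` with `P` commuting with `L`, then `P u` solves the scalar equation with `μ`
and vanishes. Peeling off one factor at a time leads from the zero product down to `u` itself. -/
theorem system_unique {w : Fin m → ℝ} {L : Matrix ι ι ℂ} (hL : ∀ μ ∈ spectrum ℂ L, μ.re ≠ 0)
    {u : (Fin m → ℝ) → ι → ℂ} (hu : SmoothTorus u)
    (h : ∀ φ, fderiv ℝ u φ w = L.mulVec (u φ)) : ∀ φ, u φ = 0 := by
  obtain ⟨l, hl, hl0⟩ := exists_factorProd_eq_zero hL
  have key : ∀ l : List ℂ, (∀ μ ∈ l, μ.re ≠ 0) →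
      (∀ φ, (factorProd L l).mulVec (u φ) = 0) → ∀ φ, u φ = 0 := by
    intro l
    induction l with
    | nil => intro _ h0 φ; simpa [factorProd] using h0 φ
    | cons μ l ih =>
      intro hl h0
      refine ih (fun ν hν => hl ν (List.mem_cons_of_mem _ hν)) ?_
      refine scalar_unique (w := w) (hl μ List.mem_cons_self) (hu.mulVec (factorProd L l))
        fun φ => ?_
      rw [fderiv_mulVec _ hu, h, Matrix.mulVec_mulVec, ← (factorProd_commute L l).eq]
      have := h0 φ
      simp only [factorProd, Matrix.sub_mul, Matrix.smul_mul, Matrix.one_mul, Matrix.sub_mulVec,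
        Matrix.smul_mulVec, sub_eq_zero] at this
      exact this
  exact key l hl fun φ => by rw [hl0, Matrix.zero_mulVec]

/-- An approximate solution with residual `P q` is improved by adding `P p`, where `∂_w p - μ p =
q`; the new residual is `(L - μ) P p`. After all factors the product is zero and the residual is
gone. -/
theorem system_exists (w : Fin m → ℝ) {L : Matrix ι ι ℂ} (hL : ∀ μ ∈ spectrum ℂ L, μ.re ≠ 0)
    {κ : (Fin m → ℝ) → ι → ℂ} (hκ : SmoothTorus κ) :
    ∃ h : (Fin m → ℝ) → ι → ℂ, SmoothTorus h ∧
      ∀ φ, fderiv ℝ h φ w - L.mulVec (h φ) = κ φ := by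
  obtain ⟨l, hl, hl0⟩ := exists_factorProd_eq_zero hL
  have key : ∀ l : List ℂ, (∀ μ ∈ l, μ.re ≠ 0) → ∃ h q : (Fin m → ℝ) → ι → ℂ,
      SmoothTorus h ∧ SmoothTorus q ∧ ∀ φ, fderiv ℝ h φ w - L.mulVec (h φ) =
        κ φ - (factorProd L l).mulVec (q φ) := by
    intro l
    induction l with
    | nil =>
      intro _
      exact ⟨fun _ => 0, κ, SmoothTorus.const 0, hκ, fun φ => by simp [factorProd]⟩
    | cons μ l ih =>
      intro hl
      obtain ⟨h, q, hh, hq, heq⟩ := ih fun ν hν => hl ν (List.mem_cons_of_mem _ hν)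
      obtain ⟨p, hp, hpeq⟩ := scalar_exists w (hl μ List.mem_cons_self) hq
      refine ⟨fun φ => h φ + (factorProd L l).mulVec (p φ), p, hh.add (hp.mulVec _), hp,
        fun φ => ?_⟩
      have h1 : fderiv ℝ (fun φ => h φ + (factorProd L l).mulVec (p φ)) φ w =
          fderiv ℝ h φ w + (factorProd L l).mulVec (fderiv ℝ p φ w) := by
        rw [fderiv_fun_add (hh.differentiable φ) ((hp.mulVec _).differentiable φ), ← fderiv_mulVec _ hp]
        rfl
      have h2 := congrArg (factorProd L l).mulVec (hpeq φ)
      rw [Matrix.mulVec_sub, Matrix.mulVec_smul] at h2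
      have h3 := heq φ
      rw [← h2] at h3
      rw [h1, Matrix.mulVec_add]
      simp only [factorProd, Matrix.sub_mul, Matrix.smul_mul, Matrix.one_mul, Matrix.sub_mulVec,
        Matrix.smul_mulVec, ← Matrix.mulVec_mulVec] at h3 ⊢
      rw [sub_eq_iff_eq_add] at h3
      rw [h3]
      abel
  obtain ⟨h, q, hh, hq, heq⟩ := key l hl
  exact ⟨h, hh, fun φ => by rw [heq, hl0, Matrix.zero_mulVec, sub_zero]⟩

end Linear

end DelayPhase

namespace DelayPhase

open Filter Topology MeasureTheory

/-! ### Fourier coefficients on the torus -/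

section Fourier

variable {m : ℕ}

theorem box_ae_eq : (Set.pi univ fun _ : Fin m => Ioc (0 : ℝ) (2 * Real.pi)) =ᵐ[volume]
    Icc (fun _ : Fin m => (0 : ℝ)) (fun _ => 2 * Real.pi) :=
  Measure.univ_pi_Ioc_ae_eq_Icc

theorem integrableOn_box {V : Type*} [NormedAddCommGroup V] {u : (Fin m → ℝ) → V}
    (hu : Continuous u) :
    IntegrableOn u (Set.pi univ fun _ : Fin m => Ioc (0 : ℝ) (2 * Real.pi)) :=
  (integrableOn_congr_set_ae box_ae_eq).2 (hu.continuousOn.integrableOn_compact isCompact_Icc)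

/-- Divergence theorem on the box: the contributions of opposite faces cancel by periodicity. -/
theorem integral_box_fderiv {v : (Fin m → ℝ) → ℂ} (hv : SmoothTorus v) (w : Fin m → ℝ) :
    ∫ φ in Set.pi univ (fun _ : Fin m => Ioc (0 : ℝ) (2 * Real.pi)), fderiv ℝ v φ w = 0 := by
  -- The divergence theorem is applied in dimension `n + 1`, so the zero-dimensional torus is
  -- treated separately.
  rcases m with _ | n
  · have hw : w = 0 := Subsingleton.elim _ _
    simp only [hw, map_zero, integral_zero]
  rw [setIntegral_congr_set box_ae_eq]
  have h2 : (0 : ℝ) ≤ 2 * Real.pi := by positivity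
  have hdiv := integral_divergence_of_hasFDerivAt_off_countable'
    (fun _ : Fin (n + 1) => (0 : ℝ)) (fun _ => 2 * Real.pi) (fun _ => h2)
    (fun i φ => w i • v φ) (fun i φ => w i • fderiv ℝ v φ) ∅ countable_empty
    (fun i => (hv.1.continuous.const_smul (w i)).continuousOn)
    (fun φ _ i => (hv.differentiable φ).hasFDerivAt.const_smul (w i))
    (by
      refine ContinuousOn.integrableOn_compact isCompact_Icc (Continuous.continuousOn ?_)
      have := hv.fderiv.1.continuous
      fun_prop)
  have hsum : ∀ φ, ∑ i, (w i • fderiv ℝ v φ) (Pi.single i 1) = fderiv ℝ v φ w := by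
    intro φ
    conv_rhs => rw [pi_eq_sum_univ' w]
    rw [map_sum]
    refine Finset.sum_congr rfl fun i _ => ?_
    rw [map_smul]
    rfl
  simp_rw [hsum] at hdiv
  rw [hdiv]
  refine Finset.sum_eq_zero fun i _ => ?_
  rw [sub_eq_zero]
  refine setIntegral_congr_fun measurableSet_Icc fun x _ => ?_
  congr 1
  have := hv.2 (i.insertNth 0 x) (Pi.single i 1)
  rw [← this]
  congr 1
  ext j
  refine Fin.succAboveCases i ?_ (fun l => ?_) j
  · simp
  · simp

/-- The exponential `φ ↦ e^{i⟨k,φ⟩}`. -/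
noncomputable def torusExp (k : Fin m → ℤ) (φ : Fin m → ℝ) : ℂ :=
  Complex.exp (Complex.I * (resonance φ k : ℂ))

theorem resonance_neg (φ : Fin m → ℝ) (k : Fin m → ℤ) :
    resonance φ (-k) = -resonance φ k := by
  simp [resonance]

theorem contDiff_resonance (k : Fin m → ℤ) : ContDiff ℝ ∞ fun φ : Fin m → ℝ => resonance φ k := by
  unfold resonance
  fun_prop

theorem smoothTorus_torusExp (k : Fin m → ℤ) : SmoothTorus (torusExp k) := by
  refine ⟨(contDiff_const.mul (Complex.ofRealCLM.contDiff.comp (contDiff_resonance k))).cexp,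
    fun φ l => ?_⟩
  have h : resonance (fun j => φ j + 2 * Real.pi * (l j : ℝ)) k =
      resonance φ k + ((∑ j, k j * l j : ℤ) : ℝ) * (2 * Real.pi) := by
    simp only [resonance, mul_add, Finset.sum_add_distrib]
    push_cast
    rw [Finset.sum_mul]
    congr 1
    exact Finset.sum_congr rfl fun j _ => by ring
  unfold torusExp
  rw [h, Complex.exp_eq_exp_iff_exists_int]
  refine ⟨∑ j, k j * l j, ?_⟩
  push_cast
  ring

theorem fderiv_torusExp (k : Fin m → ℤ) (φ w : Fin m → ℝ) :
    fderiv ℝ (torusExp k) φ w = Complex.I * (resonance w k : ℂ) * torusExp k φ := by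
  have h1 : HasDerivAt (fun r : ℝ => torusExp k (φ + r • w))
      (Complex.I * (resonance w k : ℂ) * torusExp k φ) 0 := by
    have h2 : HasDerivAt (fun r : ℝ => Complex.I * ((resonance φ k + r * resonance w k : ℝ) : ℂ))
        (Complex.I * ((1 * resonance w k : ℝ) : ℂ)) 0 :=
      ((((hasDerivAt_id (0 : ℝ)).mul_const (resonance w k)).const_add
        (resonance φ k)).ofReal_comp).const_mul Complex.I
    have h3 : ∀ r : ℝ, torusExp k (φ + r • w) =
        Complex.exp (Complex.I * ((resonance φ k + r * resonance w k : ℝ) : ℂ)) := by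
      intro r
      unfold torusExp
      congr 3
      simp only [resonance, Pi.add_apply, Pi.smul_apply, smul_eq_mul, mul_add,
        Finset.sum_add_distrib, Finset.mul_sum]
      congr 1
      exact Finset.sum_congr rfl fun j _ => by ring
    rw [show (fun r : ℝ => torusExp k (φ + r • w)) = _ from funext h3]
    refine h2.cexp.congr_deriv ?_
    simp [torusExp, mul_comm]
  exact fderiv_apply_eq_of_hasDerivAt_line (smoothTorus_torusExp k).differentiable h1

theorem torusFourierCoeff_apply {ι : Type*} (u : (Fin m → ℝ) → ι → ℂ) (k : Fin m → ℤ) (i : ι) :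
    torusFourierCoeff u k i = (((2 * Real.pi) ^ m : ℝ) : ℂ)⁻¹ *
      ∫ φ in Set.pi univ (fun _ : Fin m => Ioc (0 : ℝ) (2 * Real.pi)), torusExp (-k) φ * u φ i := by
  simp [torusFourierCoeff, torusExp, resonance_neg]

theorem integrable_torusExp_mul {u : (Fin m → ℝ) → ℂ} (hu : Continuous u) (k : Fin m → ℤ) :
    IntegrableOn (fun φ => torusExp k φ * u φ)
      (Set.pi univ fun _ : Fin m => Ioc (0 : ℝ) (2 * Real.pi)) :=
  integrableOn_box ((smoothTorus_torusExp k).1.continuous.mul hu)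

theorem torusFourierCoeff_add {ι : Type*} {u v : (Fin m → ℝ) → ι → ℂ} (hu : Continuous u)
    (hv : Continuous v) (k : Fin m → ℤ) : torusFourierCoeff (fun φ => u φ + v φ) k =
      torusFourierCoeff u k + torusFourierCoeff v k := by
  ext i
  simp only [torusFourierCoeff_apply, Pi.add_apply, mul_add]
  rw [integral_add (integrable_torusExp_mul (by fun_prop) _)
    (integrable_torusExp_mul (by fun_prop) _), mul_add]

theorem torusFourierCoeff_const_smul {ι : Type*} (c : ℂ) (u : (Fin m → ℝ) → ι → ℂ)
    (k : Fin m → ℤ) : torusFourierCoeff (fun φ => c • u φ) k = c • torusFourierCoeff u k := by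
  ext i
  simp only [torusFourierCoeff_apply, Pi.smul_apply, smul_eq_mul, mul_left_comm _ c]
  rw [integral_const_mul, mul_left_comm]

theorem torusFourierCoeff_sub {ι : Type*} {u v : (Fin m → ℝ) → ι → ℂ} (hu : Continuous u)
    (hv : Continuous v) (k : Fin m → ℤ) : torusFourierCoeff (fun φ => u φ - v φ) k =
      torusFourierCoeff u k - torusFourierCoeff v k := by
  have := torusFourierCoeff_add (u := u) (v := fun φ => (-1 : ℂ) • v φ) hu (by fun_prop) k
  rw [torusFourierCoeff_const_smul] at this
  simpa [sub_eq_add_neg] using this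

theorem torusFourierCoeff_sum {ι α : Type*} (s : Finset α) {u : α → (Fin m → ℝ) → ι → ℂ}
    (hu : ∀ a ∈ s, Continuous (u a)) (k : Fin m → ℤ) :
    torusFourierCoeff (fun φ => ∑ a ∈ s, u a φ) k = ∑ a ∈ s, torusFourierCoeff (u a) k := by
  ext i
  simp only [torusFourierCoeff_apply, Finset.sum_apply, Finset.mul_sum]
  rw [integral_finsetSum s fun a ha => integrable_torusExp_mul (u := fun φ => u a φ i)
    ((continuous_apply i).comp (hu a ha)) (-k), Finset.mul_sum]

theorem torusFourierCoeff_mulVec {ι κ : Type*} [Fintype ι] (M : Matrix κ ι ℂ)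
    {u : (Fin m → ℝ) → ι → ℂ} (hu : Continuous u) (k : Fin m → ℤ) :
    torusFourierCoeff (fun φ => M.mulVec (u φ)) k = M.mulVec (torusFourierCoeff u k) := by
  ext i
  simp only [torusFourierCoeff_apply, Matrix.mulVec, dotProduct, Finset.mul_sum,
    mul_left_comm _ (M i _)]
  rw [integral_finsetSum _ fun j _ => (integrable_torusExp_mul (u := fun φ => u φ j)
    ((continuous_apply j).comp hu) (-k)).const_mul (M i j), Finset.mul_sum]
  refine Finset.sum_congr rfl fun j _ => ?_
  rw [integral_const_mul, mul_left_comm]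

/-- Integration by parts: the derivative of `e^{-i⟨k,φ⟩} u` in direction `w` has integral zero. -/
theorem torusFourierCoeff_fderiv {ι : Type*} [Fintype ι] {u : (Fin m → ℝ) → ι → ℂ}
    (hu : SmoothTorus u) (w : Fin m → ℝ) (k : Fin m → ℤ) :
    torusFourierCoeff (fun φ => fderiv ℝ u φ w) k =
      (Complex.I * (resonance w k : ℂ)) • torusFourierCoeff u k := by
  ext i
  have hui : SmoothTorus fun φ => u φ i := hu.comp (g := fun x : ι → ℂ => x i) (by fun_prop)
  have hv : SmoothTorus fun φ => torusExp (-k) φ * u φ i :=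
    ⟨(smoothTorus_torusExp _).1.mul hui.1, (smoothTorus_torusExp _).2.comp₂ hui.2 _⟩
  have hd : ∀ φ, fderiv ℝ (fun φ => torusExp (-k) φ * u φ i) φ w =
      torusExp (-k) φ * fderiv ℝ u φ w i -
        (Complex.I * (resonance w k : ℂ)) * (torusExp (-k) φ * u φ i) := by
    intro φ
    rw [fderiv_fun_mul ((smoothTorus_torusExp _).differentiable φ) (hui.differentiable φ)]
    have h1 : fderiv ℝ (fun φ => u φ i) φ w = fderiv ℝ u φ w i := by
      rw [fderiv_apply (hu.differentiable φ)]
      rfl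
    simp only [add_apply, smul_apply, smul_eq_mul, h1,
      fderiv_torusExp, resonance_neg]
    push_cast
    ring
  have h0 := integral_box_fderiv hv w
  simp_rw [hd] at h0
  have hdi : Continuous fun φ => fderiv ℝ u φ w i :=
    (continuous_apply i).comp (hu.dirDeriv w).1.continuous
  rw [integral_sub (integrable_torusExp_mul hdi _)
    ((integrable_torusExp_mul hui.1.continuous _).const_mul _), integral_const_mul,
    sub_eq_zero] at h0
  rw [torusFourierCoeff_apply, h0, Pi.smul_apply, torusFourierCoeff_apply, smul_eq_mul]
  ring

/-- Orthogonality comes from the derivative rule. In a direction `j` with `k j ≠ l j`,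
differentiation multiplies the same coefficient by `i k j` and by `i l j`, so the coefficient is
zero. -/
theorem torusFourierCoeff_torusExp {ι : Type*} [Fintype ι] (k l : Fin m → ℤ) (v : ι → ℂ) :
    torusFourierCoeff (fun φ => torusExp l φ • v) k = if k = l then v else 0 := by
  have hs : SmoothTorus fun φ => torusExp l φ • v :=
    (smoothTorus_torusExp l).comp (g := fun z : ℂ => z • v) (by fun_prop)
  split_ifs with hkl
  · subst hkl
    ext i
    rw [torusFourierCoeff_apply]
    have : ∀ φ, torusExp (-k) φ * (torusExp k φ • v) i = v i := by
      intro φ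
      rw [Pi.smul_apply, smul_eq_mul, ← mul_assoc, torusExp, torusExp, ← Complex.exp_add,
        resonance_neg]
      simp
    simp_rw [this]
    rw [setIntegral_const, Measure.real, Real.volume_pi_Ioc]
    have hpi : (0 : ℝ) ≤ 2 * Real.pi := by positivity
    have hne : ((2 * Real.pi : ℝ) : ℂ) ^ m ≠ 0 :=
      pow_ne_zero _ (by exact_mod_cast (by positivity : (2 * Real.pi : ℝ) ≠ 0))
    simp only [sub_zero, Finset.prod_const, Finset.card_univ, Fintype.card_fin, ENNReal.toReal_pow,
      ENNReal.toReal_ofReal hpi, Complex.real_smul, Complex.ofReal_pow]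
    field_simp
  · obtain ⟨j, hj⟩ := Function.ne_iff.1 hkl
    set w : Fin m → ℝ := Pi.single j 1 with hw
    have hr : ∀ k : Fin m → ℤ, resonance w k = k j := by
      intro k
      simp [resonance, hw, Pi.single_apply]
    have h1 : ∀ φ, fderiv ℝ (fun φ => torusExp l φ • v) φ w =
        (Complex.I * (l j : ℂ)) • (torusExp l φ • v) := by
      intro φ
      have hh : HasFDerivAt (fun φ => torusExp l φ • v) _ φ :=
        ((smoothTorus_torusExp l).differentiable φ).hasFDerivAt.smul_const v
      rw [hh.fderiv, ContinuousLinearMap.smulRight_apply, fderiv_torusExp, hr, smul_smul]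
      simp
    have h2 := torusFourierCoeff_fderiv hs w k
    simp_rw [h1] at h2
    rw [torusFourierCoeff_const_smul, hr, ← sub_eq_zero, ← sub_smul, smul_eq_zero] at h2
    refine h2.resolve_left ?_
    simp only [Complex.ofReal_intCast, ← mul_sub, mul_eq_zero, Complex.I_ne_zero, false_or,
      sub_eq_zero, Int.cast_inj]
    exact fun h => hj h.symm

/-- `toC` as a continuous linear map. -/
noncomputable def toCCLM (ι : Type*) [Fintype ι] : (ι → ℝ) →L[ℝ] (ι → ℂ) :=
  ContinuousLinearMap.pi fun i => Complex.ofRealCLM.comp (ContinuousLinearMap.proj i)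

/-- The real part of a complex vector. -/
noncomputable def reCLM (ι : Type*) [Fintype ι] : (ι → ℂ) →L[ℝ] (ι → ℝ) :=
  ContinuousLinearMap.pi fun i => Complex.reCLM.comp (ContinuousLinearMap.proj i)

theorem toCCLM_apply {ι : Type*} [Fintype ι] (x : ι → ℝ) : toCCLM ι x = toC x := rfl

theorem SmoothTorus.toC {ι : Type*} [Fintype ι] {u : (Fin m → ℝ) → ι → ℝ} (hu : SmoothTorus u) :
    SmoothTorus fun φ => toC (u φ) := hu.comp (toCCLM ι).contDiff

theorem fderiv_toC {ι : Type*} [Fintype ι] {u : (Fin m → ℝ) → ι → ℝ} (hu : SmoothTorus u)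
    (φ w : Fin m → ℝ) : fderiv ℝ (fun φ => DelayPhase.toC (u φ)) φ w =
      DelayPhase.toC (fderiv ℝ u φ w) := by
  have := ((toCCLM ι).hasFDerivAt.comp φ (hu.differentiable φ).hasFDerivAt).fderiv
  exact congrArg (fun A => A w) this

theorem toC_injective {ι : Type*} : Function.Injective (DelayPhase.toC (ι := ι)) := fun _ _ h =>
  funext fun i => Complex.ofReal_injective (congrFun h i)

theorem toC_re {ι : Type*} {z : ι → ℂ} (h : star z = z) :
    DelayPhase.toC (fun i => (z i).re) = z := by
  ext i
  exact Complex.conj_eq_iff_re.1 (congrFun h i)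

theorem star_toC {ι : Type*} (x : ι → ℝ) : star (DelayPhase.toC x) = DelayPhase.toC x := by
  ext i
  exact Complex.conj_ofReal _

theorem star_torusExp (k : Fin m → ℤ) (φ : Fin m → ℝ) :
    (starRingEnd ℂ) (torusExp k φ) = torusExp (-k) φ := by
  unfold torusExp
  rw [← Complex.exp_conj, map_mul, Complex.conj_I, Complex.conj_ofReal, resonance_neg]
  push_cast
  ring_nf

theorem star_torusFourierCoeff_toC {ι : Type*} (u : (Fin m → ℝ) → ι → ℝ) (k : Fin m → ℤ) :
    star (torusFourierCoeff (fun φ => toC (u φ)) k) =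
      torusFourierCoeff (fun φ => DelayPhase.toC (u φ)) (-k) := by
  ext i
  rw [Pi.star_apply, torusFourierCoeff_apply, torusFourierCoeff_apply]
  change (starRingEnd ℂ) _ = _
  rw [map_mul, map_inv₀, Complex.conj_ofReal, ← integral_conj]
  congr 2
  ext φ
  rw [map_mul, star_torusExp]
  congr 1
  exact Complex.conj_ofReal _

/-- The multi-indices `k` with `|k| ≤ K` and `⟨k, w⟩ ≠ 0`. -/
noncomputable def nonresonant (w : Fin m → ℝ) (K : ℕ) : Finset (Fin m → ℤ) :=
  ((Fintype.piFinset fun _ : Fin m => Finset.Icc (-(K : ℤ)) K).filter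
    fun k => ∑ j, |k j| ≤ (K : ℤ) ∧ resonance w k ≠ 0)

theorem mem_nonresonant {w : Fin m → ℝ} {K : ℕ} {k : Fin m → ℤ} :
    k ∈ nonresonant w K ↔ ∑ j, |k j| ≤ (K : ℤ) ∧ resonance w k ≠ 0 := by
  classical
  unfold nonresonant
  rw [Finset.mem_filter, and_iff_right_iff_imp]
  intro h
  rw [Fintype.mem_piFinset]
  intro j
  rw [Finset.mem_Icc, ← abs_le]
  exact (Finset.single_le_sum (f := fun j => |k j|) (fun i _ => abs_nonneg _)
    (Finset.mem_univ j)).trans h.1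

/-- The divisors `i⟨k, w⟩` are inverted only on the finite set `nonresonant w K`; `g` is the
resulting trigonometric polynomial, and `f = ζ - ∂_w g` absorbs all remaining modes. -/
theorem exists_normalForm {ι : Type*} [Fintype ι] (w : Fin m → ℝ) (K : ℕ)
    {ζ : (Fin m → ℝ) → ι → ℝ} (hζ : SmoothTorus ζ) :
    ∃ g f : (Fin m → ℝ) → ι → ℝ, SmoothTorus g ∧ SmoothTorus f ∧
      (∀ φ, fderiv ℝ g φ w + f φ = ζ φ) ∧
      ∀ k : Fin m → ℤ,
        ((∑ j, |k j| ≤ (K : ℤ) ∧ resonance w k ≠ 0) →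
          torusFourierCoeff (fun φ => toC (g φ)) k =
            (Complex.I * (resonance w k : ℂ))⁻¹ • torusFourierCoeff (fun φ => toC (ζ φ)) k ∧
          torusFourierCoeff (fun φ => toC (f φ)) k = 0) ∧
        (¬(∑ j, |k j| ≤ (K : ℤ) ∧ resonance w k ≠ 0) →
          torusFourierCoeff (fun φ => toC (g φ)) k = 0 ∧
          torusFourierCoeff (fun φ => toC (f φ)) k =
            torusFourierCoeff (fun φ => toC (ζ φ)) k) := by
  classical
  set a : (Fin m → ℤ) → ι → ℂ := fun k =>
    (Complex.I * (resonance w k : ℂ))⁻¹ • torusFourierCoeff (fun φ => toC (ζ φ)) k with ha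
  set gC : (Fin m → ℝ) → ι → ℂ := fun φ => ∑ k ∈ nonresonant w K, torusExp k φ • a k with hgC
  have hts : ∀ k, SmoothTorus fun φ => torusExp k φ • a k := fun k =>
    (smoothTorus_torusExp k).comp (g := fun z : ℂ => z • a k) (by fun_prop)
  have hgs : SmoothTorus gC := SmoothTorus.sum fun k _ => hts k
  have hstar : ∀ φ, star (gC φ) = gC φ := by
    intro φ
    simp only [hgC, star_sum, star_smul]
    -- The index set is symmetric under `k ↦ -k`, and conjugation exchanges the terms of `k` and
    -- `-k` because `ζ` is real.
    refine Finset.sum_equiv (Equiv.neg _) (fun k => ?_) (fun k _ => ?_)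
    · simp [mem_nonresonant, resonance_neg]
    · simp only [Equiv.neg_apply, ha, star_smul, star_torusFourierCoeff_toC]
      rw [show star (torusExp k φ) = torusExp (-k) φ from star_torusExp k φ]
      congr 2
      change (starRingEnd ℂ) _ = _
      rw [map_inv₀, map_mul, Complex.conj_I, Complex.conj_ofReal, resonance_neg]
      push_cast
      ring
  set g : (Fin m → ℝ) → ι → ℝ := fun φ i => (gC φ i).re with hg
  have hgr : SmoothTorus g := hgs.comp (reCLM ι).contDiff
  have htog : (fun φ => toC (g φ)) = gC := funext fun φ => toC_re (hstar φ)
  have hcg : ∀ k, torusFourierCoeff (fun φ => toC (g φ)) k =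
      if k ∈ nonresonant w K then a k else 0 := by
    intro k
    rw [htog, hgC, torusFourierCoeff_sum _ fun k _ => (hts k).1.continuous]
    simp_rw [torusFourierCoeff_torusExp]
    simp
  have hcf : ∀ k, torusFourierCoeff (fun φ => toC (ζ φ - fderiv ℝ g φ w)) k =
      torusFourierCoeff (fun φ => toC (ζ φ)) k -
        (Complex.I * (resonance w k : ℂ)) • torusFourierCoeff (fun φ => toC (g φ)) k := by
    intro k
    rw [← torusFourierCoeff_fderiv hgr.toC, ← torusFourierCoeff_sub hζ.toC.1.continuous
      (hgr.toC.dirDeriv w).1.continuous]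
    congr 1
    ext φ i
    rw [fderiv_toC hgr]
    simp [DelayPhase.toC]
  refine ⟨g, fun φ => ζ φ - fderiv ℝ g φ w, hgr, hζ.sub (hgr.dirDeriv w), fun φ => add_sub_cancel _ _,
    fun k => ⟨fun hk => ?_, fun hk => ?_⟩⟩
  · have h1 := hcg k
    rw [if_pos (mem_nonresonant.2 hk)] at h1
    refine ⟨h1, ?_⟩
    have hne : Complex.I * (resonance w k : ℂ) ≠ 0 :=
      mul_ne_zero Complex.I_ne_zero (by exact_mod_cast hk.2)
    rw [hcf, h1, ha, smul_smul, mul_inv_cancel₀ hne, one_smul, sub_self]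
  · have h1 := hcg k
    rw [if_neg (mt mem_nonresonant.1 hk)] at h1
    exact ⟨h1, by rw [hcf, h1, smul_zero, sub_zero]⟩

end Fourier

end DelayPhase

namespace DelayPhase

open Filter Topology MeasureTheory

/-! ### Logarithms in a complex Banach algebra -/

section Log

variable {𝔸 : Type*} [NormedRing 𝔸] [NormedAlgebra ℂ 𝔸] [CompleteSpace 𝔸]

theorem commute_intervalIntegral {x : 𝔸} {R : ℝ → 𝔸} (hR : Continuous R)
    (h : ∀ s, Commute x (R s)) (a b : ℝ) : Commute x (∫ s in a..b, R s) := by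
  have h1 := (ContinuousLinearMap.mul ℝ 𝔸 x).intervalIntegral_comp_comm
    (hR.intervalIntegrable (μ := volume) a b)
  have h2 := ((ContinuousLinearMap.mul ℝ 𝔸).flip x).intervalIntegral_comp_comm
    (hR.intervalIntegrable (μ := volume) a b)
  simp only [ContinuousLinearMap.mul_apply', ContinuousLinearMap.flip_apply] at h1 h2
  rw [commute_iff_eq, ← h1, ← h2]
  exact intervalIntegral.integral_congr fun s _ => h s

/-- Commutativity allows `exp (b t)` to be factored out, so only the derivative of `exp` at `0` is
needed. -/
theorem hasDerivAt_exp_of_commute {b : ℝ → 𝔸} {b' : 𝔸} {t : ℝ} (hb : HasDerivAt b b' t)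
    (hc : ∀ s, Commute (b t) (b s)) :
    HasDerivAt (fun s => NormedSpace.exp (b s)) (NormedSpace.exp (b t) * b') t := by
  let +nondep : NormedAlgebra ℚ 𝔸 := .restrictScalars ℚ ℂ 𝔸
  have h1 : ∀ s, NormedSpace.exp (b s) = NormedSpace.exp (b t) * NormedSpace.exp (b s - b t) := by
    intro s
    rw [← NormedSpace.exp_add_of_commute ((hc s).sub_right (Commute.refl _)), add_sub_cancel]
  have h2 : HasDerivAt (fun s => NormedSpace.exp (b s - b t)) b' t := by
    have h3 : HasFDerivAt NormedSpace.exp (1 : 𝔸 →L[ℝ] 𝔸) (b t - b t) := by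
      rw [sub_self]
      exact hasFDerivAt_exp_zero
    exact h3.comp_hasDerivAt t (hb.sub_const (b t))
  rw [show (fun s => NormedSpace.exp (b s)) = _ from funext h1]
  exact h2.const_mul _

/-- The parabolic arcs `t + i c t(1 - t)` join `0` to `1`, and each point of `Z` lies on at most one
of them; finitely many values of `c` are excluded. -/
theorem exists_path_avoiding {Z : Set ℂ} (hZ : Z.Finite) (h0 : (0 : ℂ) ∉ Z) (h1 : (1 : ℂ) ∉ Z) :
    ∃ c : ℝ, ∀ t : ℝ, (t : ℂ) + Complex.I * ((c * (t * (1 - t)) : ℝ) : ℂ) ∉ Z := by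
  obtain ⟨c, hc⟩ := (hZ.image fun z : ℂ => z.im / (z.re * (1 - z.re))).infinite_compl.nonempty
  refine ⟨c, fun t ht => ?_⟩
  have hne : t * (1 - t) ≠ 0 := by
    intro h
    rw [h] at ht
    rcases mul_eq_zero.1 h with h | h
    · exact h0 (by simpa [h] using ht)
    · have : t = 1 := by linarith
      exact h1 (by simpa [this] using ht)
  refine hc ⟨_, ht, ?_⟩
  simp only [Complex.add_im, Complex.ofReal_im, Complex.I_mul_im, Complex.ofReal_re, zero_add,
    Complex.add_re, Complex.I_mul_re, neg_zero, add_zero]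
  exact mul_div_cancel_right₀ c hne

/-- Join `1` to `a` by the commuting units `q = 1 + p(t)(a - 1)`, where `p` avoids the finitely many
bad parameters, and take `b(t) = ∫₀ᵗ q' q⁻¹`. Then `exp(-b) q` has zero derivative and equals `1`.
-/
theorem exists_exp_eq {a : 𝔸} (ha : IsUnit a) (hfin : (spectrum ℂ a).Finite) :
    ∃ b : 𝔸, NormedSpace.exp b = a := by
  let +nondep : NormedAlgebra ℚ 𝔸 := .restrictScalars ℚ ℂ 𝔸
  set Z : Set ℂ := {z | ¬IsUnit (1 + z • (a - 1))} with hZdef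
  have hZ : Z.Finite := by
    have hinj : Function.Injective fun z : ℂ => 1 - z⁻¹ := fun x y h => by simpa using h
    refine (hfin.preimage hinj.injOn).subset fun z hz => ?_
    have hz0 : z ≠ 0 := by
      rintro rfl
      exact hz (by simp)
    rw [mem_preimage, spectrum.mem_iff]
    intro hu
    refine hz ?_
    -- For `z ≠ 0`, failure of invertibility means `1 - z⁻¹` is in the spectrum of `a`; injectivity
    -- of `z ↦ 1 - z⁻¹` transfers finiteness.
    have : 1 + z • (a - 1) = (-z) • (algebraMap ℂ 𝔸 (1 - z⁻¹) - a) := by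
      have hzz : -z * (1 - z⁻¹) = 1 - z := by field_simp; ring
      rw [Algebra.algebraMap_eq_smul_one, smul_sub (-z), smul_smul, hzz]
      module
    rw [this]
    exact hu.smul (Units.mk0 (-z) (neg_ne_zero.2 hz0))
  obtain ⟨c, hc⟩ := exists_path_avoiding hZ (by simp [hZdef]) (by simpa [hZdef] using ha)
  set p : ℝ → ℂ := fun t => (t : ℂ) + Complex.I * ((c * (t * (1 - t)) : ℝ) : ℂ) with hp
  set p' : ℝ → ℂ := fun t => 1 + Complex.I * ((c * (1 - 2 * t) : ℝ) : ℂ) with hp'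
  have hpd : ∀ t, HasDerivAt p (p' t) t := by
    intro t
    have h1 : HasDerivAt (fun t : ℝ => c * (t * (1 - t))) (c * (1 - 2 * t)) t := by
      refine (((hasDerivAt_id t).mul ((hasDerivAt_id t).const_sub 1)).const_mul c).congr_deriv ?_
      simp only [id]
      ring
    exact (Complex.ofRealCLM.hasDerivAt (x := t)).add (h1.ofReal_comp.const_mul Complex.I)
  have hp'c : Continuous p' := by fun_prop
  have hpc : Continuous p := by fun_prop
  set q : ℝ → 𝔸 := fun t => 1 + p t • (a - 1) with hq
  have hqu : ∀ t, IsUnit (q t) := fun t => not_not.1 (hc t)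
  have hqd : ∀ t, HasDerivAt q (p' t • (a - 1)) t := fun t =>
    ((hpd t).smul_const (a - 1)).const_add 1
  have hqc : Continuous q := by fun_prop
  set R : ℝ → 𝔸 := fun t => (p' t • (a - 1)) * Ring.inverse (q t) with hR
  have hRc : Continuous R := by
    have : Continuous fun t => Ring.inverse (q t) := continuous_iff_continuousAt.2 fun t => by
      obtain ⟨v, hv⟩ := hqu t
      have := NormedRing.inverse_continuousAt v
      rw [hv] at this
      exact this.comp (f := q) hqc.continuousAt
    fun_prop
  have hcom : ∀ s t, Commute (R s) (R t) := by
    have h0 : ∀ s, Commute (a - 1) (q s) := fun s =>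
      (Commute.one_right _).add_right ((Commute.refl _).smul_right _)
    have h1 : ∀ s, Commute (a - 1) (Ring.inverse (q s)) := fun s => by
      obtain ⟨v, hv⟩ := hqu s
      rw [← hv, Ring.inverse_unit]
      exact Commute.units_inv_right (by rw [hv]; exact h0 s)
    have h2 : ∀ s t, Commute (Ring.inverse (q s)) (Ring.inverse (q t)) := fun s t =>
      Commute.ringInverse_ringInverse
        ((Commute.one_left _).add_left ((h0 t).smul_left _))
    intro s t
    exact ((((Commute.refl (a - 1)).smul_left _).smul_right _).mul_right ((h1 t).smul_left _)).mul_left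
      (((h1 s).symm.smul_right _).mul_right (h2 s t))
  set b : ℝ → 𝔸 := fun t => ∫ s in (0 : ℝ)..t, R s with hb
  have hbd : ∀ t, HasDerivAt b (R t) t := fun t =>
    intervalIntegral.integral_hasDerivAt_right (hRc.intervalIntegrable _ _)
      (hRc.stronglyMeasurableAtFilter _ _) hRc.continuousAt
  have hbcom : ∀ s t, Commute (b s) (b t) := fun s t =>
    commute_intervalIntegral hRc (fun r => (commute_intervalIntegral hRc (hcom r) 0 s).symm) 0 t
  have hexpd : ∀ t, HasDerivAt (fun s => NormedSpace.exp (-b s))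
      (NormedSpace.exp (-b t) * (-R t)) t := fun t =>
    hasDerivAt_exp_of_commute (b := fun s => -b s) (hbd t).neg
      fun s => (hbcom t s).neg_left.neg_right
  have hprod : ∀ t, HasDerivAt (fun s => NormedSpace.exp (-b s) * q s) 0 t := by
    intro t
    refine ((hexpd t).mul (hqd t)).congr_deriv ?_
    have : R t * q t = p' t • (a - 1) := by
      rw [hR, mul_assoc, Ring.inverse_mul_cancel _ (hqu t), mul_one]
    rw [mul_assoc, neg_mul, this, mul_neg, neg_add_cancel]
  have hconst := is_const_of_deriv_eq_zero (fun t => (hprod t).differentiableAt)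
    (fun t => (hprod t).deriv) 1 0
  have hq1 : q 1 = a := by simp [hq, hp]
  have hq0 : q 0 = 1 := by simp [hq, hp]
  have hb0 : b 0 = 0 := by simp [hb]
  simp only [hq1, hq0, hb0, neg_zero, NormedSpace.exp_zero, mul_one] at hconst
  refine ⟨b 1, ?_⟩
  calc NormedSpace.exp (b 1) = NormedSpace.exp (b 1) * (NormedSpace.exp (-b 1) * a) := by
        rw [hconst, mul_one]
    _ = a := by
        rw [← mul_assoc, ← NormedSpace.exp_add_of_commute ((Commute.refl _).neg_right),
          add_neg_cancel, NormedSpace.exp_zero, one_mul]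

end Log

/-! ### Ordinary differential equations -/

section ODE

variable {V : Type*} [NormedAddCommGroup V] [NormedSpace ℝ V]

/-- Bootstrapping: a `Cⁿ` solution has a `Cⁿ` right-hand side, hence is `Cⁿ⁺¹`. -/
theorem contDiff_of_ode {G : ℝ × V → V} (hG : ContDiff ℝ ∞ G) {X : ℝ → V}
    (h : ∀ t, HasDerivAt X (G (t, X t)) t) : ContDiff ℝ ∞ X := by
  refine contDiff_infty.2 fun n => ?_
  induction n with
  | zero =>
    exact contDiff_zero.2 (continuous_iff_continuousAt.2 fun t => (h t).continuousAt)
  | succ n ih =>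
    push_cast
    rw [contDiff_succ_iff_deriv]
    refine ⟨fun t => (h t).differentiableAt, by simp, ?_⟩
    rw [show deriv X = fun t => G (t, X t) from funext fun t => (h t).deriv]
    exact (hG.of_le (by exact_mod_cast le_top)).comp (contDiff_id.prodMk ih)

theorem linear_ode_unique {A : ℝ → V →L[ℝ] V} {K : ℝ} (hA : ∀ t, ‖A t‖ ≤ K) {X Y : ℝ → V}
    (hX : ∀ t, HasDerivAt X (A t (X t)) t) (hY : ∀ t, HasDerivAt Y (A t (Y t)) t) {t₀ : ℝ}
    (h0 : X t₀ = Y t₀) : X = Y := by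
  refine ODE_solution_unique_univ (v := fun t x => A t x) (s := fun _ => univ) (K := K.toNNReal)
    (fun t => ?_) (fun t => ⟨hX t, mem_univ _⟩) (fun t => ⟨hY t, mem_univ _⟩) h0
  refine ((A t).lipschitz.weaken ?_).lipschitzOnWith
  rw [← NNReal.coe_le_coe, coe_nnnorm]
  exact (hA t).trans (Real.le_coe_toNNReal K)

theorem exists_bound_of_periodic {V : Type*} [NormedAddCommGroup V] {f : ℝ → V} (hf : Continuous f) {T : ℝ} (hT : 0 < T)
    (hp : Function.Periodic f T) : ∃ C, ∀ t, ‖f t‖ ≤ C := by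
  obtain ⟨C, hC⟩ := (isCompact_Icc (a := 0) (b := T)).exists_bound_of_continuousOn
    hf.continuousOn
  refine ⟨C, fun t => ?_⟩
  obtain ⟨s, hs, hst⟩ := hp.exists_mem_Ico₀ hT t
  rw [hst]
  exact hC s (Ico_subset_Icc_self hs)

end ODE

/-! ### Complexification -/

section Complexification

variable {ι κ : Type*} [Fintype ι] [Fintype κ]

/-- Complexification of a real linear map, as a continuous complex linear map. -/
noncomputable def cplx (A : (ι → ℝ) →L[ℝ] (κ → ℝ)) : (ι → ℂ) →L[ℂ] (κ → ℂ) :=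
  LinearMap.toContinuousLinearMap
    { toFun := complexify A
      map_add' := fun z z' => by
        have h1 : (fun i => ((z + z') i).re) = (fun i => (z i).re) + fun i => (z' i).re := rfl
        have h2 : (fun i => ((z + z') i).im) = (fun i => (z i).im) + fun i => (z' i).im := rfl
        simp only [complexify]
        rw [h1, h2, map_add, map_add]
        ext i
        simp only [toC, Pi.add_apply, Pi.smul_apply, smul_eq_mul]
        push_cast
        ring
      map_smul' := fun c z => by
        have h1 : (fun i => ((c • z) i).re) =
            c.re • (fun i => (z i).re) - c.im • fun i => (z i).im := by
          ext i; simp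
        have h2 : (fun i => ((c • z) i).im) =
            c.re • (fun i => (z i).im) + c.im • fun i => (z i).re := by
          ext i; simp
        simp only [complexify]
        rw [h1, h2, map_add, map_sub, map_smul, map_smul, map_smul, map_smul]
        ext i
        simp only [toC, Pi.add_apply, Pi.sub_apply, Pi.smul_apply, smul_eq_mul, RingHom.id_apply]
        push_cast
        set x : ℂ := (((A fun i => (z i).re) i : ℝ) : ℂ)
        set y : ℂ := (((A fun i => (z i).im) i : ℝ) : ℂ)
        linear_combination (-(c.im : ℂ) * y) * Complex.I_sq +
          (x + Complex.I * y) * Complex.re_add_im c }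

theorem cplx_apply (A : (ι → ℝ) →L[ℝ] (κ → ℝ)) (z : ι → ℂ) : cplx A z = complexify A z := rfl

theorem cplx_toC (A : (ι → ℝ) →L[ℝ] (κ → ℝ)) (x : ι → ℝ) : cplx A (toC x) = toC (A x) := by
  have h : (fun _ : ι => (0 : ℝ)) = 0 := rfl
  ext i
  simp [cplx_apply, complexify, toC, h]

theorem toC_re_add_im {ι : Type*} (z : ι → ℂ) :
    z = toC (fun i => (z i).re) + Complex.I • toC (fun i => (z i).im) := by
  ext i
  simp only [toC, Pi.add_apply, Pi.smul_apply, smul_eq_mul]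
  rw [mul_comm, Complex.re_add_im]

theorem re_complexify (A : (ι → ℝ) →L[ℝ] (κ → ℝ)) (z : ι → ℂ) :
    (fun j => (complexify A z j).re) = A fun i => (z i).re := by
  ext j
  simp [complexify, toC]

theorem im_complexify (A : (ι → ℝ) →L[ℝ] (κ → ℝ)) (z : ι → ℂ) :
    (fun j => (complexify A z j).im) = A fun i => (z i).im := by
  ext j
  simp [complexify, toC]

theorem cplx_comp {ρ : Type*} [Fintype ρ] (A : (ι → ℝ) →L[ℝ] (κ → ℝ)) (B : (ρ → ℝ) →L[ℝ] (ι → ℝ)) :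
    cplx (A.comp B) = (cplx A).comp (cplx B) := by
  ext1 z
  simp only [ContinuousLinearMap.comp_apply, cplx_apply]
  rw [complexify.eq_1 A, re_complexify, im_complexify]
  rfl

theorem star_complexify (A : (ι → ℝ) →L[ℝ] (κ → ℝ)) (z : ι → ℂ) :
    star (complexify A z) = complexify A (star z) := by
  have h1 : (fun i => ((star z) i).re) = fun i => (z i).re := rfl
  have h2 : (fun i => ((star z) i).im) = -fun i => (z i).im := rfl
  rw [complexify, complexify, h1, h2, map_neg]
  ext j
  simp [toC]

/-- Complexification as a continuous linear map. -/
noncomputable def cplxL (ι κ : Type*) [Fintype ι] [Fintype κ] :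
    ((ι → ℝ) →L[ℝ] (κ → ℝ)) →L[ℝ] ((ι → ℂ) →L[ℂ] (κ → ℂ)) :=
  LinearMap.toContinuousLinearMap
    { toFun := cplx
      map_add' := fun A B => by
        ext z i
        simp [cplx_apply, complexify, toC]
        ring
      map_smul' := fun c A => by
        ext z i
        simp [cplx_apply, complexify, toC]
        ring }

theorem cplxL_apply (A : (ι → ℝ) →L[ℝ] (κ → ℝ)) : cplxL ι κ A = cplx A := rfl

theorem cplx_injective_apply {A : (ι → ℝ) →L[ℝ] (κ → ℝ)} (hA : ∀ x, A x = 0 → x = 0) {z : ι → ℂ}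
    (hz : cplx A z = 0) : z = 0 := by
  have h1 := hA _ (by rw [← re_complexify, ← cplx_apply, hz]; rfl)
  have h2 := hA _ (by rw [← im_complexify, ← cplx_apply, hz]; rfl)
  ext i
  exact Complex.ext (congrFun h1 i) (congrFun h2 i)

end Complexification

end DelayPhase

namespace DelayPhase

open Filter Topology MeasureTheory

/-! ### Floquet theory of a normally hyperbolic periodic orbit -/

/-! ### Complex linear maps depending on a real parameter, and exponentials -/

section ComplexFamilies

variable {E F G : Type*} [NormedAddCommGroup E] [NormedSpace ℂ E] [NormedAddCommGroup F]
  [NormedSpace ℂ F] [NormedAddCommGroup G] [NormedSpace ℂ G]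

theorem contDiff_clm_comp_complex {X : Type*} [NormedAddCommGroup X] [NormedSpace ℝ X]
    {A : X → F →L[ℂ] G} {B : X → E →L[ℂ] F} (hA : ContDiff ℝ ∞ A) (hB : ContDiff ℝ ∞ B) :
    ContDiff ℝ ∞ fun x => (A x).comp (B x) :=
  ((isBoundedBilinearMap_comp (𝕜 := ℂ) (E := E) (F := F) (G := G)).contDiff.restrict_scalars
    ℝ).comp (hA.prodMk hB)

theorem hasDerivAt_clm_comp_complex {A : ℝ → F →L[ℂ] G} {B : ℝ → E →L[ℂ] F} {A' : F →L[ℂ] G}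
    {B' : E →L[ℂ] F} {t : ℝ} (hA : HasDerivAt A A' t) (hB : HasDerivAt B B' t) :
    HasDerivAt (fun t => (A t).comp (B t)) (A'.comp (B t) + (A t).comp B') t := by
  have h := (((isBoundedBilinearMap_comp (𝕜 := ℂ) (E := E) (F := F) (G := G)).hasFDerivAt
    (A t, B t)).restrictScalars ℝ).comp_hasDerivAt t (hA.prodMk hB)
  refine h.congr_deriv ?_
  ext1 z
  simp [IsBoundedBilinearMap.deriv, add_comm]

theorem exp_smul_mul_exp_smul_neg {𝔸 : Type*} [NormedRing 𝔸] [NormedAlgebra ℂ 𝔸] [CompleteSpace 𝔸]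
    (L : 𝔸) (z : ℂ) : NormedSpace.exp (z • L) * NormedSpace.exp (z • -L) = 1 := by
  let +nondep : NormedAlgebra ℚ 𝔸 := .restrictScalars ℚ ℂ 𝔸
  rw [smul_neg, ← NormedSpace.exp_add_of_commute (Commute.refl (z • L)).neg_right,
    add_neg_cancel, NormedSpace.exp_zero]

theorem exp_add_smul {𝔸 : Type*} [NormedRing 𝔸] [NormedAlgebra ℂ 𝔸] [CompleteSpace 𝔸]
    (L : 𝔸) (z w : ℂ) :
    NormedSpace.exp ((z + w) • L) = NormedSpace.exp (w • L) * NormedSpace.exp (z • L) := by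
  let +nondep : NormedAlgebra ℚ 𝔸 := .restrictScalars ℚ ℂ 𝔸
  rw [← NormedSpace.exp_add_of_commute (((Commute.refl L).smul_left w).smul_right z), ← add_smul,
    add_comm]

theorem exp_apply_of_eigenvector [CompleteSpace E] {B : E →L[ℂ] E} {μ : ℂ} {w : E}
    (h : B w = μ • w) : NormedSpace.exp B w = Complex.exp μ • w := by
  have h1 := (NormedSpace.exp_series_hasSum_exp' (𝕂 := ℂ) B).mapL
    (ContinuousLinearMap.apply ℂ E w)
  have h2 := (NormedSpace.exp_series_hasSum_exp' (𝕂 := ℂ) μ).smul_const w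
  have hp : ∀ n : ℕ, (B ^ n) w = μ ^ n • w := by
    intro n
    induction n with
    | zero => simp
    | succ n ih =>
      rw [pow_succ, mul_apply_eq_comp, h, map_smul, ih, smul_smul, pow_succ, mul_comm]
  rw [Complex.exp_eq_exp_ℂ]
  refine h1.unique ?_
  convert h2 using 2 with n
  simp [hp, smul_smul]

end ComplexFamilies

/-! ### Monodromy and the normal frame of a single orbit -/

section Floquet

variable {k : ℕ} {F : (Fin k → ℝ) → (Fin k → ℝ)} {γ : ℝ → (Fin k → ℝ)} {T : ℝ}

theorem IsHyperbolicPeriodicOrbit.contDiff (h : IsHyperbolicPeriodicOrbit F γ T)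
    (hF : ContDiff ℝ ∞ F) : ContDiff ℝ ∞ γ :=
  contDiff_of_ode (G := fun p : ℝ × (Fin k → ℝ) => F p.2) (hF.comp contDiff_snd) h.solution

theorem IsHyperbolicPeriodicOrbit.hasDerivAt_velocity (h : IsHyperbolicPeriodicOrbit F γ T)
    (hF : ContDiff ℝ ∞ F) (t : ℝ) :
    HasDerivAt (fun t => F (γ t)) (fderiv ℝ F (γ t) (F (γ t))) t :=
  (hF.differentiable (by simp) _).hasFDerivAt.comp_hasDerivAt t (h.solution t)

theorem IsHyperbolicPeriodicOrbit.exists_bound (h : IsHyperbolicPeriodicOrbit F γ T)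
    (hF : ContDiff ℝ ∞ F) : ∃ K, ∀ t, ‖fderiv ℝ F (γ t)‖ ≤ K :=
  exists_bound_of_periodic ((hF.continuous_fderiv (by simp)).comp (h.contDiff hF).continuous)
    h.period_pos (h.periodic.comp _)

/-- The velocity solves the variational equation, so a single zero makes it vanish identically. The
orbit would then be constant, contrary to `minimal` at time `T / 2`. -/
theorem IsHyperbolicPeriodicOrbit.velocity_ne_zero (h : IsHyperbolicPeriodicOrbit F γ T)
    (hF : ContDiff ℝ ∞ F) (t : ℝ) : F (γ t) ≠ 0 := by
  intro h0
  obtain ⟨K, hK⟩ := h.exists_bound hF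
  have hz : (fun t => F (γ t)) = fun _ => 0 :=
    linear_ode_unique hK (h.hasDerivAt_velocity hF)
      (fun t => by simpa using hasDerivAt_const t (0 : Fin k → ℝ)) (t₀ := t) h0
  have hc := is_const_of_deriv_eq_zero (fun t => (h.solution t).differentiableAt)
    (fun t => (h.solution t).deriv.trans (congrFun hz t)) (T / 2) 0
  exact h.minimal (T / 2) ⟨half_pos h.period_pos, half_lt_self h.period_pos⟩ hc

/-- Ensures that the natural-number subtractions in `k - 1` and `codim` are not truncated. -/
theorem IsHyperbolicPeriodicOrbit.pos (h : IsHyperbolicPeriodicOrbit F γ T)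
    (hF : ContDiff ℝ ∞ F) : 1 ≤ k := by
  by_contra hk
  obtain rfl : k = 0 := by omega
  exact h.velocity_ne_zero hF 0 (Subsingleton.elim _ _)

theorem isRoot_of_eigenvector {M : (Fin k → ℝ) →L[ℝ] (Fin k → ℝ)} {μ : ℂ} {z : Fin k → ℂ}
    (hz : z ≠ 0) (h : cplx M z = μ • z) :
    ((charpolyOf M).map (algebraMap ℝ ℂ)).IsRoot μ := by
  set A : Matrix (Fin k) (Fin k) ℝ := LinearMap.toMatrix' (M : (Fin k → ℝ) →ₗ[ℝ] (Fin k → ℝ))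
  have hA : charpolyOf M = A.charpoly :=
    (LinearMap.charpoly_toMatrix (M : (Fin k → ℝ) →ₗ[ℝ] (Fin k → ℝ)) (Pi.basisFun ℝ (Fin k))).symm
  have hmul : (A.map (algebraMap ℝ ℂ)).mulVec z = cplx M z := by
    have hre : ∀ x : Fin k → ℝ, (A.map (algebraMap ℝ ℂ)).mulVec (toC x) = toC (M x) := by
      intro x
      have : M x = A.mulVec x := by
        rw [LinearMap.toMatrix'_mulVec]; rfl
      rw [this]
      ext i
      simp [Matrix.mulVec, dotProduct, toC]
    rw [cplx_apply, complexify, ← hre, ← hre, ← Matrix.mulVec_smul, ← Matrix.mulVec_add,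
      ← toC_re_add_im]
  rw [hA, ← Matrix.charpoly_map, Polynomial.IsRoot, Matrix.eval_charpoly,
    ← Matrix.exists_mulVec_eq_zero_iff]
  refine ⟨z, hz, ?_⟩
  rw [Matrix.sub_mulVec, hmul, h, sub_eq_zero]
  simp [Matrix.scalar_apply]

/-- A complement to the eigenvector of a simple eigenvalue `1`, in coordinates. -/
theorem exists_complement {M : (Fin k → ℝ) →L[ℝ] (Fin k → ℝ)} {v₀ : Fin k → ℝ} (hv₀ : v₀ ≠ 0)
    (hM : M v₀ = v₀) (hinj : ∀ x, M x = 0 → x = 0)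
    (hsimple : (charpolyOf M).rootMultiplicity 1 = 1) :
    ∃ (P : (Fin (k - 1) → ℝ) →L[ℝ] (Fin k → ℝ)) (M' : (Fin (k - 1) → ℝ) →L[ℝ] (Fin (k - 1) → ℝ)),
      M.comp P = P.comp M' ∧ (∀ x, M' x = 0 → x = 0) ∧ (∀ x, M' x = x → x = 0) ∧
      ∀ (c : ℝ) (x), c • v₀ + P x = 0 → c = 0 ∧ x = 0 := by
  set f : Module.End ℝ (Fin k → ℝ) := (M : (Fin k → ℝ) →ₗ[ℝ] (Fin k → ℝ)) with hf
  set D : Module.End ℝ (Fin k → ℝ) := f - 1 with hD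
  have hDx : ∀ x, D x = M x - x := fun x => rfl
  have hker : ∀ x, D x = 0 ↔ M x = x := fun x => by rw [hDx, sub_eq_zero]
  have hgen : Module.finrank ℝ (f.maxGenEigenspace 1) = 1 := by
    rw [LinearMap.finrank_maxGenEigenspace_eq]; exact hsimple
  have hkle : LinearMap.ker D ≤ f.maxGenEigenspace 1 := by
    intro x hx
    rw [Module.End.mem_maxGenEigenspace]
    refine ⟨1, ?_⟩
    rw [pow_one, one_smul]
    exact hx
  have hv₀k : v₀ ∈ LinearMap.ker D := (hker v₀).2 hM
  have hkerpos : 0 < Module.finrank ℝ (LinearMap.ker D) := by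
    rw [Module.finrank_pos_iff]
    exact ⟨⟨v₀, hv₀k⟩, 0, fun h => hv₀ (congrArg Subtype.val h)⟩
  -- Algebraic multiplicity one makes the generalised eigenspace a line, and this line already
  -- contains the eigenvector `v₀`.
  have hkereq : LinearMap.ker D = f.maxGenEigenspace 1 :=
    Submodule.eq_of_le_of_finrank_le hkle (by omega)
  have hker1 : Module.finrank ℝ (LinearMap.ker D) = 1 := by rw [hkereq, hgen]
  have hrange : Module.finrank ℝ (LinearMap.range D) = k - 1 := by
    have := D.finrank_range_add_finrank_ker
    rw [hker1, Module.finrank_fin_fun] at this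
    omega
  -- Consequently kernel and range of `M - 1` meet only in zero. The range is the desired
  -- complement: it is invariant, has dimension `k - 1`, and `M` has no nonzero fixed vector in it.
  have hdisj : ∀ x, D (D x) = 0 → D x = 0 := by
    intro x hx
    have : x ∈ f.maxGenEigenspace 1 := by
      rw [Module.End.mem_maxGenEigenspace]
      refine ⟨2, ?_⟩
      rw [pow_two, one_smul]
      exact hx
    rw [← hkereq] at this
    exact this
  let b := Module.finBasisOfFinrankEq ℝ (LinearMap.range D) hrange
  let e : LinearMap.range D ≃ₗ[ℝ] (Fin (k - 1) → ℝ) := b.equivFun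
  have hinv : ∀ x ∈ LinearMap.range D, f x ∈ LinearMap.range D := by
    rintro _ ⟨y, rfl⟩
    exact ⟨f y, by simp [hD]⟩
  let P : (Fin (k - 1) → ℝ) →L[ℝ] (Fin k → ℝ) :=
    LinearMap.toContinuousLinearMap ((LinearMap.range D).subtype ∘ₗ e.symm.toLinearMap)
  let M' : (Fin (k - 1) → ℝ) →L[ℝ] (Fin (k - 1) → ℝ) :=
    LinearMap.toContinuousLinearMap (e.toLinearMap ∘ₗ f.restrict hinv ∘ₗ e.symm.toLinearMap)
  have hP : ∀ x, P x = (e.symm x : Fin k → ℝ) := fun x => rfl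
  have hcomm : ∀ x, M (P x) = P (M' x) := by
    intro x
    have : e.symm (M' x) = f.restrict hinv (e.symm x) := e.symm_apply_apply _
    rw [hP, hP, this]
    rfl
  have hP0 : ∀ x, P x = 0 → x = 0 := by
    intro x hx
    have : e.symm x = 0 := Subtype.ext hx
    simpa using this
  have hPr : ∀ x, ∃ y, P x = D y := fun x => by
    obtain ⟨y, hy⟩ := (e.symm x).2
    exact ⟨y, hy.symm⟩
  have hPfix : ∀ x, M (P x) = P x → x = 0 := by
    intro x hx
    obtain ⟨y, hy⟩ := hPr x
    refine hP0 x ?_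
    rw [hy]
    exact hdisj y (by rw [← hy]; exact (hker _).2 hx)
  refine ⟨P, M', ContinuousLinearMap.ext hcomm, fun x hx => ?_, fun x hx => ?_, fun c x hx => ?_⟩
  · exact hP0 x (hinj _ (by rw [hcomm, hx, map_zero]))
  · exact hPfix x (by rw [hcomm, hx])
  · have h1 : P x = -(c • v₀) := by rw [eq_neg_iff_add_eq_zero, add_comm]; exact hx
    have h2 : x = 0 := hPfix x (by rw [h1, map_neg, map_smul, hM])
    rw [h2, map_zero, add_zero] at hx
    exact ⟨(smul_eq_zero.1 hx).resolve_right hv₀, h2⟩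

/-- With `P` a basis of the invariant complement, `M'` the monodromy in these coordinates and
`exp(TL) = M'`, the frame is `N(t) = Φ(t) P exp(-tL)`. Complex coefficients are used because a real
invertible `M'` need not have a real logarithm. -/
theorem IsHyperbolicPeriodicOrbit.exists_floquet (h : IsHyperbolicPeriodicOrbit F γ T)
    (hF : ContDiff ℝ ∞ F) :
    ∃ (N : ℝ → (Fin (k - 1) → ℂ) →L[ℂ] (Fin k → ℂ))
      (L : (Fin (k - 1) → ℂ) →L[ℂ] (Fin (k - 1) → ℂ)),
      ContDiff ℝ ∞ N ∧ Function.Periodic N T ∧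
      (∀ (μ : ℂ) (w : Fin (k - 1) → ℂ), w ≠ 0 → L w = μ • w → μ.re ≠ 0) ∧
      (∀ t, HasDerivAt N ((cplx (fderiv ℝ F (γ t))).comp (N t) - (N t).comp L) t) ∧
      ∀ (t : ℝ) (c : ℂ) (w : Fin (k - 1) → ℂ), c • toC (F (γ t)) + N t w = 0 → c = 0 ∧ w = 0 := by
  obtain ⟨Φ, ⟨hΦ0, hΦ⟩, hsimple, hhyp⟩ := h.hyperbolic
  obtain ⟨K, hK⟩ := h.exists_bound hF
  have hγs := h.contDiff hF
  have hAs : ContDiff ℝ ∞ fun t => fderiv ℝ F (γ t) :=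
    (hF.fderiv_right (m := ∞) (by simp)).comp hγs
  have hΦs : ContDiff ℝ ∞ Φ :=
    contDiff_of_ode (G := fun p : ℝ × ((Fin k → ℝ) →L[ℝ] (Fin k → ℝ)) =>
      (fderiv ℝ F (γ p.1)).comp p.2) ((hAs.comp contDiff_fst).clm_comp contDiff_snd) hΦ
  have hΦv : ∀ v t, HasDerivAt (fun t => Φ t v) (fderiv ℝ F (γ t) (Φ t v)) t := fun v t => by
    simpa using (hΦ t).clm_apply (hasDerivAt_const t v)
  have hΦinj : ∀ t x, Φ t x = 0 → x = 0 := by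
    intro t x hx
    have := congrFun (linear_ode_unique hK (hΦv x) (Y := fun _ => 0)
      (fun t => by simpa using hasDerivAt_const t (0 : Fin k → ℝ)) (t₀ := t) hx) 0
    simpa [hΦ0] using this
  -- Both sides solve the same variational equation, since its coefficients have period `T`, and
  -- they agree at time `0`.
  have hΦper : ∀ t, Φ (t + T) = (Φ t).comp (Φ T) := by
    intro t
    ext1 x
    refine congrFun (linear_ode_unique hK (X := fun t => Φ (t + T) x)
      (Y := fun t => Φ t (Φ T x)) (fun t => ?_) (hΦv (Φ T x)) (t₀ := 0) (by simp [hΦ0])) t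
    have h1 := (hΦv x (t + T)).comp_add_const t T
    rwa [h.periodic t] at h1
  have hvel : ∀ t, Φ t (F (γ 0)) = F (γ t) := fun t =>
    congrFun (linear_ode_unique hK (hΦv (F (γ 0))) (h.hasDerivAt_velocity hF) (t₀ := 0)
      (by simp [hΦ0])) t
  have hv₀ := h.velocity_ne_zero hF 0
  have hMv : Φ T (F (γ 0)) = F (γ 0) := by
    rw [hvel T, ← h.periodic 0, zero_add]
  obtain ⟨P, M', hPM, hM'inj, hM'fix, hcompl⟩ :=
    exists_complement hv₀ hMv (hΦinj T) hsimple
  have hMc : IsUnit (cplx M') := by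
    have hinj : Function.Injective (cplx M' : (Fin (k - 1) → ℂ) →ₗ[ℂ] (Fin (k - 1) → ℂ)) := by
      rw [← LinearMap.ker_eq_bot, LinearMap.ker_eq_bot']
      exact fun z hz => cplx_injective_apply hM'inj hz
    let e := (LinearEquiv.ofInjectiveEndo _ hinj).toContinuousLinearEquiv
    exact ⟨ContinuousLinearEquiv.unitsEquiv ℂ (Fin (k - 1) → ℂ) |>.symm e, rfl⟩
  have hfin : (spectrum ℂ (cplx M')).Finite := by
    refine (Module.End.finite_spectrum
      (cplx M' : (Fin (k - 1) → ℂ) →ₗ[ℂ] (Fin (k - 1) → ℂ))).subset fun μ hμ => ?_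
    have := AlgEquiv.spectrum_eq (Module.End.toContinuousLinearMap (𝕜 := ℂ) (Fin (k - 1) → ℂ))
      (cplx M' : (Fin (k - 1) → ℂ) →ₗ[ℂ] (Fin (k - 1) → ℂ))
    rw [← this]
    exact hμ
  obtain ⟨B, hB⟩ := exists_exp_eq hMc hfin
  have hT := h.period_pos
  have hTc : (T : ℂ) ≠ 0 := by exact_mod_cast hT.ne'
  set L : (Fin (k - 1) → ℂ) →L[ℂ] (Fin (k - 1) → ℂ) := (T : ℂ)⁻¹ • B with hL
  have hTL : (T : ℂ) • L = B := by rw [hL, smul_smul, mul_inv_cancel₀ hTc, one_smul]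
  set X : ℝ → (Fin (k - 1) → ℂ) →L[ℂ] (Fin (k - 1) → ℂ) :=
    fun t => NormedSpace.exp ((t : ℂ) • -L) with hX
  have hXd : ∀ t, HasDerivAt X ((X t).comp (-L)) t := fun t => by
    have := (hasDerivAt_exp_smul_const (𝕂 := ℂ) (-L) (t : ℂ)).scomp t
      (Complex.ofRealCLM.hasDerivAt (x := t))
    rw [Complex.ofRealCLM_apply, Complex.ofReal_one, one_smul] at this
    exact this
  have hXs : ContDiff ℝ ∞ X :=
    contDiff_of_ode (G := fun p : ℝ × ((Fin (k - 1) → ℂ) →L[ℂ] (Fin (k - 1) → ℂ)) =>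
      p.2.comp (-L)) (contDiff_clm_comp_complex contDiff_snd contDiff_const) hXd
  -- The factor `exp(-TL)` gained over one period cancels the monodromy; this is what makes `N`
  -- periodic.
  have hXT : ∀ t, cplx M' * X (t + T) = X t := by
    intro t
    have h1 : X (t + T) = X T * X t := by
      simp only [hX]
      rw [Complex.ofReal_add]
      exact exp_add_smul (-L) t T
    have h2 : cplx M' * X T = 1 := by
      rw [← hB, ← hTL]
      exact exp_smul_mul_exp_smul_neg L T
    rw [h1, ← mul_assoc, h2, one_mul]
  set N : ℝ → (Fin (k - 1) → ℂ) →L[ℂ] (Fin k → ℂ) :=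
    fun t => ((cplx (Φ t)).comp (cplx P)).comp (X t) with hN
  have hΦc : ∀ t, HasDerivAt (fun t => cplx (Φ t)) (cplx ((fderiv ℝ F (γ t)).comp (Φ t))) t :=
    fun t => (cplxL (Fin k) (Fin k)).hasFDerivAt.comp_hasDerivAt t (hΦ t)
  have hXinj : ∀ t w, X t w = 0 → w = 0 := by
    intro t w hw
    have : NormedSpace.exp ((t : ℂ) • L) * X t = 1 := exp_smul_mul_exp_smul_neg L t
    have h2 := congrArg (fun A : (Fin (k - 1) → ℂ) →L[ℂ] (Fin (k - 1) → ℂ) => A w) this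
    simpa [hw] using h2.symm
  refine ⟨N, L, ?_, ?_, ?_, ?_, ?_⟩
  · have h1 : ContDiff ℝ ∞ fun t => cplx (Φ t) := (cplxL (Fin k) (Fin k)).contDiff.comp hΦs
    exact contDiff_clm_comp_complex (contDiff_clm_comp_complex h1 contDiff_const) hXs
  · intro t
    simp only [hN]
    rw [hΦper, cplx_comp, ContinuousLinearMap.comp_assoc (cplx (Φ t)), ← cplx_comp, hPM, cplx_comp,
      ← ContinuousLinearMap.comp_assoc, ContinuousLinearMap.comp_assoc _ (cplx M')]
    congr 1
    exact hXT t
  -- An imaginary eigenvalue `μ` of `L` yields a multiplier `e^{Tμ}` on the unit circle, which must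
  -- be `1`. Then `w` is fixed by `M'`, and so are its real and imaginary parts, which therefore
  -- vanish.
  · intro μ w hw hμ hre
    have hexp : cplx M' w = Complex.exp (T * μ) • w := by
      rw [← hB, exp_apply_of_eigenvector]
      rw [← hTL, smul_apply, hμ, smul_smul]
    have hroot : ((charpolyOf (Φ T)).map (algebraMap ℝ ℂ)).IsRoot (Complex.exp (T * μ)) := by
      refine isRoot_of_eigenvector (z := cplx P w) (fun h0 => hw ?_) ?_
      · refine cplx_injective_apply (fun x hx => (hcompl 0 x ?_).2) h0
        rw [zero_smul, zero_add, hx]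
      · have : cplx (Φ T) (cplx P w) = cplx P (cplx M' w) := by
          change ((cplx (Φ T)).comp (cplx P)) w = ((cplx P).comp (cplx M')) w
          rw [← cplx_comp, ← cplx_comp, hPM]
        rw [this, hexp, map_smul]
    have h1 := hhyp _ hroot (by rw [Complex.norm_exp]; simp [hre])
    rw [h1, one_smul] at hexp
    have hr : M' (fun i => (w i).re) = fun i => (w i).re := by
      rw [← re_complexify, ← cplx_apply, hexp]
    have hi : M' (fun i => (w i).im) = fun i => (w i).im := by
      rw [← im_complexify, ← cplx_apply, hexp]
    refine hw ?_
    ext i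
    exact Complex.ext (congrFun (hM'fix _ hr) i) (congrFun (hM'fix _ hi) i)
  · intro t
    have hc : HasDerivAt (fun _ : ℝ => cplx P) 0 t := hasDerivAt_const _ _
    refine (hasDerivAt_clm_comp_complex (hasDerivAt_clm_comp_complex (hΦc t) hc)
      (hXd t)).congr_deriv ?_
    ext1 w
    simp [hN, cplx_comp, sub_eq_add_neg]
  · intro t c w h0
    -- Both the velocity and the frame are transported by `Φ`, so transversality at time `t` is
    -- pulled back to time `0`.
    have h1 : cplx (Φ t) (c • toC (F (γ 0)) + cplx P (X t w)) = 0 := by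
      rw [map_add, map_smul, cplx_toC, hvel]
      exact h0
    have h2 := cplx_injective_apply (hΦinj t) h1
    have hcR : (fun i => ((c • toC (F (γ 0)) + cplx P (X t w)) i).re) =
        c.re • F (γ 0) + P fun i => (X t w i).re := by
      rw [← re_complexify]
      ext i
      simp [toC, cplx_apply]
    have hcI : (fun i => ((c • toC (F (γ 0)) + cplx P (X t w)) i).im) =
        c.im • F (γ 0) + P fun i => (X t w i).im := by
      rw [← im_complexify]
      ext i
      simp [toC, cplx_apply]
    rw [h2] at hcR hcI
    obtain ⟨hr1, hr2⟩ := hcompl _ _ hcR.symm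
    obtain ⟨hi1, hi2⟩ := hcompl _ _ hcI.symm
    refine ⟨Complex.ext hr1 hi1, hXinj t w ?_⟩
    ext i
    exact Complex.ext (congrFun hr2 i) (congrFun hi2 i)

end Floquet

end DelayPhase

namespace DelayPhase

open Filter Topology MeasureTheory

/-! ### The unperturbed torus -/

namespace DelaySystem

variable {m : ℕ} (S : DelaySystem m)

theorem T_pos (j : Fin m) : 0 < S.T j := (S.orbit j).period_pos

theorem freq_pos (j : Fin m) : 0 < S.freq j := div_pos (by positivity) (S.T_pos j)

theorem freq_ne (j : Fin m) : S.freq j ≠ 0 := (S.freq_pos j).ne'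

theorem one_le_d (j : Fin m) : 1 ≤ S.d j := (S.orbit j).pos (S.smooth_F j)

theorem contDiff_γ (j : Fin m) : ContDiff ℝ ∞ (S.γ j) := (S.orbit j).contDiff (S.smooth_F j)

/-- The block of coordinates of the `j`-th unit. -/
noncomputable def block (j : Fin m) : S.State →L[ℝ] (Fin (S.d j) → ℝ) :=
  ContinuousLinearMap.pi fun i => ContinuousLinearMap.proj (⟨j, i⟩ : Coord S.d)

theorem field_apply (x : S.State) (p : Coord S.d) :
    S.field x p = S.F p.1 (S.block p.1 x) p.2 := rfl

theorem contDiff_field : ContDiff ℝ ∞ S.field := by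
  rw [contDiff_pi]
  intro p
  exact (contDiff_pi.1 (S.smooth_F p.1) p.2).comp (S.block p.1).contDiff

theorem fderiv_field_apply (x v : S.State) (p : Coord S.d) :
    fderiv ℝ S.field x v p = fderiv ℝ (S.F p.1) (S.block p.1 x) (S.block p.1 v) p.2 := by
  have h1 : HasFDerivAt (fun x => S.F p.1 (S.block p.1 x))
      ((fderiv ℝ (S.F p.1) (S.block p.1 x)).comp (S.block p.1)) x :=
    ((S.smooth_F p.1).differentiable (by simp) _).hasFDerivAt.comp x (S.block p.1).hasFDerivAt
  have h2 := hasFDerivAt_pi'.1 (S.contDiff_field.differentiable (by simp) x).hasFDerivAt p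
  have h3 := h2.unique (hasFDerivAt_pi'.1 h1 p.2)
  exact congrArg (fun A => A v) h3

theorem contDiff_e₀ : ContDiff ℝ ∞ S.e₀ := by
  rw [contDiff_pi]
  intro p
  refine (contDiff_pi.1 (S.contDiff_γ p.1) p.2).comp ?_
  fun_prop

theorem γ_add_int_mul (j : Fin m) (t : ℝ) (n : ℤ) : S.γ j (t + n * S.T j) = S.γ j t :=
  (S.orbit j).periodic.int_mul n t

theorem smoothTorus_e₀ : SmoothTorus S.e₀ := by
  refine ⟨S.contDiff_e₀, fun φ k => ?_⟩
  ext p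
  have : (φ p.1 + 2 * Real.pi * (k p.1 : ℝ)) / S.freq p.1 =
      φ p.1 / S.freq p.1 + (k p.1 : ℤ) * S.T p.1 := by
    have h1 := (S.T_pos p.1).ne'
    have h2 := Real.pi_ne_zero
    simp only [freq]
    field_simp
  simp only [e₀]
  rw [this, γ_add_int_mul]

/-- The unperturbed flow on the torus is a rigid rotation; this reduces periodicity, smoothness and
derivatives of `E⁰` to those of `e⁰`. -/
theorem E₀_eq (φ : Fin m → ℝ) (s : ℝ) : S.E₀ φ s = S.e₀ (φ + s • S.freq) := by
  ext p
  simp only [E₀, e₀, Pi.add_apply, Pi.smul_apply, smul_eq_mul]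
  congr 2
  have := S.freq_ne p.1
  field_simp

theorem block_e₀ (j : Fin m) (φ : Fin m → ℝ) : S.block j (S.e₀ φ) = S.γ j (φ j / S.freq j) := rfl

theorem fderiv_e₀_apply (φ v : Fin m → ℝ) (p : Coord S.d) :
    fderiv ℝ S.e₀ φ v p =
      v p.1 / S.freq p.1 * S.F p.1 (S.γ p.1 (φ p.1 / S.freq p.1)) p.2 := by
  have h1 := hasDerivAt_pi.1
    (hasDerivAt_line (S.contDiff_e₀.differentiable (by simp)) φ v 0) p
  have h2 : HasDerivAt (fun r : ℝ => (φ p.1 + r * v p.1) / S.freq p.1) (v p.1 / S.freq p.1) 0 := by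
    simpa using (((hasDerivAt_id (0 : ℝ)).mul_const (v p.1)).const_add (φ p.1)).div_const
      (S.freq p.1)
  have h3 := hasDerivAt_pi.1 ((S.orbit p.1).solution ((φ p.1 + 0 * v p.1) / S.freq p.1)) p.2
  have h4 := (h3.scomp (0 : ℝ) h2)
  have h5 := h1.unique h4
  simpa using h5

theorem fderiv_e₀_freq (φ : Fin m → ℝ) : fderiv ℝ S.e₀ φ S.freq = S.field (S.e₀ φ) := by
  ext p
  rw [fderiv_e₀_apply, div_self (S.freq_ne _), one_mul, field_apply, block_e₀]

/-- The tangent vectors `∂_φ e⁰ · v` solve the variational equation. -/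
theorem fderiv_fderiv_e₀ (φ v : Fin m → ℝ) :
    fderiv ℝ (fderiv ℝ S.e₀) φ S.freq v =
      fderiv ℝ S.field (S.e₀ φ) (fderiv ℝ S.e₀ φ v) := by
  -- After exchanging the two directions of differentiation, the claim is the `v`-derivative of the
  -- identity `∂_ω e⁰ = F(e⁰)`.
  have hsymm : IsSymmSndFDerivAt ℝ S.e₀ φ :=
    S.contDiff_e₀.contDiffAt.isSymmSndFDerivAt (by
      rw [minSmoothness_of_isRCLikeNormedField]; exact WithTop.coe_le_coe.2 (le_top : (2 : ℕ∞) ≤ ⊤))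
  rw [hsymm.eq]
  have hd : Differentiable ℝ (fderiv ℝ S.e₀) :=
    (S.contDiff_e₀.fderiv_right (m := ∞) (by simp)).differentiable (by simp)
  have h1 : HasFDerivAt (fun φ => fderiv ℝ S.e₀ φ S.freq)
      ((fderiv ℝ (fderiv ℝ S.e₀) φ).flip S.freq) φ := by
    have := (hd φ).hasFDerivAt.clm_apply (hasFDerivAt_const S.freq φ)
    simpa using this
  have h2 : HasFDerivAt (fun φ => S.field (S.e₀ φ))
      ((fderiv ℝ S.field (S.e₀ φ)).comp (fderiv ℝ S.e₀ φ)) φ :=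
    (S.contDiff_field.differentiable (by simp) _).hasFDerivAt.comp φ
      (S.contDiff_e₀.differentiable (by simp) φ).hasFDerivAt
  rw [show (fun φ => fderiv ℝ S.e₀ φ S.freq) = _ from funext S.fderiv_e₀_freq] at h1
  exact congrArg (fun A => A v) (h1.unique h2)

theorem tangent_eq (φ : Fin m → ℝ) (v : Fin m → ℂ) : S.tangent φ v = cplx (fderiv ℝ S.e₀ φ) v := rfl

theorem tangent_toC (φ v : Fin m → ℝ) : S.tangent φ (toC v) = toC (fderiv ℝ S.e₀ φ v) :=
  cplx_toC _ _

theorem tangent_apply (φ : Fin m → ℝ) (v : Fin m → ℂ) (p : Coord S.d) :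
    S.tangent φ v p =
      (v p.1 / S.freq p.1) * toC (S.F p.1 (S.γ p.1 (φ p.1 / S.freq p.1))) p.2 := by
  simp only [tangent, complexify, toC, Pi.add_apply, Pi.smul_apply, smul_eq_mul, fderiv_e₀_apply]
  push_cast
  nth_rewrite 3 [← Complex.re_add_im (v p.1)]
  ring

theorem sum_d : S.codim + m = ∑ j, S.d j := by
  have : m ≤ ∑ j, S.d j := by
    calc m = ∑ _j : Fin m, 1 := by simp
      _ ≤ _ := Finset.sum_le_sum fun j _ => S.one_le_d j
  simp only [codim]
  omega

theorem exists_codim_equiv : Nonempty (Fin S.codim ≃ ((j : Fin m) × Fin (S.d j - 1))) := by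
  refine ⟨Fintype.equivOfCardEq ?_⟩
  have h : ∑ j, S.d j = ∑ j, (S.d j - 1) + m := by
    calc ∑ j, S.d j = ∑ j, ((S.d j - 1) + 1) :=
          Finset.sum_congr rfl fun j _ => (Nat.sub_add_cancel (S.one_le_d j)).symm
      _ = _ := by rw [Finset.sum_add_distrib]; simp
  have := S.sum_d
  simp only [Fintype.card_fin, Fintype.card_sigma]
  omega

/-- The single-orbit frames are assembled block-diagonally, the `j`-th block evaluated at time `φ_j
/ ω_j`. The bijection `σ` relabels the `n - m` normal coordinates by unit and index. -/
theorem nonempty_floquetFrame : Nonempty S.FloquetFrame := by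
  classical
  obtain ⟨σ⟩ := S.exists_codim_equiv
  choose Nj Lj hNs hNp hLh hNd hNi using fun j => (S.orbit j).exists_floquet (S.smooth_F j)
  let R : (j : Fin m) → (Fin S.codim → ℂ) →L[ℂ] (Fin (S.d j - 1) → ℂ) := fun j =>
    ContinuousLinearMap.pi fun a => ContinuousLinearMap.proj (σ.symm ⟨j, a⟩)
  have hR : ∀ j w a, R j w a = w (σ.symm ⟨j, a⟩) := fun _ _ _ => rfl
  have hR0 : ∀ w, (∀ j, R j w = 0) → w = 0 := by
    intro w hw
    ext c
    have := congrFun (hw (σ c).1) (σ c).2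
    rwa [hR, Sigma.eta, Equiv.symm_apply_apply] at this
  let Lmap : (Fin S.codim → ℂ) →ₗ[ℂ] (Fin S.codim → ℂ) :=
    LinearMap.pi fun c => LinearMap.proj (σ c).2 ∘ₗ
      ((Lj (σ c).1).comp (R (σ c).1) : (Fin S.codim → ℂ) →ₗ[ℂ] (Fin (S.d (σ c).1 - 1) → ℂ))
  let L : Matrix (Fin S.codim) (Fin S.codim) ℂ := LinearMap.toMatrix' Lmap
  have hL : ∀ w j, R j (L.mulVec w) = Lj j (R j w) := by
    intro w j
    ext a
    rw [hR, LinearMap.toMatrix'_mulVec]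
    change Lj (σ (σ.symm ⟨j, a⟩)).1 (R (σ (σ.symm ⟨j, a⟩)).1 w) (σ (σ.symm ⟨j, a⟩)).2 = _
    rw [Equiv.apply_symm_apply]
  -- Written as a finite sum of compositions so that smoothness as an operator-valued map can be
  -- checked termwise.
  let N : (Fin m → ℝ) → (Fin S.codim → ℂ) →L[ℂ] S.CState := fun φ =>
    ∑ p : Coord S.d, (ContinuousLinearMap.single ℂ (fun _ : Coord S.d => ℂ) p).comp
      ((ContinuousLinearMap.proj (R := ℂ) (φ := fun _ : Fin (S.d p.1) => ℂ) p.2).comp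
        ((Nj p.1 (φ p.1 / S.freq p.1)).comp (R p.1)))
  have hN : ∀ φ w p, N φ w p = Nj p.1 (φ p.1 / S.freq p.1) (R p.1 w) p.2 := by
    intro φ w p
    simp only [N, sum_apply, Finset.sum_apply, ContinuousLinearMap.comp_apply,
      ContinuousLinearMap.single_apply, ContinuousLinearMap.proj_apply]
    rw [Finset.sum_eq_single p]
    · simp
    · intro q _ hq
      exact Pi.single_eq_of_ne hq.symm _
    · simp
  have hNsmooth : ContDiff ℝ ∞ N := by
    refine ContDiff.sum fun p _ => contDiff_clm_comp_complex contDiff_const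
      (contDiff_clm_comp_complex contDiff_const (contDiff_clm_comp_complex ?_ contDiff_const))
    exact (hNs p.1).comp (by fun_prop)
  clear_value N L
  refine ⟨⟨N, L, ⟨hNsmooth, fun φ k => ?_⟩, fun μ hμ => ?_, fun φ => ?_, fun φ w => ?_⟩⟩
  · ext1 w
    ext p
    have h1 := hN (fun j => φ j + 2 * Real.pi * (k j : ℝ)) w p
    have h2 := hN φ w p
    refine h1.trans (Eq.trans ?_ h2.symm)
    have : (φ p.1 + 2 * Real.pi * (k p.1 : ℝ)) / S.freq p.1 =
        φ p.1 / S.freq p.1 + (k p.1 : ℤ) * S.T p.1 := by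
      have h1 := (S.T_pos p.1).ne'
      have h2 := Real.pi_ne_zero
      simp only [freq]
      field_simp
    rw [this]
    exact congrArg (fun A : (Fin (S.d p.1 - 1) → ℂ) →L[ℂ] (Fin (S.d p.1) → ℂ) => A (R p.1 w) p.2)
      ((hNp p.1).int_mul (k p.1) _)
  · rw [spectrum.mem_iff, Matrix.isUnit_iff_isUnit_det, isUnit_iff_ne_zero, not_not,
      ← Matrix.exists_mulVec_eq_zero_iff] at hμ
    obtain ⟨w, hw, hμw⟩ := hμ
    have hLw : L.mulVec w = μ • w := by
      rw [Matrix.sub_mulVec, sub_eq_zero] at hμw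
      rw [← hμw, Algebra.algebraMap_eq_smul_one, Matrix.smul_mulVec, Matrix.one_mulVec]
    have : ∃ j, R j w ≠ 0 := by
      by_contra hcon
      push Not at hcon
      exact hw (hR0 w hcon)
    obtain ⟨j, hj⟩ := this
    exact hLh j μ _ hj (by rw [← hL, hLw, map_smul])
  -- Injectivity holds block by block by transversality of each orbit's frame; surjectivity is then
  -- a dimension count.
  · let B : ((Fin m → ℂ) × (Fin S.codim → ℂ)) →ₗ[ℂ] S.CState :=
      ((cplx (fderiv ℝ S.e₀ φ)).coprod (N φ) : _ →L[ℂ] S.CState)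
    have hB : ∀ q, B q = S.tangent φ q.1 + N φ q.2 := fun q => rfl
    have hinj : Function.Injective B := by
      rw [← LinearMap.ker_eq_bot, LinearMap.ker_eq_bot']
      rintro ⟨v, w⟩ hvw
      have h1 : ∀ j, v j / S.freq j = 0 ∧ R j w = 0 := by
        intro j
        refine hNi j (φ j / S.freq j) _ _ ?_
        ext i
        have := congrFun ((hB (v, w)).symm.trans hvw) ⟨j, i⟩
        rw [Pi.add_apply, tangent_apply, hN] at this
        simpa using this
      refine Prod.ext (funext fun j => ?_) (hR0 w fun j => (h1 j).2)
      exact (div_eq_zero_iff.1 (h1 j).1).resolve_right (by exact_mod_cast S.freq_ne j)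
    have hdim : Module.finrank ℂ ((Fin m → ℂ) × (Fin S.codim → ℂ)) =
        Module.finrank ℂ S.CState := by
      have := S.sum_d
      rw [Module.finrank_prod, Module.finrank_fin_fun, Module.finrank_fin_fun,
        Module.finrank_fintype_fun_eq_card, Fintype.card_sigma]
      simp only [Fintype.card_fin]
      omega
    exact ⟨hinj, (LinearMap.injective_iff_surjective_of_finrank_eq_finrank hdim).1 hinj⟩
  · ext p
    have h1 := hasDerivAt_line (hNsmooth.differentiable (by simp)) φ S.freq 0
    rw [zero_smul, add_zero] at h1
    have hev : ∀ {N' : (Fin S.codim → ℂ) →L[ℂ] S.CState} {f : ℝ → (Fin S.codim → ℂ) →L[ℂ] S.CState},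
        HasDerivAt f N' 0 → HasDerivAt (fun r => f r w p) (N' w p) 0 := by
      intro N' f hf
      exact (((ContinuousLinearMap.proj (R := ℂ) (φ := fun _ : Coord S.d => ℂ) p).comp
        (ContinuousLinearMap.apply ℂ S.CState w)).restrictScalars ℝ).hasFDerivAt.comp_hasDerivAt
        (0 : ℝ) hf
    have h2 := hev h1
    have h3 : HasDerivAt (fun r : ℝ => φ p.1 / S.freq p.1 + r) 1 0 := (hasDerivAt_id _).const_add _
    have h4 := HasDerivAt.scomp (0 : ℝ) (hNd p.1 (φ p.1 / S.freq p.1 + 0)) h3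
    rw [add_zero, one_smul] at h4
    have h5 := ((((ContinuousLinearMap.proj (R := ℂ) (φ := fun _ : Fin (S.d p.1) => ℂ) p.2).comp
        (ContinuousLinearMap.apply ℂ _ (R p.1 w))).restrictScalars ℝ).hasFDerivAt.comp_hasDerivAt
        (0 : ℝ) h4)
    -- Along `ω` every phase time `φ_j / ω_j` advances at unit speed, so `∂_ω N` is the time
    -- derivative in each block.
    have hfun : (fun r : ℝ => N (φ + r • S.freq) w p) =
        fun r : ℝ => Nj p.1 (φ p.1 / S.freq p.1 + r) (R p.1 w) p.2 := by
      funext r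
      rw [hN]
      have := S.freq_ne p.1
      simp only [Pi.add_apply, Pi.smul_apply, smul_eq_mul]
      field_simp
    rw [hfun] at h2
    have h6 := h2.unique h5
    rw [Pi.add_apply, h6, hN, hL]
    have hc : complexify (fderiv ℝ S.field (S.e₀ φ)) (N φ w) p =
        complexify (fderiv ℝ (S.F p.1) (S.γ p.1 (φ p.1 / S.freq p.1)))
          (Nj p.1 (φ p.1 / S.freq p.1) (R p.1 w)) p.2 := by
      have hb1 : S.block p.1 (fun q => (N φ w q).re) =
          fun i => (Nj p.1 (φ p.1 / S.freq p.1) (R p.1 w) i).re := by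
        ext i
        exact congrArg Complex.re (hN φ w ⟨p.1, i⟩)
      have hb2 : S.block p.1 (fun q => (N φ w q).im) =
          fun i => (Nj p.1 (φ p.1 / S.freq p.1) (R p.1 w) i).im := by
        ext i
        exact congrArg Complex.im (hN φ w ⟨p.1, i⟩)
      simp only [complexify, toC, Pi.add_apply, Pi.smul_apply, fderiv_field_apply, hb1, hb2,
        block_e₀]
    rw [hc]
    simp [cplx_apply]

end DelaySystem

end DelayPhase

namespace DelayPhase

open Filter Topology MeasureTheory

/-! ### Tangential and normal coordinates -/

/-! ### Complex linear families on the torus -/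

section ComplexFamiliesTorus

variable {m : ℕ} {E F : Type*} [NormedAddCommGroup E] [NormedSpace ℂ E] [NormedAddCommGroup F]
  [NormedSpace ℂ F]

/-- Restriction of scalars as a real continuous linear map between spaces of linear maps. -/
noncomputable def restrictL (E F : Type*) [NormedAddCommGroup E] [NormedSpace ℂ E]
    [NormedAddCommGroup F] [NormedSpace ℂ F] : (E →L[ℂ] F) →L[ℝ] (E →L[ℝ] F) :=
  ContinuousLinearMap.restrictScalarsL ℂ E F ℝ ℝ

theorem restrictL_apply (A : E →L[ℂ] F) (x : E) : restrictL E F A x = A x := rfl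

theorem SmoothTorus.clm_apply_complex {A : (Fin m → ℝ) → E →L[ℂ] F} {u : (Fin m → ℝ) → E}
    (hA : SmoothTorus A) (hu : SmoothTorus u) : SmoothTorus fun φ => A φ (u φ) :=
  (hA.comp (restrictL E F).contDiff).clm_apply hu

theorem fderiv_clm_apply_complex {A : (Fin m → ℝ) → E →L[ℂ] F} {u : (Fin m → ℝ) → E}
    (hA : SmoothTorus A) (hu : SmoothTorus u) (φ w : Fin m → ℝ) :
    fderiv ℝ (fun φ => A φ (u φ)) φ w = fderiv ℝ A φ w (u φ) + A φ (fderiv ℝ u φ w) := by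
  have h1 : HasFDerivAt (fun φ => restrictL E F (A φ)) ((restrictL E F).comp (fderiv ℝ A φ)) φ :=
    (restrictL E F).hasFDerivAt.comp φ (hA.differentiable φ).hasFDerivAt
  have h2 := (h1.clm_apply (hu.differentiable φ).hasFDerivAt).fderiv
  have h3 := congrArg (fun B => B w) h2
  refine h3.trans ?_
  simp [restrictL_apply, add_comm]

end ComplexFamiliesTorus

namespace DelaySystem

variable {m : ℕ} {S : DelaySystem m}

/-- `∂_ω z - F'(e⁰) z` for a complex vector field `z` on the torus. -/
noncomputable def variational (S : DelaySystem m) (z : (Fin m → ℝ) → S.CState) (φ : Fin m → ℝ) :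
    S.CState :=
  fderiv ℝ z φ S.freq - complexify (fderiv ℝ S.field (S.e₀ φ)) (z φ)

theorem smoothTorus_star {ι : Type*} [Fintype ι] {z : (Fin m → ℝ) → ι → ℂ} (hz : SmoothTorus z) :
    SmoothTorus fun φ => star (z φ) :=
  hz.comp (g := fun x : ι → ℂ => star x) (starL' ℝ (A := ι → ℂ)).contDiff

/-- The coefficients `F'(e⁰)` and the direction `ω` are real, so the operator commutes with
conjugation. -/
theorem variational_star {z : (Fin m → ℝ) → S.CState} (hz : SmoothTorus z) (φ : Fin m → ℝ) :
    S.variational (fun φ => star (z φ)) φ = star (S.variational z φ) := by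
  have h1 : HasFDerivAt (fun φ => star (z φ))
      (((starL' ℝ (A := S.CState)) : S.CState →L[ℝ] S.CState).comp (fderiv ℝ z φ)) φ :=
    ((starL' ℝ (A := S.CState)) : S.CState →L[ℝ] S.CState).hasFDerivAt.comp φ
      (hz.differentiable φ).hasFDerivAt
  simp only [variational]
  rw [h1.fderiv, star_sub, star_complexify]
  rfl

theorem variational_toC {e : (Fin m → ℝ) → S.State} (he : SmoothTorus e) (φ : Fin m → ℝ) :
    S.variational (fun φ => toC (e φ)) φ =
      toC (fderiv ℝ e φ S.freq - fderiv ℝ S.field (S.e₀ φ) (e φ)) := by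
  simp only [variational]
  rw [fderiv_toC he, ← cplx_apply, cplx_toC]
  ext p
  simp [toC]

theorem smoothTorus_tangent : SmoothTorus fun φ => cplx (fderiv ℝ S.e₀ φ) :=
  S.smoothTorus_e₀.fderiv.comp (cplxL (Fin m) (Coord S.d)).contDiff

theorem fderiv_tangent (φ : Fin m → ℝ) (v : Fin m → ℂ) :
    fderiv ℝ (fun φ => cplx (fderiv ℝ S.e₀ φ)) φ S.freq v =
      complexify (fderiv ℝ S.field (S.e₀ φ)) (S.tangent φ v) := by
  have h1 : HasFDerivAt (fun φ => cplx (fderiv ℝ S.e₀ φ))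
      ((cplxL (Fin m) (Coord S.d)).comp (fderiv ℝ (fderiv ℝ S.e₀) φ)) φ :=
    (cplxL (Fin m) (Coord S.d)).hasFDerivAt.comp φ
      (S.smoothTorus_e₀.fderiv.differentiable φ).hasFDerivAt
  rw [h1.fderiv]
  have h2 : fderiv ℝ (fderiv ℝ S.e₀) φ S.freq =
      (fderiv ℝ S.field (S.e₀ φ)).comp (fderiv ℝ S.e₀ φ) := by
    ext1 x
    exact S.fderiv_fderiv_e₀ φ x
  rw [ContinuousLinearMap.comp_apply, cplxL_apply, h2, cplx_comp]
  rfl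

namespace FloquetFrame

variable (A : S.FloquetFrame)

theorem tangent_add_normal (φ : Fin m → ℝ) (z : S.CState) :
    S.tangent φ (A.tangentInv φ z) + A.N φ (A.normalInv φ z) = z :=
  (A.coords φ).symm_apply_apply z

theorem coords_apply (φ : Fin m → ℝ) (v : Fin m → ℂ) (w : Fin S.codim → ℂ) :
    A.coords φ (S.tangent φ v + A.N φ w) = (v, w) :=
  (A.coords φ).apply_symm_apply (v, w)

theorem tangentInv_apply (φ : Fin m → ℝ) (v : Fin m → ℂ) (w : Fin S.codim → ℂ) :
    A.tangentInv φ (S.tangent φ v + A.N φ w) = v := congrArg Prod.fst (A.coords_apply φ v w)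

theorem normalInv_apply (φ : Fin m → ℝ) (v : Fin m → ℂ) (w : Fin S.codim → ℂ) :
    A.normalInv φ (S.tangent φ v + A.N φ w) = w := congrArg Prod.snd (A.coords_apply φ v w)

theorem add_eq_add_iff {φ : Fin m → ℝ} {v v' : Fin m → ℂ} {w w' : Fin S.codim → ℂ} :
    S.tangent φ v + A.N φ w = S.tangent φ v' + A.N φ w' ↔ v = v' ∧ w = w' := by
  refine ⟨fun h => ?_, fun h => by rw [h.1, h.2]⟩
  have := (A.transverse φ).1 (a₁ := (v, w)) (a₂ := (v', w')) h
  exact Prod.mk_inj.1 this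

theorem tangent_inj (A : S.FloquetFrame) {φ : Fin m → ℝ} {v v' : Fin m → ℂ} :
    S.tangent φ v = S.tangent φ v' ↔ v = v' :=
  ⟨fun h => (A.add_eq_add_iff (w := 0) (w' := 0) |>.1 (by rw [h])).1, fun h => by rw [h]⟩

theorem normal_inj {φ : Fin m → ℝ} {w w' : Fin S.codim → ℂ} : A.N φ w = A.N φ w' ↔ w = w' :=
  ⟨fun h => (A.add_eq_add_iff (v := 0) (v' := 0) |>.1 (by rw [h])).2, fun h => by rw [h]⟩

theorem sub_proj (φ : Fin m → ℝ) (z : S.CState) :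
    z - A.proj φ z = A.N φ (A.normalInv φ z) := by
  rw [proj, sub_eq_iff_eq_add, add_comm, tangent_add_normal]

theorem tangentInv_proj (φ : Fin m → ℝ) (z : S.CState) :
    A.tangentInv φ (A.proj φ z) = A.tangentInv φ z := by
  have := A.tangentInv_apply φ (A.tangentInv φ z) 0
  rwa [map_zero, add_zero] at this

theorem normalInv_sub_proj (φ : Fin m → ℝ) (z : S.CState) :
    A.normalInv φ (z - A.proj φ z) = A.normalInv φ z := by
  rw [sub_proj]
  have := A.normalInv_apply φ 0 (A.normalInv φ z)
  rwa [tangent_eq, map_zero, zero_add] at this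

/-- The isomorphism `(v, w) ↦ T(φ) v + N(φ) w`, as a continuous linear map. -/
noncomputable def frameMap (φ : Fin m → ℝ) : ((Fin m → ℂ) × (Fin S.codim → ℂ)) →L[ℂ] S.CState :=
  (cplx (fderiv ℝ S.e₀ φ)).comp (ContinuousLinearMap.fst ℂ _ _) +
    (A.N φ).comp (ContinuousLinearMap.snd ℂ _ _)

/-- The isomorphism `(v, w) ↦ T(φ) v + N(φ) w`. -/
noncomputable def frameEquiv (φ : Fin m → ℝ) : ((Fin m → ℂ) × (Fin S.codim → ℂ)) ≃L[ℂ] S.CState :=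
  (LinearEquiv.ofBijective (A.frameMap φ).toLinearMap (A.transverse φ)).toContinuousLinearEquiv

theorem frameEquiv_coe (φ : Fin m → ℝ) : (A.frameEquiv φ : _ →L[ℂ] S.CState) = A.frameMap φ := rfl

theorem frameEquiv_symm_apply (φ : Fin m → ℝ) (z : S.CState) :
    (A.frameEquiv φ).symm z = A.coords φ z := by
  rw [ContinuousLinearEquiv.symm_apply_eq]
  exact ((A.coords φ).symm_apply_apply z).symm

theorem smoothTorus_frameMap : SmoothTorus A.frameMap :=
  ⟨(contDiff_clm_comp_complex smoothTorus_tangent.1 contDiff_const).add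
    (contDiff_clm_comp_complex A.smooth.1 contDiff_const), fun φ k => by
      have h1 := (smoothTorus_tangent (S := S)).2 φ k
      have h2 := A.smooth.2 φ k
      simp only [frameMap] at h1 h2 ⊢
      rw [h1, h2]⟩

/-- Inversion of continuous linear maps is smooth at invertible ones, and `frameMap` is a smooth
family of such maps. -/
theorem smoothTorus_coords {z : (Fin m → ℝ) → S.CState} (hz : SmoothTorus z) :
    SmoothTorus fun φ => A.coords φ (z φ) := by
  have h1 : SmoothTorus fun φ => ((A.frameEquiv φ).symm : S.CState →L[ℂ] (Fin m → ℂ) × (Fin S.codim → ℂ)) := by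
    have : (fun φ => ((A.frameEquiv φ).symm : S.CState →L[ℂ] (Fin m → ℂ) × (Fin S.codim → ℂ))) =
        fun φ => ContinuousLinearMap.inverse (A.frameMap φ) := by
      funext φ
      rw [← frameEquiv_coe, ContinuousLinearMap.inverse_equiv]
    rw [this]
    refine ⟨contDiff_iff_contDiffAt.2 fun φ => ?_, A.smoothTorus_frameMap.2.comp _⟩
    have h2 : ContDiffAt ℝ ∞ (ContinuousLinearMap.inverse :
        (((Fin m → ℂ) × (Fin S.codim → ℂ)) →L[ℂ] S.CState) → _) (A.frameMap φ) := by
      rw [← frameEquiv_coe]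
      exact (contDiffAt_map_inverse (A.frameEquiv φ)).restrict_scalars ℝ
    exact h2.comp φ A.smoothTorus_frameMap.1.contDiffAt
  have h2 := h1.clm_apply_complex hz
  simpa only [ContinuousLinearEquiv.coe_coe, frameEquiv_symm_apply] using h2

theorem smoothTorus_tangentInv {z : (Fin m → ℝ) → S.CState} (hz : SmoothTorus z) :
    SmoothTorus fun φ => A.tangentInv φ (z φ) := (A.smoothTorus_coords hz).comp contDiff_fst

theorem smoothTorus_normalInv {z : (Fin m → ℝ) → S.CState} (hz : SmoothTorus z) :
    SmoothTorus fun φ => A.normalInv φ (z φ) := (A.smoothTorus_coords hz).comp contDiff_snd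

theorem smoothTorus_combine {v : (Fin m → ℝ) → Fin m → ℂ} {h : (Fin m → ℝ) → Fin S.codim → ℂ}
    (hv : SmoothTorus v) (hh : SmoothTorus h) :
    SmoothTorus fun φ => S.tangent φ (v φ) + A.N φ (h φ) :=
  (smoothTorus_tangent.clm_apply_complex hv).add (A.smooth.clm_apply_complex hh)

/-- The variational operator in tangential and normal coordinates. -/
theorem variational_combine {v : (Fin m → ℝ) → Fin m → ℂ} {h : (Fin m → ℝ) → Fin S.codim → ℂ}
    (hv : SmoothTorus v) (hh : SmoothTorus h) (φ : Fin m → ℝ) :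
    S.variational (fun φ => S.tangent φ (v φ) + A.N φ (h φ)) φ =
      S.tangent φ (fderiv ℝ v φ S.freq) +
        A.N φ (fderiv ℝ h φ S.freq - A.L.mulVec (h φ)) := by
  have h1 : fderiv ℝ (fun φ => S.tangent φ (v φ) + A.N φ (h φ)) φ S.freq =
      (complexify (fderiv ℝ S.field (S.e₀ φ)) (S.tangent φ (v φ)) +
        S.tangent φ (fderiv ℝ v φ S.freq)) +
      (fderiv ℝ A.N φ S.freq (h φ) + A.N φ (fderiv ℝ h φ S.freq)) := by
    have h0 := fderiv_fun_add
      ((smoothTorus_tangent.clm_apply_complex hv).differentiable φ)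
      ((A.smooth.clm_apply_complex hh).differentiable φ)
    refine (congrArg (fun B => B S.freq) h0).trans ?_
    rw [add_apply, fderiv_clm_apply_complex A.smooth hh]
    congr 1
    rw [← fderiv_tangent]
    exact fderiv_clm_apply_complex smoothTorus_tangent hv φ S.freq
  simp only [variational]
  rw [h1, ← cplx_apply, ← cplx_apply, map_add, cplx_apply _ (A.N φ (h φ)), ← A.floquet, map_sub]
  abel

theorem variational_normal {h : (Fin m → ℝ) → Fin S.codim → ℂ} (hh : SmoothTorus h)
    (φ : Fin m → ℝ) : S.variational (fun φ => A.N φ (h φ)) φ =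
      A.N φ (fderiv ℝ h φ S.freq - A.L.mulVec (h φ)) := by
  have := A.variational_combine (v := fun _ => 0) (SmoothTorus.const 0) hh φ
  simpa [tangent_eq] using this

/-- The image of `N` is invariant under complex conjugation. -/
theorem tangentInv_star_normal (φ : Fin m → ℝ) (w : Fin S.codim → ℂ) :
    A.tangentInv φ (star (A.N φ w)) = 0 := by
  classical
  let b : Fin S.codim → (Fin m → ℝ) → S.CState := fun a φ => star (A.N φ (Pi.single a 1))
  have hN : ∀ a, SmoothTorus fun φ => A.N φ (Pi.single a 1) := fun a =>
    A.smooth.clm_apply_complex (SmoothTorus.const _)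
  have hb : ∀ a, SmoothTorus (b a) := fun a => smoothTorus_star (hN a)
  let P : Fin S.codim → (Fin m → ℝ) → Fin m → ℂ := fun a φ => A.tangentInv φ (b a φ)
  let Q : Fin S.codim → (Fin m → ℝ) → Fin S.codim → ℂ := fun a φ => A.normalInv φ (b a φ)
  have hP : ∀ a, SmoothTorus (P a) := fun a => A.smoothTorus_tangentInv (hb a)
  have hQ : ∀ a, SmoothTorus (Q a) := fun a => A.smoothTorus_normalInv (hb a)
  have hPQ : ∀ a φ, S.tangent φ (P a φ) + A.N φ (Q a φ) = b a φ := fun a φ =>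
    A.tangent_add_normal φ (b a φ)
  have hNsum : ∀ (φ : Fin m → ℝ) (w : Fin S.codim → ℂ),
      star (A.N φ w) = ∑ c, star (w c) • b c φ := by
    intro φ w
    have : w = ∑ c, w c • (Pi.single c (1 : ℂ) : Fin S.codim → ℂ) := by
      ext i
      simp [Finset.sum_apply, Pi.single_apply]
    conv_lhs => rw [this, map_sum, star_sum]
    refine Finset.sum_congr rfl fun c _ => ?_
    rw [map_smul, star_smul]
  -- Conjugating the frame equation of the `a`-th column and comparing tangential components gives a
  -- closed linear system for the `P a`, because the tangential block of the variational operator is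
  -- just `∂_ω`.
  have hvar : ∀ a φ, fderiv ℝ (P a) φ S.freq = -∑ c, star (A.L c a) • P c φ := by
    intro a φ
    have h1 := A.variational_combine (hP a) (hQ a) φ
    simp only [hPQ] at h1
    have h2 : S.variational (b a) φ = star (A.N φ (-(A.L.mulVec (Pi.single a 1)))) := by
      have h3 := variational_star (hN a) φ
      rw [A.variational_normal (SmoothTorus.const _)] at h3
      rw [fderiv_fun_const, Pi.zero_apply, zero_apply, zero_sub] at h3
      exact h3
    rw [show (fun φ => b a φ) = b a from rfl, h2, hNsum] at h1
    have h4 : ∀ c, star ((-(A.L.mulVec (Pi.single a 1))) c) = -star (A.L c a) := by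
      intro c
      simp [Matrix.mulVec_single]
    simp only [h4] at h1
    have h5 : ∑ c, -star (A.L c a) • b c φ =
        S.tangent φ (-∑ c, star (A.L c a) • P c φ) + A.N φ (-∑ c, star (A.L c a) • Q c φ) := by
      simp only [← hPQ, tangent_eq, map_neg, map_sum, map_smul, ← Finset.sum_neg_distrib,
        ← Finset.sum_add_distrib, smul_add, neg_smul]
    rw [h5] at h1
    exact (A.add_eq_add_iff.1 h1).1.symm
  have hzero : ∀ (i : Fin m) (φ : Fin m → ℝ), (fun a => P a φ i) = 0 := by
    intro i
    -- The matrix of the system is minus the conjugate transpose of `L`; its eigenvalues are the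
    -- numbers `-conj μ` with `μ` an eigenvalue of `L`, so it is again hyperbolic.
    have hL : ∀ μ ∈ spectrum ℂ (-star A.L), μ.re ≠ 0 := by
      intro μ hμ
      rw [← spectrum.neg_eq, Set.mem_neg, spectrum.map_star, Set.mem_star] at hμ
      have := A.hyperbolic _ hμ
      simpa using this
    have hs : SmoothTorus fun φ => fun a => P a φ i :=
      ⟨contDiff_pi.2 fun a => contDiff_pi.1 (hP a).1 i, fun φ k => funext fun a =>
        congrFun ((hP a).2 φ k) i⟩
    refine system_unique (w := S.freq) hL hs fun φ => ?_
    ext a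
    have h1 : HasFDerivAt (fun φ => fun a => P a φ i)
        (ContinuousLinearMap.pi fun a => (ContinuousLinearMap.proj i).comp (fderiv ℝ (P a) φ)) φ :=
      hasFDerivAt_pi.2 fun a => hasFDerivAt_pi'.1 ((hP a).differentiable φ).hasFDerivAt i
    rw [h1.fderiv]
    change fderiv ℝ (P a) φ S.freq i = _
    rw [hvar]
    simp [Matrix.mulVec, dotProduct, Matrix.star_apply]
  have hP0 : ∀ c φ, P c φ = 0 := fun c φ => funext fun i => congrFun (hzero i φ) c
  have hfin : star (A.N φ w) = S.tangent φ 0 + A.N φ (∑ c, star (w c) • Q c φ) := by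
    rw [hNsum, map_sum, tangent_eq, map_zero, zero_add]
    refine Finset.sum_congr rfl fun c _ => ?_
    rw [map_smul, ← hPQ c φ, hP0, tangent_eq, map_zero, zero_add]
  rw [hfin, tangentInv_apply]

theorem star_tangent (φ : Fin m → ℝ) (v : Fin m → ℂ) :
    star (S.tangent φ v) = S.tangent φ (star v) := star_complexify _ _

theorem star_normal (φ : Fin m → ℝ) (w : Fin S.codim → ℂ) :
    star (A.N φ w) = A.N φ (A.normalInv φ (star (A.N φ w))) := by
  have := A.tangent_add_normal φ (star (A.N φ w))
  rw [A.tangentInv_star_normal, tangent_eq, map_zero, zero_add] at this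
  exact this.symm

/-- Conjugation preserves both `im T` and `im N`, so it acts on the two components of a vector
separately. -/
theorem star_tangentInv_toC (φ : Fin m → ℝ) (x : S.State) :
    star (A.tangentInv φ (toC x)) = A.tangentInv φ (toC x) := by
  have h1 := congrArg star (A.tangent_add_normal φ (toC x))
  rw [star_add, star_tangent, A.star_normal, star_toC] at h1
  conv_rhs => rw [← h1]
  rw [tangentInv_apply]

theorem star_sub_proj_toC (φ : Fin m → ℝ) (x : S.State) :
    star (toC x - A.proj φ (toC x)) = toC x - A.proj φ (toC x) := by
  rw [star_sub, star_toC, proj, star_tangent, star_tangentInv_toC]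

/-! ### The tangential and the normal equation -/

/-- The variational operator is block-diagonal in the frame and `∂_φ e⁰ · f` is tangential;
directness of the sum separates the equation into its two components. -/
theorem homFin_iff {f g : (Fin m → ℝ) → Fin m → ℝ} {h : (Fin m → ℝ) → Fin S.codim → ℂ}
    {e η : (Fin m → ℝ) → S.State} (hg : SmoothTorus g) (hh : SmoothTorus h) (he : SmoothTorus e)
    (hd : A.Decomposes e g h) :
    S.HomFin f e η ↔ A.HomTangent g f η ∧ A.HomNormal h η := by
  have key : ∀ φ, (fderiv ℝ e φ S.freq - fderiv ℝ S.field (S.e₀ φ) (e φ) +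
      fderiv ℝ S.e₀ φ (f φ) = η φ) ↔
      (S.tangent φ (toC (fderiv ℝ g φ S.freq + f φ)) = A.proj φ (toC (η φ)) ∧
        A.N φ (fderiv ℝ h φ S.freq - A.L.mulVec (h φ)) = toC (η φ) - A.proj φ (toC (η φ))) := by
    intro φ
    have h1 := variational_toC he φ
    rw [show (fun φ => toC (e φ)) = _ from funext hd, A.variational_combine hg.toC hh,
      fderiv_toC hg] at h1
    have h2 : toC (fderiv ℝ e φ S.freq - fderiv ℝ S.field (S.e₀ φ) (e φ) +
        fderiv ℝ S.e₀ φ (f φ)) = S.tangent φ (toC (fderiv ℝ g φ S.freq + f φ)) +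
          A.N φ (fderiv ℝ h φ S.freq - A.L.mulVec (h φ)) := by
      simp only [← toCCLM_apply, map_add] at h1 ⊢
      rw [← h1]
      simp only [toCCLM_apply, ← tangent_toC, tangent_eq, map_add]
      abel
    rw [← toC_injective.eq_iff, h2, sub_proj, proj, normal_inj, A.tangent_inj]
    conv_lhs => rw [← A.tangent_add_normal φ (toC (η φ))]
    exact A.add_eq_add_iff
  exact ⟨fun H => ⟨fun φ => ((key φ).1 (H φ)).1, fun φ => ((key φ).1 (H φ)).2⟩,
    fun H φ => (key φ).2 ⟨H.1 φ, H.2 φ⟩⟩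

theorem exists_homTangent {η : (Fin m → ℝ) → S.State} (hη : SmoothTorus η) (K : ℕ) :
    ∃ g f : (Fin m → ℝ) → (Fin m → ℝ),
      SmoothTorus g ∧ SmoothTorus f ∧ A.HomTangent g f η ∧ InNormalForm S.freq K f ∧
      ∀ k : Fin m → ℤ,
        ((∑ j, |k j| ≤ (K : ℤ) ∧ resonance S.freq k ≠ 0) →
          torusFourierCoeff (fun φ => toC (g φ)) k =
            (Complex.I * (resonance S.freq k : ℂ))⁻¹ • A.zetaHat η k ∧
          torusFourierCoeff (fun φ => toC (f φ)) k = 0) ∧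
        (¬(∑ j, |k j| ≤ (K : ℤ) ∧ resonance S.freq k ≠ 0) →
          torusFourierCoeff (fun φ => toC (g φ)) k = 0 ∧
          torusFourierCoeff (fun φ => toC (f φ)) k = A.zetaHat η k) := by
  -- The tangential coordinates of the real vector `η` are real, so taking real parts changes
  -- nothing and yields real `g` and `f`.
  have hζ : SmoothTorus fun φ => fun i => (A.tangentInv φ (toC (η φ)) i).re :=
    (A.smoothTorus_tangentInv hη.toC).comp (reCLM (Fin m)).contDiff
  have hζC : ∀ φ, toC (fun i => (A.tangentInv φ (toC (η φ)) i).re) =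
      A.tangentInv φ (toC (η φ)) := fun φ => toC_re (A.star_tangentInv_toC φ (η φ))
  obtain ⟨g, f, hg, hf, heq, hk⟩ := exists_normalForm S.freq K hζ
  have hhat : ∀ k, torusFourierCoeff
      (fun φ => toC fun i => (A.tangentInv φ (toC (η φ)) i).re) k = A.zetaHat η k := by
    intro k
    simp only [zetaHat, tangentInv_proj, hζC]
  simp only [hhat] at hk
  refine ⟨g, f, hg, hf, fun φ => ?_, fun k hres hle => ((hk k).1 ⟨hle, hres⟩).2, hk⟩
  rw [heq, hζC, proj]

theorem homNormal_iff {h : (Fin m → ℝ) → Fin S.codim → ℂ} {η : (Fin m → ℝ) → S.State} :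
    A.HomNormal h η ↔
      ∀ φ, fderiv ℝ h φ S.freq - A.L.mulVec (h φ) = A.normalInv φ (toC (η φ)) := by
  refine forall_congr' fun φ => ?_
  rw [sub_proj, normal_inj]

theorem isUnit_resolvent (r : ℝ) :
    IsUnit ((Complex.I * (r : ℂ)) • (1 : Matrix (Fin S.codim) (Fin S.codim) ℂ) - A.L) := by
  by_contra hcon
  rw [← Algebra.algebraMap_eq_smul_one, ← spectrum.mem_iff] at hcon
  exact A.hyperbolic _ hcon (by simp)

theorem exists_homNormal {η : (Fin m → ℝ) → S.State} (hη : SmoothTorus η) :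
    ∃ h : (Fin m → ℝ) → (Fin S.codim → ℂ),
      SmoothTorus h ∧ A.HomNormal h η ∧
      (∀ h' : (Fin m → ℝ) → (Fin S.codim → ℂ), SmoothTorus h' → A.HomNormal h' η → h' = h) ∧
      ∀ k : Fin m → ℤ,
        IsUnit ((Complex.I * (resonance S.freq k : ℂ)) •
          (1 : Matrix (Fin S.codim) (Fin S.codim) ℂ) - A.L) ∧
        torusFourierCoeff h k =
          ((Complex.I * (resonance S.freq k : ℂ)) •
            (1 : Matrix (Fin S.codim) (Fin S.codim) ℂ) - A.L)⁻¹.mulVec (A.kappaHat η k) := by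
  have hκ : SmoothTorus fun φ => A.normalInv φ (toC (η φ)) := A.smoothTorus_normalInv hη.toC
  obtain ⟨h, hh, heq⟩ := system_exists S.freq A.hyperbolic hκ
  refine ⟨h, hh, A.homNormal_iff.2 heq, fun h' hh' heq' => ?_, fun k => ⟨A.isUnit_resolvent _, ?_⟩⟩
  · have h1 := system_unique (w := S.freq) A.hyperbolic (hh'.sub hh) (fun φ => by
      rw [fderiv_fun_sub (hh'.differentiable φ) (hh.differentiable φ), sub_apply,
        Matrix.mulVec_sub]
      have h2 := (A.homNormal_iff.1 heq' φ).trans (heq φ).symm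
      rw [sub_eq_sub_iff_add_eq_add] at h2 ⊢
      rw [h2, add_comm])
    exact funext fun φ => sub_eq_zero.1 (h1 φ)
  -- Taking Fourier coefficients turns `∂_ω - L` into the matrix `i⟨k, ω⟩ - L`, which is inverted
  -- because no eigenvalue of `L` is imaginary.
  · have h1 : A.kappaHat η k = ((Complex.I * (resonance S.freq k : ℂ)) •
        (1 : Matrix (Fin S.codim) (Fin S.codim) ℂ) - A.L).mulVec (torusFourierCoeff h k) := by
      simp only [kappaHat, normalInv_sub_proj, ← heq]
      rw [torusFourierCoeff_sub (hh.dirDeriv _).1.continuous (hh.mulVec _).1.continuous,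
        torusFourierCoeff_fderiv hh, torusFourierCoeff_mulVec _ hh.1.continuous,
        Matrix.sub_mulVec, Matrix.smul_mulVec, Matrix.one_mulVec]
    rw [h1, Matrix.mulVec_mulVec, Matrix.nonsing_inv_mul _
      ((Matrix.isUnit_iff_isUnit_det _).1 (A.isUnit_resolvent _)), Matrix.one_mulVec]

/-- The normal coordinates of the conjugate of `N h` solve the same equation, since `η` and its
normal part are real; uniqueness then gives `N h` real, although `h` itself need not be. -/
theorem star_normal_of_homNormal {h : (Fin m → ℝ) → Fin S.codim → ℂ} {η : (Fin m → ℝ) → S.State}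
    (hh : SmoothTorus h) (heq : A.HomNormal h η) (φ : Fin m → ℝ) :
    star (A.N φ (h φ)) = A.N φ (h φ) := by
  have hN := A.smooth.clm_apply_complex hh
  have hNs := smoothTorus_star hN
  set h' : (Fin m → ℝ) → Fin S.codim → ℂ := fun φ => A.normalInv φ (star (A.N φ (h φ))) with hh'
  have hs' : SmoothTorus h' := A.smoothTorus_normalInv hNs
  have hstar : ∀ φ, star (A.N φ (h φ)) = A.N φ (h' φ) := fun φ => A.star_normal φ (h φ)
  have hvar : ∀ φ, fderiv ℝ h' φ S.freq - A.L.mulVec (h' φ) =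
      fderiv ℝ h φ S.freq - A.L.mulVec (h φ) := by
    intro φ
    rw [← A.normal_inj (φ := φ), ← A.variational_normal hs', heq φ]
    simp only [← hstar]
    rw [variational_star hN, A.variational_normal hh, heq φ, A.star_sub_proj_toC]
  have h1 := system_unique (w := S.freq) A.hyperbolic (hs'.sub hh) (fun φ => by
    rw [fderiv_fun_sub (hs'.differentiable φ) (hh.differentiable φ), sub_apply, Matrix.mulVec_sub]
    have h2 := hvar φ
    rw [sub_eq_sub_iff_add_eq_add] at h2 ⊢
    rw [h2, add_comm])
  rw [hstar, sub_eq_zero.1 (h1 φ)]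

theorem exists_decomposes {g : (Fin m → ℝ) → Fin m → ℝ} {h : (Fin m → ℝ) → Fin S.codim → ℂ}
    {η : (Fin m → ℝ) → S.State} (hg : SmoothTorus g) (hh : SmoothTorus h)
    (heq : A.HomNormal h η) : ∃ e, SmoothTorus e ∧ A.Decomposes e g h := by
  refine ⟨fun φ p => (S.tangent φ (toC (g φ)) p + A.N φ (h φ) p).re,
    (A.smoothTorus_combine hg.toC hh).comp (reCLM (Coord S.d)).contDiff, fun φ => ?_⟩
  refine toC_re (z := S.tangent φ (toC (g φ)) + A.N φ (h φ)) ?_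
  rw [star_add, A.star_normal_of_homNormal hh heq, star_tangent, star_toC]

end FloquetFrame

end DelaySystem

end DelayPhase

namespace DelayPhase

open Filter Topology MeasureTheory

/-! ### The transport equation -/

section Transport

variable {m : ℕ} {V : Type} [NormedAddCommGroup V] [NormedSpace ℝ V]

/-- `(φ, s) ↦ ∫₀ˢ H(φ + (s - ζ) w, ζ) dζ`. -/
noncomputable def transportIntegral (w : Fin m → ℝ) (H : (Fin m → ℝ) × ℝ → V)
    (p : (Fin m → ℝ) × ℝ) : V :=
  ∫ ζ in (0 : ℝ)..p.2, H (p.1 + (p.2 - ζ) • w, ζ)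

theorem contDiff_transportIntegral [CompleteSpace V] (w : Fin m → ℝ) {H : (Fin m → ℝ) × ℝ → V}
    (hH : ContDiff ℝ ∞ H) : ContDiff ℝ ∞ (transportIntegral w H) :=
  contDiff_integral_upper (E := (Fin m → ℝ) × ℝ)
    (g := fun q => H (q.1.1 + (q.1.2 - q.2) • w, q.2)) (hH.comp (by fun_prop)) contDiff_snd

theorem transportIntegral_line (w : Fin m → ℝ) (H : (Fin m → ℝ) × ℝ → V) (φ : Fin m → ℝ)
    (s r : ℝ) : transportIntegral w H (φ - r • w, s + r) =
      ∫ ζ in (0 : ℝ)..s + r, H (φ + (s - ζ) • w, ζ) := by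
  simp only [transportIntegral]
  congr 1
  ext1 ζ
  congr 2
  module

/-- Along the characteristic `r ↦ (φ - r w, s + r)` the integrand does not depend on `r`; only the
upper limit moves. -/
theorem hasDerivAt_transportIntegral_line [CompleteSpace V] (w : Fin m → ℝ) {H : (Fin m → ℝ) × ℝ → V}
    (hH : Continuous H) (φ : Fin m → ℝ) (s : ℝ) :
    HasDerivAt (fun r : ℝ => transportIntegral w H (φ - r • w, s + r)) (H (φ, s)) 0 := by
  simp only [transportIntegral_line]
  have hc : Continuous fun ζ : ℝ => H (φ + (s - ζ) • w, ζ) := by fun_prop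
  have h1 : HasDerivAt (fun r : ℝ => ∫ ζ in (0 : ℝ)..r, H (φ + (s - ζ) • w, ζ))
      (H (φ + (s - (s + 0)) • w, s + 0)) (s + 0) :=
    intervalIntegral.integral_hasDerivAt_right (hc.intervalIntegrable _ _)
      (hc.stronglyMeasurableAtFilter _ _) hc.continuousAt
  simpa using h1.comp_const_add s 0

end Transport

namespace DelaySystem

variable {m : ℕ} {S : DelaySystem m}

/-! ### Histories -/

theorem hist_congr {u v : ℝ → S.State} (h : ∀ s ∈ Icc (-S.τ) 0, u s = v s) :
    S.hist u = S.hist v := by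
  unfold hist
  congr 1
  ext1 s
  exact h s s.2

theorem hist_apply {u : ℝ → S.State} (hu : ContinuousOn u (Icc (-S.τ) 0))
    (s : Icc (-S.τ) (0 : ℝ)) : S.hist u s = u s :=
  ContinuousMap.mkD_apply_of_continuous hu.domRestrict

theorem hist_sum_smul {α : Type*} (t : Finset α) (a : α → ℝ) {u : α → ℝ → S.State}
    (hu : ∀ k ∈ t, ContinuousOn (u k) (Icc (-S.τ) 0)) :
    S.hist (fun s => ∑ k ∈ t, a k • u k s) = ∑ k ∈ t, a k • S.hist (u k) := by
  ext s p
  have h1 : ContinuousOn (fun s => ∑ k ∈ t, a k • u k s) (Icc (-S.τ) 0) :=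
    continuousOn_finsetSum t fun k hk => (hu k hk).const_smul (a k)
  rw [hist_apply h1, ContinuousMap.coe_sum, Finset.sum_apply, Finset.sum_apply, Finset.sum_apply]
  refine Finset.sum_congr rfl fun k hk => ?_
  rw [ContinuousMap.coe_smul, Pi.smul_apply, Pi.smul_apply, hist_apply (hu k hk)]
  rfl

theorem zero_mem_Icc : (0 : ℝ) ∈ Icc (-S.τ) 0 := ⟨by linarith [S.τ_pos], le_rfl⟩

theorem uniqueDiffOn_history : UniqueDiffOn ℝ (Icc (-S.τ) (0 : ℝ)) :=
  uniqueDiffOn_Icc (by linarith [S.τ_pos])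

/-- `W` is a smooth extension of `E` from `[-τ, 0]` to all times. -/
def Extends (S : DelaySystem m) (W : (Fin m → ℝ) × ℝ → S.State)
    (E : (Fin m → ℝ) → ℝ → S.State) : Prop :=
  ContDiff ℝ ∞ W ∧ ∀ φ, ∀ s ∈ Icc (-S.τ) 0, E φ s = W (φ, s)

theorem Extends.contDiffOn {W : (Fin m → ℝ) × ℝ → S.State} {E : (Fin m → ℝ) → ℝ → S.State}
    (h : S.Extends W E) :
    ContDiffOn ℝ ∞ (fun q : (Fin m → ℝ) × ℝ => E q.1 q.2) (univ ×ˢ Icc (-S.τ) 0) :=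
  h.1.contDiffOn.congr fun q hq => h.2 q.1 q.2 hq.2

/-! ### Partial derivatives of functions given only on the strip over `[-τ, 0]` -/

section Slices

variable {E : (Fin m → ℝ) → ℝ → S.State} {W' : (Fin m → ℝ) × ℝ →L[ℝ] S.State} {φ : Fin m → ℝ}
  {s : ℝ}

theorem hasFDerivAt_slice (hs : s ∈ Icc (-S.τ) 0)
    (h : HasFDerivWithinAt (fun q : (Fin m → ℝ) × ℝ => E q.1 q.2) W' (univ ×ˢ Icc (-S.τ) 0) (φ, s)) :
    HasFDerivAt (fun ψ => E ψ s) (W'.comp (ContinuousLinearMap.inl ℝ _ ℝ)) φ := by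
  rw [← hasFDerivWithinAt_univ]
  exact HasFDerivWithinAt.comp (g := fun q : (Fin m → ℝ) × ℝ => E q.1 q.2)
    (f := fun ψ => (ψ, s)) φ h
    (hasFDerivAt_prodMk_left φ s).hasFDerivWithinAt (fun ψ _ => ⟨mem_univ _, hs⟩)

theorem hasDerivWithinAt_slice
    (h : HasFDerivWithinAt (fun q : (Fin m → ℝ) × ℝ => E q.1 q.2) W' (univ ×ˢ Icc (-S.τ) 0) (φ, s)) :
    HasDerivWithinAt (E φ) (W' (0, 1)) (Icc (-S.τ) 0) s := by
  have h1 : HasDerivWithinAt (fun t : ℝ => (φ, t)) ((0 : Fin m → ℝ), (1 : ℝ)) (Icc (-S.τ) 0) s :=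
    ((hasDerivAt_const s φ).prodMk (hasDerivAt_id s)).hasDerivWithinAt
  exact HasFDerivWithinAt.comp_hasDerivWithinAt (l := fun q : (Fin m → ℝ) × ℝ => E q.1 q.2)
    s h h1 fun t ht => ⟨mem_univ _, ht⟩

theorem fderiv_slice (hs : s ∈ Icc (-S.τ) 0) (v : Fin m → ℝ)
    (h : HasFDerivWithinAt (fun q : (Fin m → ℝ) × ℝ => E q.1 q.2) W' (univ ×ˢ Icc (-S.τ) 0) (φ, s)) :
    fderiv ℝ (fun ψ => E ψ s) φ v = W' (v, 0) := by
  rw [(hasFDerivAt_slice hs h).fderiv]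
  rfl

theorem derivWithin_slice (hs : s ∈ Icc (-S.τ) 0)
    (h : HasFDerivWithinAt (fun q : (Fin m → ℝ) × ℝ => E q.1 q.2) W' (univ ×ˢ Icc (-S.τ) 0) (φ, s)) :
    derivWithin (E φ) (Icc (-S.τ) 0) s = W' (0, 1) :=
  (hasDerivWithinAt_slice h).derivWithin (S.uniqueDiffOn_history s hs)

/-- The transport operator is minus the derivative in the characteristic direction `(-w, 1)`,
one-sided at the ends of `[-τ, 0]`. -/
theorem slice_transport (hs : s ∈ Icc (-S.τ) 0) (w : Fin m → ℝ)
    (h : HasFDerivWithinAt (fun q : (Fin m → ℝ) × ℝ => E q.1 q.2) W' (univ ×ˢ Icc (-S.τ) 0) (φ, s)) :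
    fderiv ℝ (fun ψ => E ψ s) φ w - derivWithin (E φ) (Icc (-S.τ) 0) s = -W' (-w, 1) := by
  rw [fderiv_slice hs w h, derivWithin_slice hs h, ← map_sub, ← map_neg]
  simp

theorem continuousOn_slice (h : ContDiffOn ℝ ∞ (fun q : (Fin m → ℝ) × ℝ => E q.1 q.2)
    (univ ×ˢ Icc (-S.τ) 0)) (φ : Fin m → ℝ) : ContinuousOn (E φ) (Icc (-S.τ) 0) :=
  h.continuousOn.comp (f := fun t : ℝ => (φ, t)) (by fun_prop) fun _ ht => ⟨mem_univ _, ht⟩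

theorem hasFDerivWithinAt_of_contDiffOn
    (h : ContDiffOn ℝ ∞ (fun q : (Fin m → ℝ) × ℝ => E q.1 q.2) (univ ×ˢ Icc (-S.τ) 0))
    (φ : Fin m → ℝ) (hs : s ∈ Icc (-S.τ) 0) :
    ∃ W' : (Fin m → ℝ) × ℝ →L[ℝ] S.State,
      HasFDerivWithinAt (fun q : (Fin m → ℝ) × ℝ => E q.1 q.2) W' (univ ×ˢ Icc (-S.τ) 0)
      (φ, s) :=
  ⟨_, (h.differentiableOn (by simp) (φ, s) ⟨mem_univ _, hs⟩).hasFDerivWithinAt⟩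

theorem Extends.hasFDerivWithinAt {W : (Fin m → ℝ) × ℝ → S.State} (h : S.Extends W E)
    (φ : Fin m → ℝ) (hs : s ∈ Icc (-S.τ) 0) :
    HasFDerivWithinAt (fun q : (Fin m → ℝ) × ℝ => E q.1 q.2) (_root_.fderiv ℝ W (φ, s))
      (univ ×ˢ Icc (-S.τ) 0) (φ, s) :=
  ((h.1.differentiable (by simp) (φ, s)).hasFDerivAt.hasFDerivWithinAt).congr
    (fun q hq => h.2 q.1 q.2 hq.2) (h.2 φ s hs)

end Slices

/-- The smooth extension of the history `E⁰`. -/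
theorem extends_E₀ : S.Extends (fun p => S.e₀ (p.1 + p.2 • S.freq)) S.E₀ :=
  ⟨S.contDiff_e₀.comp (by fun_prop), fun φ s _ => S.E₀_eq φ s⟩

theorem fderiv_E₀ (φ : Fin m → ℝ) (s : ℝ) :
    fderiv ℝ (fun ψ => S.E₀ ψ s) φ = fderiv ℝ S.e₀ (φ + s • S.freq) := by
  simp only [E₀_eq]
  exact fderiv_comp_add_right _

/-- The transport solution with all data extended to all times. -/
noncomputable def transportExt (S : DelaySystem m) (f : (Fin m → ℝ) → (Fin m → ℝ))
    (e : (Fin m → ℝ) → S.State) (W : (Fin m → ℝ) × ℝ → S.State) (p : (Fin m → ℝ) × ℝ) : S.State :=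
  e (p.1 + p.2 • S.freq)
    + fderiv ℝ S.e₀ (p.1 + p.2 • S.freq) (transportIntegral S.freq (fun q => f q.1) p)
    - transportIntegral S.freq W p

/-! ### The integral formula: smoothness, equation and uniqueness -/

section TransportSolution

variable {f : (Fin m → ℝ) → (Fin m → ℝ)} {e : (Fin m → ℝ) → S.State}
  {H : (Fin m → ℝ) → ℝ → S.State} {W : (Fin m → ℝ) × ℝ → S.State}

theorem contDiff_transportExt (hf : ContDiff ℝ ∞ f) (he : ContDiff ℝ ∞ e) (hW : ContDiff ℝ ∞ W) :
    ContDiff ℝ ∞ (S.transportExt f e W) := by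
  have hl : ContDiff ℝ ∞ fun p : (Fin m → ℝ) × ℝ => p.1 + p.2 • S.freq := by fun_prop
  have hf' : ContDiff ℝ ∞ fun q : (Fin m → ℝ) × ℝ => f q.1 := hf.comp contDiff_fst
  exact ((he.comp hl).add ((S.smoothTorus_e₀.fderiv.1.comp hl).clm_apply
    (contDiff_transportIntegral S.freq hf'))).sub (contDiff_transportIntegral S.freq hW)

/-- At time `s ∈ [-τ, 0]` the formula evaluates `H` only at times in `[s, 0]`, where `H` and its
extension agree. -/
theorem extends_transportSolution (hf : SmoothTorus f) (he : SmoothTorus e)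
    (hW : S.Extends W H) : S.Extends (S.transportExt f e W) (S.transportSolution f e H) := by
  refine ⟨contDiff_transportExt hf.1 he.1 hW.1, fun φ s hs => ?_⟩
  simp only [transportSolution, transportExt, transportIntegral, fderiv_E₀]
  congr 1
  refine intervalIntegral.integral_congr fun ζ hζ => ?_
  rw [uIcc_of_ge hs.2] at hζ
  exact hW.2 _ _ ⟨hs.1.trans hζ.1, hζ.2⟩

/-- On a characteristic the point `φ + s ω` is constant, so `e` and `∂_φ e⁰` are frozen and only the
two integrals contribute. -/
theorem fderiv_transportExt (hf : ContDiff ℝ ∞ f) (he : ContDiff ℝ ∞ e) (hW : ContDiff ℝ ∞ W)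
    (φ : Fin m → ℝ) (s : ℝ) :
    fderiv ℝ (S.transportExt f e W) (φ, s) (-S.freq, 1) =
      fderiv ℝ S.e₀ (φ + s • S.freq) (f φ) - W (φ, s) := by
  refine fderiv_apply_eq_of_hasDerivAt_line
    ((contDiff_transportExt hf he hW).differentiable (by simp)) ?_
  have hpt : ∀ r : ℝ, (φ, s) + r • ((-S.freq, 1) : (Fin m → ℝ) × ℝ) = (φ - r • S.freq, s + r) := by
    intro r
    ext <;> simp [sub_eq_add_neg]
  have hc : ∀ r : ℝ, φ - r • S.freq + (s + r) • S.freq = φ + s • S.freq := fun r => by module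
  simp only [hpt, transportExt, hc]
  have h1 := hasDerivAt_transportIntegral_line S.freq (H := fun q : (Fin m → ℝ) × ℝ => f q.1)
    (hf.continuous.comp continuous_fst) φ s
  have h2 := hasDerivAt_transportIntegral_line S.freq hW.continuous φ s
  exact (((fderiv ℝ S.e₀ (φ + s • S.freq)).hasFDerivAt.comp_hasDerivAt (0 : ℝ) h1).const_add
    (e (φ + s • S.freq))).sub h2

theorem transportExt_zero (φ : Fin m → ℝ) : S.transportExt f e W (φ, 0) = e φ := by
  simp [transportExt, transportIntegral]

theorem homTr_transportSolution (hf : SmoothTorus f) (he : SmoothTorus e) (hW : S.Extends W H) :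
    S.HomTr f (S.transportSolution f e H) H := by
  intro φ s hs
  rw [slice_transport hs _ ((extends_transportSolution hf he hW).hasFDerivWithinAt φ hs),
    fderiv_transportExt hf.1 he.1 hW.1, fderiv_E₀, hW.2 φ s hs]
  abel

theorem transportSolution_zero (φ : Fin m → ℝ) : S.transportSolution f e H φ 0 = e φ := by
  simp [transportSolution]

theorem smoothTorusHist_transportSolution (hf : SmoothTorus f) (he : SmoothTorus e)
    (hW : S.Extends W H) (hH : ∀ s ∈ Icc (-S.τ) 0, TorusPeriodic fun φ => H φ s) :
    SmoothTorusHist S.τ (S.transportSolution f e H) := by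
  refine ⟨(extends_transportSolution hf he hW).contDiffOn, fun s hs φ k => ?_⟩
  have h1 : ∀ {β : Type} {u : (Fin m → ℝ) → β}, TorusPeriodic u → ∀ a,
      u ((fun j => φ j + 2 * Real.pi * (k j : ℝ)) + a) = u (φ + a) := fun hu a =>
    hu.translate a φ k
  simp only [transportSolution, fderiv_E₀]
  rw [h1 he.2, h1 S.smoothTorus_e₀.fderiv.2]
  simp only [h1 hf.2]
  congr 1
  refine intervalIntegral.integral_congr fun ζ hζ => ?_
  rw [uIcc_of_ge hs.2] at hζ
  exact h1 (hH ζ ⟨hs.1.trans hζ.1, hζ.2⟩) _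

/-- Uniqueness for the transport equation, by the method of characteristics. -/
theorem eq_transportExt {E : (Fin m → ℝ) → ℝ → S.State} (hf : SmoothTorus f)
    (he : SmoothTorus e) (hW : S.Extends W H) (hE : SmoothTorusHist S.τ E)
    (hT : S.HomTr f E H) (h0 : ∀ φ, e φ = E φ 0) (φ : Fin m → ℝ) {s : ℝ}
    (hs : s ∈ Icc (-S.τ) 0) : E φ s = S.transportExt f e W (φ, s) := by
  set X := S.transportExt f e W with hX
  have hXs : ContDiff ℝ ∞ X := contDiff_transportExt hf.1 he.1 hW.1
  -- The difference of the two solutions is followed along the characteristic up to time `0`,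
  -- reached at `r = -s`. It is constant there and vanishes at the end by the boundary condition.
  set y : ℝ → S.State := fun r => E (φ - r • S.freq) (s + r) - X (φ - r • S.freq, s + r) with hy
  have hmem : ∀ r ∈ Icc 0 (-s), s + r ∈ Icc (-S.τ) 0 := fun r hr =>
    ⟨by linarith [hs.1, hr.1], by linarith [hr.2]⟩
  have hd : ∀ r ∈ Icc 0 (-s), HasDerivWithinAt y 0 (Icc 0 (-s)) r := by
    intro r hr
    have hc : HasDerivAt (fun r : ℝ => (φ - r • S.freq, s + r)) (-S.freq, (1 : ℝ)) r := by
      have h1 : HasDerivAt (fun r : ℝ => φ - r • S.freq) (-S.freq) r := by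
        simpa using ((hasDerivAt_id r).smul_const S.freq).const_sub φ
      exact h1.prodMk ((hasDerivAt_id r).const_add s)
    obtain ⟨W', hW'⟩ := hasFDerivWithinAt_of_contDiffOn hE.1 (φ - r • S.freq) (hmem r hr)
    have h2 := HasFDerivWithinAt.comp_hasDerivWithinAt
      (l := fun q : (Fin m → ℝ) × ℝ => E q.1 q.2) r hW'
      (hc.hasDerivWithinAt (s := Icc 0 (-s))) fun t ht => mk_mem_prod (mem_univ _) (hmem t ht)
    have h3 := ((hXs.differentiable (by simp) (φ - r • S.freq, s + r)).hasFDerivAt.comp_hasDerivAt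
      r hc).hasDerivWithinAt (s := Icc 0 (-s))
    refine (h2.sub h3).congr_deriv ?_
    have h4 := hT (φ - r • S.freq) (s + r) (hmem r hr)
    rw [slice_transport (hmem r hr) _ hW', fderiv_E₀, hW.2 _ _ (hmem r hr)] at h4
    rw [hX, fderiv_transportExt hf.1 he.1 hW.1, ← h4]
    abel
  have hconst := (convex_Icc 0 (-s)).norm_image_sub_le_of_norm_hasDerivWithin_le (C := 0) hd
    (fun _ _ => by simp) (right_mem_Icc.2 (neg_nonneg.2 hs.2)) (left_mem_Icc.2 (neg_nonneg.2 hs.2))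
  rw [zero_mul, norm_le_zero_iff, sub_eq_zero] at hconst
  have hend : y (-s) = 0 := by
    simp only [hy, add_neg_cancel, hX, transportExt_zero, h0, sub_self]
  rw [hend] at hconst
  simpa [hy, sub_eq_zero] using hconst

end TransportSolution

/-! ### Right-hand sides of the homological equations -/

namespace Expansion

variable {c : S.Expansion}

theorem Hrhs_congr {c' : S.Expansion} {ℓ : ℕ} (hf : ∀ k < ℓ, c'.f k = c.f k)
    (hE : ∀ k < ℓ, c'.E k = c.E k) : c'.Hrhs ℓ = c.Hrhs ℓ := by
  ext1 φ
  ext1 s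
  simp only [Hrhs]
  congr 1
  refine Finset.sum_congr rfl fun k hk => ?_
  rw [Finset.mem_Ico] at hk
  rw [hE k hk.2, hf (ℓ - k) (by omega)]

theorem eta_congr {c' : S.Expansion} {ℓ : ℕ} (hf : ∀ k < ℓ, c'.f k = c.f k)
    (he : ∀ k < ℓ, c'.e k = c.e k) (hE : ∀ k < ℓ, c'.E k = c.E k) : c'.eta ℓ = c.eta ℓ := by
  ext1 φ
  simp only [eta]
  congr 1
  · congr 2
    ext1 ε
    congr 1
    · congr 1
      exact Finset.sum_congr rfl fun k hk => by rw [he k (Finset.mem_range.1 hk)]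
    · congr 2
      exact Finset.sum_congr rfl fun k hk => by rw [hE k (Finset.mem_range.1 hk)]
  · refine Finset.sum_congr rfl fun k hk => ?_
    rw [Finset.mem_Ico] at hk
    rw [he k hk.2, hf (ℓ - k) (by omega)]

theorem Admissible.periodic_Hrhs (hc : c.Admissible) (ℓ : ℕ) {s : ℝ} (hs : s ∈ Icc (-S.τ) 0) :
    TorusPeriodic fun φ => c.Hrhs ℓ φ s := by
  intro φ k
  simp only [Hrhs]
  congr 1
  refine Finset.sum_congr rfl fun j _ => ?_
  have h1 := ((hc.smooth_E j).2 s hs).fderiv φ k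
  have h2 := (hc.smooth_f (ℓ - j)).2 φ k
  rw [h1, h2]

theorem Admissible.exists_extends_Hrhs (hc : c.Admissible) {ℓ : ℕ}
    (h : ∀ k < ℓ, ∃ W, S.Extends W (c.E k)) : ∃ W, S.Extends W (c.Hrhs ℓ) := by
  choose! W hW using h
  refine ⟨fun p => -∑ k ∈ Finset.Ico 1 ℓ, fderiv ℝ (W k) p (c.f (ℓ - k) p.1, 0), ?_, ?_⟩
  · refine (ContDiff.sum fun k hk => ?_).neg
    have h1 : ContDiff ℝ ∞ fun p : (Fin m → ℝ) × ℝ => c.f (ℓ - k) p.1 :=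
      (hc.smooth_f (ℓ - k)).1.comp contDiff_fst
    exact ((hW k (Finset.mem_Ico.1 hk).2).1.fderiv_right (m := ∞) (by simp)).clm_apply
      (h1.prodMk contDiff_const)
  · intro φ s hs
    simp only [Hrhs]
    congr 1
    refine Finset.sum_congr rfl fun k hk => ?_
    exact fderiv_slice hs _ ((hW k (Finset.mem_Ico.1 hk).2).hasFDerivWithinAt φ hs)

/-- Extensions propagate by induction: lower orders extend the right-hand side, and uniqueness
identifies `E^k` with the extended integral formula. This supplies smooth extensions without an
abstract extension theorem. -/
theorem Admissible.exists_extends (hc : c.Admissible) {ℓ : ℕ}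
    (h : ∀ k, 1 ≤ k → k < ℓ → c.Homological k) : ∀ k < ℓ, ∃ W, S.Extends W (c.E k) := by
  intro k
  induction k using Nat.strong_induction_on with
  | _ k ih =>
    intro hk
    rcases Nat.eq_zero_or_pos k with rfl | hpos
    · exact ⟨_, S.extends_E₀.1, fun φ s hs => (hc.E_zero φ s hs).trans (S.extends_E₀.2 φ s hs)⟩
    · obtain ⟨W, hW⟩ := hc.exists_extends_Hrhs fun j hj => ih j hj (hj.trans hk)
      obtain ⟨-, hT, h0⟩ := h k hpos hk
      exact ⟨S.transportExt (c.f k) (c.e k) W,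
        contDiff_transportExt (hc.smooth_f k).1 (hc.smooth_e k).1 hW.1, fun φ s hs =>
          eq_transportExt (hc.smooth_f k) (hc.smooth_e k) hW (hc.smooth_E k) hT h0 φ hs⟩

end Expansion

/-- The history map is the curried extension, so `contDiff_curryIcc` gives smoothness in the sup
norm, as needed to compose with `G`. -/
theorem Extends.smoothTorus_hist {W : (Fin m → ℝ) × ℝ → S.State} {E : (Fin m → ℝ) → ℝ → S.State}
    (hW : S.Extends W E) (hE : SmoothTorusHist S.τ E) : SmoothTorus fun φ => S.hist (E φ) := by
  have h1 : (fun φ => S.hist (E φ)) = curryIcc (-S.τ) 0 W hW.1.continuous := by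
    ext φ s p
    rw [hist_apply (continuousOn_slice hW.contDiffOn φ), hW.2 φ s s.2]
    rfl
  exact ⟨h1 ▸ contDiff_curryIcc (-S.τ) 0 hW.1,
    fun φ k => hist_congr fun s hs => hE.2 s hs φ k⟩

namespace Expansion

variable {c : S.Expansion}

/-- `F(e) + ε G(E)` along the truncated expansion with `n` terms. -/
noncomputable def forcing (c : S.Expansion) (n : ℕ) (p : ℝ × (Fin m → ℝ)) : S.State :=
  S.field (∑ k ∈ Finset.range n, p.1 ^ k • c.e k p.2) +
    p.1 • S.G (∑ k ∈ Finset.range n, p.1 ^ k • S.hist (c.E k p.2))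

theorem contDiff_forcing_left (c : S.Expansion) (n : ℕ) (φ : Fin m → ℝ) :
    ContDiff ℝ ∞ fun ε : ℝ => c.forcing n (ε, φ) := by
  have h1 : ContDiff ℝ ∞ fun ε : ℝ => ∑ k ∈ Finset.range n, ε ^ k • c.e k φ := by fun_prop
  have h2 : ContDiff ℝ ∞ fun ε : ℝ => ∑ k ∈ Finset.range n, ε ^ k • S.hist (c.E k φ) := by
    fun_prop
  exact (S.contDiff_field.comp h1).add (contDiff_id.smul (S.smooth_G.comp h2))

theorem Admissible.contDiff_forcing (hc : c.Admissible) {n : ℕ}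
    (h : ∀ k < n, ∃ W, S.Extends W (c.E k)) : ContDiff ℝ ∞ (c.forcing n) := by
  have h1 : ContDiff ℝ ∞ fun p : ℝ × (Fin m → ℝ) => ∑ k ∈ Finset.range n, p.1 ^ k • c.e k p.2 :=
    ContDiff.sum fun k _ => (contDiff_fst.pow k).smul ((hc.smooth_e k).1.comp contDiff_snd)
  have h2 : ContDiff ℝ ∞ fun p : ℝ × (Fin m → ℝ) =>
      ∑ k ∈ Finset.range n, p.1 ^ k • S.hist (c.E k p.2) :=
    ContDiff.sum fun k hk => by
      obtain ⟨W, hW⟩ := h k (Finset.mem_range.1 hk)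
      exact (contDiff_fst.pow k).smul ((hW.smoothTorus_hist (hc.smooth_E k)).1.comp contDiff_snd)
  exact (S.contDiff_field.comp h1).add (contDiff_fst.smul (S.smooth_G.comp h2))

theorem Admissible.periodic_forcing (hc : c.Admissible) (n : ℕ) (ε : ℝ) :
    TorusPeriodic fun φ => c.forcing n (ε, φ) := by
  intro φ k
  have h1 : ∀ j, c.e j (fun i => φ i + 2 * Real.pi * (k i : ℝ)) = c.e j φ := fun j =>
    (hc.smooth_e j).2 φ k
  have h2 : ∀ j, S.hist (c.E j fun i => φ i + 2 * Real.pi * (k i : ℝ)) = S.hist (c.E j φ) :=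
    fun j => hist_congr fun s hs => (hc.smooth_E j).2 s hs φ k
  simp only [forcing, h1, h2]

theorem eta_eq (c : S.Expansion) (ℓ : ℕ) (φ : Fin m → ℝ) :
    c.eta ℓ φ = (Nat.factorial ℓ : ℝ)⁻¹ • iteratedDeriv ℓ (fun ε : ℝ => c.forcing ℓ (ε, φ)) 0
      - ∑ k ∈ Finset.Ico 1 ℓ, fderiv ℝ (c.e k) φ (c.f (ℓ - k) φ) := rfl

theorem Admissible.smoothTorus_eta (hc : c.Admissible) {ℓ : ℕ}
    (h : ∀ k < ℓ, ∃ W, S.Extends W (c.E k)) : SmoothTorus (c.eta ℓ) := by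
  have h1 : SmoothTorus fun φ => (Nat.factorial ℓ : ℝ)⁻¹ •
      iteratedDeriv ℓ (fun ε : ℝ => c.forcing ℓ (ε, φ)) 0 := by
    have h2 : ContDiff ℝ ∞ fun φ => iteratedDeriv ℓ (fun ε : ℝ => c.forcing ℓ (ε, φ)) 0 :=
      ContDiff.comp (f := fun φ : Fin m → ℝ => ((0 : ℝ), φ))
        (g := fun p : ℝ × (Fin m → ℝ) => iteratedDeriv ℓ (fun ε => c.forcing ℓ (ε, p.2)) p.1)
        (contDiff_iteratedDeriv_param (hc.contDiff_forcing h) ℓ)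
        (contDiff_const.prodMk contDiff_id)
    refine ⟨h2.const_smul (Nat.factorial ℓ : ℝ)⁻¹, fun φ k => ?_⟩
    have := fun ε => hc.periodic_forcing ℓ ε φ k
    simp only at this
    simp only [this]
  exact h1.sub (SmoothTorus.sum fun k _ => (hc.smooth_e k).fderiv.clm_apply (hc.smooth_f (ℓ - k)))

/-! ### The recursion -/

/-- Replace the coefficients of order `ℓ`. -/
noncomputable def update (c : S.Expansion) (ℓ : ℕ) (f : (Fin m → ℝ) → (Fin m → ℝ))
    (e : (Fin m → ℝ) → S.State) (E : (Fin m → ℝ) → ℝ → S.State) : S.Expansion where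
  f := Function.update c.f ℓ f
  e := Function.update c.e ℓ e
  E := Function.update c.E ℓ E

theorem Admissible.update (hc : c.Admissible) {ℓ : ℕ} (hℓ : 1 ≤ ℓ)
    {f : (Fin m → ℝ) → (Fin m → ℝ)} {e : (Fin m → ℝ) → S.State}
    {E : (Fin m → ℝ) → ℝ → S.State} (hf : SmoothTorus f) (he : SmoothTorus e)
    (hE : SmoothTorusHist S.τ E) : (c.update ℓ f e E).Admissible where
  smooth_f k := by
    rcases eq_or_ne k ℓ with rfl | hk
    · simpa [Expansion.update] using hf
    · simpa [Expansion.update, hk] using hc.smooth_f k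
  smooth_e k := by
    rcases eq_or_ne k ℓ with rfl | hk
    · simpa [Expansion.update] using he
    · simpa [Expansion.update, hk] using hc.smooth_e k
  smooth_E k := by
    rcases eq_or_ne k ℓ with rfl | hk
    · simpa [Expansion.update] using hE
    · simpa [Expansion.update, hk] using hc.smooth_E k
  f_zero := by
    have h0 : (c.update ℓ f e E).f 0 = c.f 0 := Function.update_of_ne (by omega) _ _
    rw [h0]
    exact hc.f_zero
  e_zero := by
    have h0 : (c.update ℓ f e E).e 0 = c.e 0 := Function.update_of_ne (by omega) _ _
    rw [h0]
    exact hc.e_zero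
  E_zero := by
    have h0 : (c.update ℓ f e E).E 0 = c.E 0 := Function.update_of_ne (by omega) _ _
    rw [h0]
    exact hc.E_zero

theorem Admissible.recursion (hc : c.Admissible) {ℓ : ℕ} (hℓ : 1 ≤ ℓ)
    (h : ∀ k, 1 ≤ k → k < ℓ → c.Homological k) (A : S.FloquetFrame)
    {g f : (Fin m → ℝ) → (Fin m → ℝ)} {h' : (Fin m → ℝ) → (Fin S.codim → ℂ)}
    (hg : SmoothTorus g) (hf : SmoothTorus f) (hh : SmoothTorus h')
    (hT : A.HomTangent g f (c.eta ℓ)) (hN : A.HomNormal h' (c.eta ℓ)) :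
    ∃ c' : S.Expansion, c'.Admissible ∧
      (∀ k, k < ℓ → c'.f k = c.f k ∧ c'.e k = c.e k ∧ c'.E k = c.E k) ∧
      c'.f ℓ = f ∧ A.Decomposes (c'.e ℓ) g h' ∧
      c'.E ℓ = S.transportSolution f (c'.e ℓ) (c.Hrhs ℓ) ∧ c'.Homological ℓ := by
  obtain ⟨e, he, hd⟩ := A.exists_decomposes hg hh hN
  obtain ⟨W, hW⟩ := hc.exists_extends_Hrhs (hc.exists_extends h)
  -- Replacing the coefficients of order `ℓ` leaves `η^ℓ` and `H^ℓ` unchanged, so these may be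
  -- computed from the original expansion.
  have hhom : S.HomFin f e (c.eta ℓ) := (A.homFin_iff hg hh he hd).2 ⟨hT, hN⟩
  set c' := c.update ℓ f e (S.transportSolution f e (c.Hrhs ℓ)) with hc'
  have hlow : ∀ k, k < ℓ → c'.f k = c.f k ∧ c'.e k = c.e k ∧ c'.E k = c.E k := by
    intro k hk
    simp [hc', Expansion.update, hk.ne]
  have hfl : c'.f ℓ = f := by simp [hc', Expansion.update]
  have hel : c'.e ℓ = e := by simp [hc', Expansion.update]
  have hEl : c'.E ℓ = S.transportSolution f e (c.Hrhs ℓ) := by simp [hc', Expansion.update]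
  refine ⟨c', hc.update hℓ hf he (smoothTorusHist_transportSolution hf he hW
    fun s hs => hc.periodic_Hrhs ℓ hs), hlow, hfl, hel ▸ hd, by rw [hEl, hel], ?_, ?_, ?_⟩
  · rw [hfl, hel, eta_congr (fun k hk => (hlow k hk).1) (fun k hk => (hlow k hk).2.1)
      (fun k hk => (hlow k hk).2.2)]
    exact hhom
  · rw [hfl, hEl, Hrhs_congr (fun k hk => (hlow k hk).1) (fun k hk => (hlow k hk).2.2)]
    exact homTr_transportSolution hf he hW
  · intro φ
    rw [hel, hEl, transportSolution_zero]

end Expansion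

end DelaySystem

end DelayPhase

namespace DelayPhase

open Filter Topology MeasureTheory Asymptotics

/-! ### Taylor coefficients of power sums -/

section Taylor

variable {V V' W : Type*} [NormedAddCommGroup V] [NormedSpace ℝ V] [NormedAddCommGroup V']
  [NormedSpace ℝ V'] [NormedAddCommGroup W] [NormedSpace ℝ W]

theorem _root_.ContDiff.contDiffAt_nat {f : V → V'} (h : ContDiff ℝ ∞ f) {n : ℕ} {x : V} :
    ContDiffAt ℝ n f x :=
  (h.of_le (mod_cast le_top)).contDiffAt

theorem contDiff_pow_smul (j : ℕ) (v : V) : ContDiff ℝ ∞ fun ε : ℝ => ε ^ j • v := by fun_prop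

theorem iteratedDeriv_pow_smul (ℓ j : ℕ) (v : V) :
    iteratedDeriv ℓ (fun ε : ℝ => ε ^ j • v) 0 = if ℓ = j then (Nat.factorial ℓ : ℝ) • v else 0 := by
  rw [iteratedDeriv_smul_const (by fun_prop), iteratedDeriv_fun_pow_zero]
  split_ifs with h
  · rw [h]
  · simp

theorem iteratedDeriv_sum_pow_smul {n ℓ : ℕ} (hℓ : ℓ < n) (v : ℕ → V) :
    iteratedDeriv ℓ (fun ε : ℝ => ∑ k ∈ Finset.range n, ε ^ k • v k) 0 =
      (Nat.factorial ℓ : ℝ) • v ℓ := by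
  rw [iteratedDeriv_fun_sum fun k _ => (contDiff_pow_smul k (v k)).contDiffAt_nat]
  simp only [iteratedDeriv_pow_smul]
  rw [Finset.sum_ite_eq, if_pos (Finset.mem_range.2 hℓ)]

/-- Cauchy product: as `ℓ < n`, truncation removes no pair with `a + b = ℓ`. -/
theorem iteratedDeriv_sum_sum_pow_smul {n ℓ : ℕ} (hℓ : ℓ < n) (v : ℕ → ℕ → V) :
    iteratedDeriv ℓ (fun ε : ℝ => ∑ a ∈ Finset.range n, ∑ b ∈ Finset.range n,
      ε ^ (a + b) • v a b) 0 =
      (Nat.factorial ℓ : ℝ) • ∑ k ∈ Finset.range (ℓ + 1), v k (ℓ - k) := by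
  have h1 : ∀ a b, ContDiff ℝ ∞ fun ε : ℝ => ε ^ (a + b) • v a b := fun a b =>
    contDiff_pow_smul _ _
  rw [iteratedDeriv_fun_sum fun a _ =>
    (ContDiff.sum fun b _ => h1 a b).contDiffAt_nat, Finset.smul_sum,
    ← Finset.sum_subset (Finset.range_mono (Nat.succ_le_of_lt hℓ))]
  · refine Finset.sum_congr rfl fun a ha => ?_
    have ha' : a ≤ ℓ := Nat.lt_succ_iff.1 (Finset.mem_range.1 ha)
    rw [iteratedDeriv_fun_sum fun b _ => (h1 a b).contDiffAt_nat]
    simp only [iteratedDeriv_pow_smul]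
    rw [Finset.sum_eq_single (ℓ - a)]
    · rw [if_pos (by omega)]
    · intro b _ hb
      rw [if_neg (by omega)]
    · intro hb
      exact absurd (Finset.mem_range.2 (by omega)) hb
  · intro a _ ha
    rw [iteratedDeriv_fun_sum fun b _ => (h1 a b).contDiffAt_nat]
    simp only [iteratedDeriv_pow_smul]
    refine Finset.sum_eq_zero fun b _ => if_neg ?_
    rw [Finset.mem_range] at ha
    omega

theorem isBigO_pow_smul {ℓ k : ℕ} (h : ℓ ≤ k) (v : V) :
    (fun ε : ℝ => ε ^ k • v) =O[𝓝 0] fun ε => ε ^ ℓ := by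
  have h1 : (fun ε : ℝ => ε ^ k • v) =O[𝓝 0] fun ε => ε ^ k :=
    IsBigO.of_bound ‖v‖ (Eventually.of_forall fun ε => by rw [norm_smul, mul_comm])
  rcases h.eq_or_lt with rfl | h
  · exact h1
  · exact h1.trans (isLittleO_pow_pow h).isBigO

theorem isBigO_sum_Ico_pow_smul (ℓ n : ℕ) (v : ℕ → V) :
    (fun ε : ℝ => ∑ k ∈ Finset.Ico ℓ n, ε ^ k • v k) =O[𝓝 0] fun ε => ε ^ ℓ := by
  have h := IsBigO.sum (s := Finset.Ico ℓ n) (A := fun k (ε : ℝ) => ε ^ k • v k) (l := 𝓝 0)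
    (g := fun ε : ℝ => ε ^ ℓ) fun k hk => isBigO_pow_smul (Finset.mem_Ico.1 hk).1 (v k)
  refine h.congr_left fun ε => ?_
  simp

theorem tendsto_sum_range_pow_smul {n : ℕ} (hn : 1 ≤ n) (v : ℕ → V) :
    Tendsto (fun ε : ℝ => ∑ k ∈ Finset.range n, ε ^ k • v k) (𝓝 0) (𝓝 (v 0)) := by
  have h1 : Continuous fun ε : ℝ => ∑ k ∈ Finset.range n, ε ^ k • v k := by fun_prop
  refine (h1.tendsto 0).trans_eq ?_
  obtain ⟨n, rfl⟩ := Nat.exists_eq_add_of_le' hn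
  simp [Finset.sum_range_succ']

/-- The top coefficient enters the `ℓ`-th Taylor coefficient of `F(∑ ε^k v_k) + ε G(∑ ε^k w_k)`
only linearly, through the derivative of `F`. -/
theorem iteratedDeriv_forcing {F : V → V'} {G : W → V'} (hF : ContDiff ℝ ∞ F)
    (hG : ContDiff ℝ ∞ G) (v : ℕ → V) (w : ℕ → W) {ℓ n : ℕ} (hℓ : 1 ≤ ℓ) (hn : ℓ < n) :
    iteratedDeriv ℓ (fun ε : ℝ => F (∑ k ∈ Finset.range n, ε ^ k • v k) +
        ε • G (∑ k ∈ Finset.range n, ε ^ k • w k)) 0 =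
      iteratedDeriv ℓ (fun ε : ℝ => F (∑ k ∈ Finset.range ℓ, ε ^ k • v k) +
        ε • G (∑ k ∈ Finset.range ℓ, ε ^ k • w k)) 0 +
      (Nat.factorial ℓ : ℝ) • fderiv ℝ F (v 0) (v ℓ) := by
  set p : ℕ → ℝ → V := fun n ε => ∑ k ∈ Finset.range n, ε ^ k • v k with hp
  set q : ℕ → ℝ → W := fun n ε => ∑ k ∈ Finset.range n, ε ^ k • w k with hq
  have hps : ∀ n, ContDiff ℝ ∞ (p n) := fun n => by simp only [hp]; fun_prop
  have hqs : ∀ n, ContDiff ℝ ∞ (q n) := fun n => by simp only [hq]; fun_prop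
  have hs : ∀ n, ContDiff ℝ ∞ fun ε : ℝ => F (p n ε) + ε • G (q n ε) := fun n =>
    (hF.comp (hps n)).add (contDiff_id.smul (hG.comp (hqs n)))
  have hpd : ∀ ε, p n ε - p ℓ ε = ∑ k ∈ Finset.Ico ℓ n, ε ^ k • v k := fun ε => by
    simp only [hp, ← Finset.sum_range_add_sum_Ico _ hn.le, add_sub_cancel_left]
  have hqd : ∀ ε, q n ε - q ℓ ε = ∑ k ∈ Finset.Ico ℓ n, ε ^ k • w k := fun ε => by
    simp only [hq, ← Finset.sum_range_add_sum_Ico _ hn.le, add_sub_cancel_left]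
  have hpO : (fun ε => p n ε - p ℓ ε) =O[𝓝 0] fun ε : ℝ => ε ^ ℓ := by
    simp only [hpd]
    exact isBigO_sum_Ico_pow_smul ℓ n v
  have hqO : (fun ε => q n ε - q ℓ ε) =O[𝓝 0] fun ε : ℝ => ε ^ ℓ := by
    simp only [hqd]
    exact isBigO_sum_Ico_pow_smul ℓ n w
  have hpt : Tendsto (fun ε => (p n ε, p ℓ ε)) (𝓝 0) (𝓝 (v 0, v 0)) :=
    (tendsto_sum_range_pow_smul (by omega) v).prodMk_nhds (tendsto_sum_range_pow_smul hℓ v)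
  have hqt : Tendsto (fun ε => (q n ε, q ℓ ε)) (𝓝 0) (𝓝 (w 0, w 0)) :=
    (tendsto_sum_range_pow_smul (by omega) w).prodMk_nhds (tendsto_sum_range_pow_smul hℓ w)
  -- Strict differentiability is required because both arguments move with `ε`; they differ by
  -- `O(ε^ℓ)`.
  have hFo : (fun ε => F (p n ε) - F (p ℓ ε) - fderiv ℝ F (v 0) (p n ε - p ℓ ε)) =o[𝓝 0]
      fun ε : ℝ => ε ^ ℓ :=
    ((hF.hasStrictFDerivAt (x := v 0) (by simp)).isLittleO.comp_tendsto hpt).trans_isBigO hpO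
  have hGO : (fun ε => G (q n ε) - G (q ℓ ε)) =O[𝓝 0] fun ε : ℝ => ε ^ ℓ :=
    ((hG.hasStrictFDerivAt (x := w 0) (by simp)).isBigO_sub.comp_tendsto hqt).trans hqO
  -- The prefactor `ε` pushes the effect of the terms `w k`, `k ≥ ℓ`, beyond order `ℓ`.
  have hGo : (fun ε : ℝ => ε • (G (q n ε) - G (q ℓ ε))) =o[𝓝 0] fun ε : ℝ => ε ^ ℓ := by
    have h1 : (fun ε : ℝ => ε) =o[𝓝 0] fun _ => (1 : ℝ) := (isLittleO_one_iff ℝ).2 tendsto_id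
    simpa using h1.smul_isBigO hGO
  have htail : (fun ε : ℝ => fderiv ℝ F (v 0) (p n ε - p ℓ ε - ε ^ ℓ • v ℓ)) =o[𝓝 0]
      fun ε : ℝ => ε ^ ℓ := by
    refine ((fderiv ℝ F (v 0)).isBigO_comp _ _).trans_isLittleO ?_
    simp only [hpd, Finset.sum_eq_sum_Ico_succ_bot hn, add_sub_cancel_left]
    exact (isBigO_sum_Ico_pow_smul (ℓ + 1) n v).trans_isLittleO (isLittleO_pow_pow (by omega))
  set D : ℝ → V' := fun ε => (F (p n ε) + ε • G (q n ε)) - (F (p ℓ ε) + ε • G (q ℓ ε)) -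
    ε ^ ℓ • fderiv ℝ F (v 0) (v ℓ) with hD
  have hDo : D =o[𝓝 0] fun ε : ℝ => ε ^ ℓ := by
    refine ((hFo.add hGo).add htail).congr_left fun ε => ?_
    simp only [hD, map_sub, map_smul, smul_sub]
    abel
  have hz := iteratedDeriv_eq_zero_of_isLittleO
    (((hs n).sub (hs ℓ)).sub (contDiff_pow_smul ℓ (fderiv ℝ F (v 0) (v ℓ)))) hDo ℓ le_rfl
  rw [iteratedDeriv_fun_sub (((hs n).sub (hs ℓ)).contDiffAt_nat)
    ((contDiff_pow_smul ℓ _).contDiffAt_nat),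
    iteratedDeriv_fun_sub ((hs n).contDiffAt_nat)
    ((hs ℓ).contDiffAt_nat), iteratedDeriv_pow_smul, if_pos rfl] at hz
  rw [sub_sub, sub_eq_zero] at hz
  exact hz

end Taylor

namespace DelaySystem

variable {m : ℕ} {S : DelaySystem m}

/-! ### The unperturbed torus -/

theorem smoothTorusHist_E₀ : SmoothTorusHist S.τ S.E₀ := by
  refine ⟨S.extends_E₀.contDiffOn, fun s _ φ k => ?_⟩
  simp only [E₀_eq]
  exact S.smoothTorus_e₀.2.translate _ φ k

/-- Since `E⁰(φ, s) = e⁰(φ + sω)`, it is constant on characteristics. -/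
theorem transport_E₀ (φ : Fin m → ℝ) {s : ℝ} (hs : s ∈ Icc (-S.τ) 0) :
    fderiv ℝ (fun ψ => S.E₀ ψ s) φ S.freq = derivWithin (S.E₀ φ) (Icc (-S.τ) 0) s := by
  rw [← sub_eq_zero, slice_transport hs _ (S.extends_E₀.hasFDerivWithinAt φ hs), neg_eq_zero]
  refine fderiv_apply_eq_of_hasDerivAt_line (S.extends_E₀.1.differentiable (by simp)) ?_
  have hc : ∀ r : ℝ, ((φ, s) + r • ((-S.freq, 1) : (Fin m → ℝ) × ℝ)).1 +
      ((φ, s) + r • ((-S.freq, 1) : (Fin m → ℝ) × ℝ)).2 • S.freq = φ + s • S.freq := fun r => by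
    simp only [Prod.fst_add, Prod.snd_add, Prod.smul_fst, Prod.smul_snd, smul_eq_mul, mul_one]
    module
  simp only [hc]
  exact hasDerivAt_const _ _

theorem defectFin_e₀ (φ : Fin m → ℝ) : S.defectFin 0 (fun _ => S.freq) S.e₀ S.E₀ φ = 0 := by
  simp [defectFin, fderiv_e₀_freq]

theorem defectTr_E₀ (φ : Fin m → ℝ) {s : ℝ} (hs : s ∈ Icc (-S.τ) 0) :
    S.defectTr (fun _ => S.freq) S.E₀ φ s = 0 := by
  rw [defectTr, transport_E₀ φ hs, sub_self]

theorem defectBc_e₀ (φ : Fin m → ℝ) : S.defectBc S.e₀ S.E₀ φ = 0 := by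
  simp [defectBc, E₀_eq]

end DelaySystem

end DelayPhase

namespace DelayPhase

open Filter Topology MeasureTheory Asymptotics

namespace DelaySystem

variable {m : ℕ} {S : DelaySystem m}

/-! ### Defects of the truncated expansions -/

namespace Expansion

variable {c : S.Expansion}

theorem smul_sum_eq {V : Type*} [NormedAddCommGroup V] [NormedSpace ℝ V] (n : ℕ) (ε : ℝ)
    (A : ℕ → (Fin m → ℝ) →L[ℝ] V) (f : ℕ → Fin m → ℝ) :
    (∑ a ∈ Finset.range n, ε ^ a • A a) (∑ b ∈ Finset.range n, ε ^ b • f b) =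
      ∑ a ∈ Finset.range n, ∑ b ∈ Finset.range n, ε ^ (a + b) • A a (f b) := by
  rw [sum_apply]
  refine Finset.sum_congr rfl fun a _ => ?_
  rw [smul_apply, map_sum, Finset.smul_sum]
  refine Finset.sum_congr rfl fun b _ => ?_
  rw [map_smul, smul_smul, pow_add]

theorem Admissible.defectFin_eq (hc : c.Admissible) (M : ℕ) (ε : ℝ) (φ : Fin m → ℝ) :
    S.defectFin ε (c.fTrunc M ε) (c.eTrunc M ε) (c.ETrunc M ε) φ =
      (∑ a ∈ Finset.range (M + 1), ∑ b ∈ Finset.range (M + 1),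
        ε ^ (a + b) • fderiv ℝ (c.e a) φ (c.f b φ)) - c.forcing (M + 1) (ε, φ) := by
  have h1 : ∀ k, DifferentiableAt ℝ (c.e k) φ := fun k => (hc.smooth_e k).differentiable φ
  have h2 : fderiv ℝ (c.eTrunc M ε) φ =
      ∑ k ∈ Finset.range (M + 1), ε ^ k • fderiv ℝ (c.e k) φ := by
    unfold eTrunc
    rw [fderiv_fun_sum fun k _ => (h1 k).fun_const_smul _]
    exact Finset.sum_congr rfl fun k _ => fderiv_fun_const_smul (h1 k) _
  have h3 : S.hist (c.ETrunc M ε φ) = ∑ k ∈ Finset.range (M + 1), ε ^ k • S.hist (c.E k φ) :=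
    hist_sum_smul _ _ fun k _ => continuousOn_slice (hc.smooth_E k).1 φ
  rw [defectFin, h2, h3, fTrunc, smul_sum_eq]
  rfl

theorem Admissible.defectTr_eq (hc : c.Admissible) (M : ℕ) (ε : ℝ) (φ : Fin m → ℝ) {s : ℝ}
    (hs : s ∈ Icc (-S.τ) 0) :
    S.defectTr (c.fTrunc M ε) (c.ETrunc M ε) φ s =
      (∑ a ∈ Finset.range (M + 1), ∑ b ∈ Finset.range (M + 1),
        ε ^ (a + b) • fderiv ℝ (fun ψ => c.E a ψ s) φ (c.f b φ)) -
      ∑ k ∈ Finset.range (M + 1), ε ^ k • derivWithin (c.E k φ) (Icc (-S.τ) 0) s := by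
  have h1 : ∀ k, DifferentiableAt ℝ (fun ψ => c.E k ψ s) φ := fun k => by
    obtain ⟨W', hW'⟩ := hasFDerivWithinAt_of_contDiffOn (hc.smooth_E k).1 φ hs
    exact (hasFDerivAt_slice hs hW').differentiableAt
  have h2 : ∀ k, DifferentiableWithinAt ℝ (c.E k φ) (Icc (-S.τ) 0) s := fun k => by
    obtain ⟨W', hW'⟩ := hasFDerivWithinAt_of_contDiffOn (hc.smooth_E k).1 φ hs
    exact (hasDerivWithinAt_slice hW').differentiableWithinAt
  have h3 : fderiv ℝ (fun ψ => c.ETrunc M ε ψ s) φ =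
      ∑ k ∈ Finset.range (M + 1), ε ^ k • fderiv ℝ (fun ψ => c.E k ψ s) φ := by
    unfold ETrunc
    rw [fderiv_fun_sum fun k _ => (h1 k).fun_const_smul _]
    exact Finset.sum_congr rfl fun k _ => fderiv_fun_const_smul (h1 k) _
  have h4 : derivWithin (c.ETrunc M ε φ) (Icc (-S.τ) 0) s =
      ∑ k ∈ Finset.range (M + 1), ε ^ k • derivWithin (c.E k φ) (Icc (-S.τ) 0) s := by
    unfold ETrunc
    rw [derivWithin_fun_sum fun k _ => (h2 k).fun_const_smul _]
    exact Finset.sum_congr rfl fun k _ => derivWithin_fun_const_smul _ (h2 k)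
  rw [defectTr, h3, h4, fTrunc, smul_sum_eq]

theorem defectBc_eq (c : S.Expansion) (M : ℕ) (ε : ℝ) (φ : Fin m → ℝ) :
    S.defectBc (c.eTrunc M ε) (c.ETrunc M ε) φ =
      ∑ k ∈ Finset.range (M + 1), ε ^ k • (c.e k φ - c.E k φ 0) := by
  simp only [defectBc, eTrunc, ETrunc, smul_sub, Finset.sum_sub_distrib]

theorem sum_range_succ_eq_Ico {V : Type*} [AddCommMonoid V] (g : ℕ → V) {ℓ : ℕ} (hℓ : 1 ≤ ℓ) :
    ∑ k ∈ Finset.range (ℓ + 1), g k = g 0 + ∑ k ∈ Finset.Ico 1 ℓ, g k + g ℓ := by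
  rw [Finset.sum_range_succ, Finset.range_eq_Ico, Finset.sum_eq_sum_Ico_succ_bot (by omega)]

theorem Admissible.e_zero_eq (hc : c.Admissible) : c.e 0 = S.e₀ := funext hc.e_zero

theorem Admissible.E_zero_slice (hc : c.Admissible) {s : ℝ} (hs : s ∈ Icc (-S.τ) 0) :
    (fun ψ => c.E 0 ψ s) = fun ψ => S.E₀ ψ s := funext fun φ => hc.E_zero φ s hs

/-! ### Taylor coefficients of the defects -/

theorem contDiff_double_sum {V : Type*} [NormedAddCommGroup V] [NormedSpace ℝ V] (n : ℕ)
    (v : ℕ → ℕ → V) : ContDiff ℝ ∞ fun ε : ℝ => ∑ a ∈ Finset.range n, ∑ b ∈ Finset.range n,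
      ε ^ (a + b) • v a b :=
  ContDiff.sum fun _ _ => ContDiff.sum fun _ _ => contDiff_pow_smul _ _

theorem contDiff_single_sum {V : Type*} [NormedAddCommGroup V] [NormedSpace ℝ V] (n : ℕ)
    (v : ℕ → V) : ContDiff ℝ ∞ fun ε : ℝ => ∑ a ∈ Finset.range n, ε ^ a • v a :=
  ContDiff.sum fun _ _ => contDiff_pow_smul _ _

theorem Admissible.contDiff_defectFin (hc : c.Admissible) (M : ℕ) (φ : Fin m → ℝ) :
    ContDiff ℝ ∞ fun ε =>
      S.defectFin ε (c.fTrunc M ε) (c.eTrunc M ε) (c.ETrunc M ε) φ := by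
  simp only [hc.defectFin_eq]
  exact (contDiff_double_sum _ _).sub (c.contDiff_forcing_left _ φ)

theorem Admissible.contDiff_defectTr (hc : c.Admissible) (M : ℕ) (φ : Fin m → ℝ) {s : ℝ}
    (hs : s ∈ Icc (-S.τ) 0) :
    ContDiff ℝ ∞ fun ε => S.defectTr (c.fTrunc M ε) (c.ETrunc M ε) φ s := by
  simp only [hc.defectTr_eq _ _ _ hs]
  exact (contDiff_double_sum _ _).sub (contDiff_single_sum _ _)

/-- The extreme terms of the Cauchy sum give `∂_φ e⁰ · f^ℓ` and `∂_ω e^ℓ`, and the top forcing term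
gives `F'(e⁰) e^ℓ`; everything of lower order is collected in `η^ℓ`. -/
theorem Admissible.iteratedDeriv_defectFin (hc : c.Admissible) {M ℓ : ℕ} (hℓ : 1 ≤ ℓ)
    (hM : ℓ ≤ M) (φ : Fin m → ℝ) :
    iteratedDeriv ℓ (fun ε =>
      S.defectFin ε (c.fTrunc M ε) (c.eTrunc M ε) (c.ETrunc M ε) φ) 0 =
      (Nat.factorial ℓ : ℝ) • (fderiv ℝ (c.e ℓ) φ S.freq - fderiv ℝ S.field (S.e₀ φ) (c.e ℓ φ) +
        fderiv ℝ S.e₀ φ (c.f ℓ φ) - c.eta ℓ φ) := by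
  have hfac : (Nat.factorial ℓ : ℝ) ≠ 0 := Nat.cast_ne_zero.2 (Nat.factorial_ne_zero ℓ)
  have hF : iteratedDeriv ℓ (fun ε => c.forcing (M + 1) (ε, φ)) 0 =
      iteratedDeriv ℓ (fun ε => c.forcing ℓ (ε, φ)) 0 +
        (Nat.factorial ℓ : ℝ) • fderiv ℝ S.field (c.e 0 φ) (c.e ℓ φ) :=
    iteratedDeriv_forcing S.contDiff_field S.smooth_G (fun k => c.e k φ)
      (fun k => S.hist (c.E k φ)) hℓ (Nat.lt_succ_of_le hM)
  simp only [hc.defectFin_eq]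
  rw [iteratedDeriv_fun_sub (contDiff_double_sum _ _).contDiffAt_nat
    (c.contDiff_forcing_left _ φ).contDiffAt_nat,
    iteratedDeriv_sum_sum_pow_smul (Nat.lt_succ_of_le hM), hF, eta_eq,
    sum_range_succ_eq_Ico _ hℓ, Nat.sub_zero, Nat.sub_self, hc.f_zero, hc.e_zero_eq]
  simp only [smul_add, smul_sub, smul_inv_smul₀ hfac]
  abel

theorem Admissible.iteratedDeriv_defectTr (hc : c.Admissible) {M ℓ : ℕ} (hℓ : 1 ≤ ℓ)
    (hM : ℓ ≤ M) (φ : Fin m → ℝ) {s : ℝ} (hs : s ∈ Icc (-S.τ) 0) :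
    iteratedDeriv ℓ (fun ε => S.defectTr (c.fTrunc M ε) (c.ETrunc M ε) φ s) 0 =
      (Nat.factorial ℓ : ℝ) • (fderiv ℝ (fun ψ => c.E ℓ ψ s) φ S.freq -
        derivWithin (c.E ℓ φ) (Icc (-S.τ) 0) s + fderiv ℝ (fun ψ => S.E₀ ψ s) φ (c.f ℓ φ) -
        c.Hrhs ℓ φ s) := by
  simp only [hc.defectTr_eq _ _ _ hs]
  rw [iteratedDeriv_fun_sub (contDiff_double_sum _ _).contDiffAt_nat
    (contDiff_single_sum _ _).contDiffAt_nat,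
    iteratedDeriv_sum_sum_pow_smul (Nat.lt_succ_of_le hM),
    iteratedDeriv_sum_pow_smul (Nat.lt_succ_of_le hM), ← smul_sub, Hrhs,
    sum_range_succ_eq_Ico _ hℓ, Nat.sub_zero, Nat.sub_self, hc.f_zero, hc.E_zero_slice hs]
  congr 1
  abel

theorem iteratedDeriv_defectBc (c : S.Expansion) {M ℓ : ℕ} (hM : ℓ ≤ M) (φ : Fin m → ℝ) :
    iteratedDeriv ℓ (fun ε => S.defectBc (c.eTrunc M ε) (c.ETrunc M ε) φ) 0 =
      (Nat.factorial ℓ : ℝ) • (c.e ℓ φ - c.E ℓ φ 0) := by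
  simp only [defectBc_eq]
  exact iteratedDeriv_sum_pow_smul (Nat.lt_succ_of_le hM) _

theorem Admissible.defectFin_zero (hc : c.Admissible) (M : ℕ) (φ : Fin m → ℝ) :
    S.defectFin 0 (c.fTrunc M 0) (c.eTrunc M 0) (c.ETrunc M 0) φ = 0 := by
  have h1 : c.eTrunc M 0 = S.e₀ := by
    ext1 ψ
    simp [eTrunc, Finset.sum_range_succ', hc.e_zero]
  have h2 : c.fTrunc M 0 φ = S.freq := by
    simp [fTrunc, Finset.sum_range_succ', hc.f_zero]
  simp [defectFin, h1, h2, fderiv_e₀_freq]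

theorem Admissible.defectTr_zero (hc : c.Admissible) (M : ℕ) (φ : Fin m → ℝ) {s : ℝ}
    (hs : s ∈ Icc (-S.τ) 0) : S.defectTr (c.fTrunc M 0) (c.ETrunc M 0) φ s = 0 := by
  have h1 : c.ETrunc M 0 = c.E 0 := by
    ext1 ψ
    ext1 r
    simp [ETrunc, Finset.sum_range_succ']
  have h2 : c.fTrunc M 0 φ = S.freq := by
    simp [fTrunc, Finset.sum_range_succ', hc.f_zero]
  rw [defectTr, h1, h2, hc.E_zero_slice hs, transport_E₀ φ hs,
    derivWithin_congr (hc.E_zero φ) (hc.E_zero φ s hs), sub_self]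

/-! ### Solving up to order `M` -/

theorem iteratedDeriv_eq_zero_of_bound {V : Type*} [NormedAddCommGroup V] [NormedSpace ℝ V]
    {g : ℝ → V} (hg : ContDiff ℝ ∞ g) {C δ : ℝ} (hδ : 0 < δ) {M : ℕ}
    (h : ∀ ε, |ε| < δ → ‖g ε‖ ≤ C * |ε| ^ (M + 1)) {ℓ : ℕ} (hℓ : ℓ ≤ M) :
    iteratedDeriv ℓ g 0 = 0 := by
  have h1 : g =O[𝓝 0] fun ε : ℝ => ε ^ (M + 1) := by
    refine IsBigO.of_bound C ?_
    filter_upwards [Metric.ball_mem_nhds (0 : ℝ) hδ] with ε hε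
    rw [norm_pow, Real.norm_eq_abs]
    exact h ε (by simpa using hε)
  exact iteratedDeriv_eq_zero_of_isLittleO hg
    (h1.trans_isLittleO (isLittleO_pow_pow (Nat.lt_succ_self M))) ℓ hℓ

/-- At fixed `φ` and `s`, a bound of order `ε^{M+1}` annihilates the Taylor coefficients up to `M`;
uniformity is not used in this direction. -/
theorem Admissible.homological_of_solvesUpTo (hc : c.Admissible) {M : ℕ} (h : c.SolvesUpTo M)
    {ℓ : ℕ} (hℓ : 1 ≤ ℓ) (hM : ℓ ≤ M) : c.Homological ℓ := by
  obtain ⟨C, δ, hδ, hb⟩ := h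
  have hfac : (Nat.factorial ℓ : ℝ) ≠ 0 := Nat.cast_ne_zero.2 (Nat.factorial_ne_zero ℓ)
  refine ⟨fun φ => ?_, fun φ s hs => ?_, fun φ => ?_⟩
  · have h1 := iteratedDeriv_eq_zero_of_bound (hc.contDiff_defectFin M φ) hδ
      (fun ε hε => (hb ε hε φ).1) hM
    rw [hc.iteratedDeriv_defectFin hℓ hM, smul_eq_zero_iff_right hfac] at h1
    exact sub_eq_zero.1 h1
  · have h1 := iteratedDeriv_eq_zero_of_bound (hc.contDiff_defectTr M φ hs) hδ
      (fun ε hε => (hb ε hε φ).2.1 s hs) hM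
    rw [hc.iteratedDeriv_defectTr hℓ hM φ hs, smul_eq_zero_iff_right hfac] at h1
    exact sub_eq_zero.1 h1
  · have hs : ContDiff ℝ ∞ fun ε => S.defectBc (c.eTrunc M ε) (c.ETrunc M ε) φ := by
      simp only [defectBc_eq]
      exact contDiff_single_sum _ _
    have h1 := iteratedDeriv_eq_zero_of_bound hs hδ (fun ε hε => (hb ε hε φ).2.2) hM
    rw [c.iteratedDeriv_defectBc hM, smul_eq_zero_iff_right hfac] at h1
    exact sub_eq_zero.1 h1

theorem Admissible.defectFin_periodic (hc : c.Admissible) (M : ℕ) (ε : ℝ) :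
    TorusPeriodic fun φ =>
      S.defectFin ε (c.fTrunc M ε) (c.eTrunc M ε) (c.ETrunc M ε) φ := by
  intro φ k
  simp only [hc.defectFin_eq]
  have h1 : ∀ a, fderiv ℝ (c.e a) (fun j => φ j + 2 * Real.pi * (k j : ℝ)) =
      fderiv ℝ (c.e a) φ := fun a => (hc.smooth_e a).2.fderiv φ k
  have h2 : ∀ b, c.f b (fun j => φ j + 2 * Real.pi * (k j : ℝ)) = c.f b φ := fun b =>
    (hc.smooth_f b).2 φ k
  have h3 : c.forcing (M + 1) (ε, fun j => φ j + 2 * Real.pi * (k j : ℝ)) =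
    c.forcing (M + 1) (ε, φ) := hc.periodic_forcing (M + 1) ε φ k
  simp only [h1, h2, h3]

theorem Admissible.defectTr_periodic (hc : c.Admissible) (M : ℕ) (ε : ℝ) {s : ℝ}
    (hs : s ∈ Icc (-S.τ) 0) :
    TorusPeriodic fun φ => S.defectTr (c.fTrunc M ε) (c.ETrunc M ε) φ s := by
  intro φ k
  simp only [hc.defectTr_eq _ _ _ hs]
  have h1 : ∀ a, fderiv ℝ (fun ψ => c.E a ψ s) (fun j => φ j + 2 * Real.pi * (k j : ℝ)) =
      fderiv ℝ (fun ψ => c.E a ψ s) φ := fun a => ((hc.smooth_E a).2 s hs).fderiv φ k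
  have h2 : ∀ b, c.f b (fun j => φ j + 2 * Real.pi * (k j : ℝ)) = c.f b φ := fun b =>
    (hc.smooth_f b).2 φ k
  have h3 : ∀ a, derivWithin (c.E a fun j => φ j + 2 * Real.pi * (k j : ℝ)) (Icc (-S.τ) 0) s =
      derivWithin (c.E a φ) (Icc (-S.τ) 0) s := fun a =>
    derivWithin_congr (fun r hr => (hc.smooth_E a).2 r hr φ k) ((hc.smooth_E a).2 s hs φ k)
  simp only [h1, h2, h3]

/-- The homological equations remove the Taylor coefficients of orders `1` to `M`, and order `0`
vanishes for the unperturbed torus. Joint smoothness on a compact box gives the constant,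
periodicity extends it to all `φ`. -/
theorem Admissible.exists_bound_defectFin (hc : c.Admissible) {M : ℕ}
    (h : ∀ ℓ, 1 ≤ ℓ → ℓ ≤ M → c.Homological ℓ) :
    ∃ C, ∀ ε : ℝ, |ε| ≤ 1 → ∀ φ,
      ‖S.defectFin ε (c.fTrunc M ε) (c.eTrunc M ε) (c.ETrunc M ε) φ‖ ≤ C * |ε| ^ (M + 1) := by
  have hW := hc.exists_extends (ℓ := M + 1) fun k hk hkM => h k hk (Nat.lt_succ_iff.1 hkM)
  have hΨ : ContDiff ℝ ∞ fun p : ℝ × (Fin m → ℝ) =>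
      S.defectFin p.1 (c.fTrunc M p.1) (c.eTrunc M p.1) (c.ETrunc M p.1) p.2 := by
    simp only [hc.defectFin_eq]
    refine (ContDiff.sum fun a _ => ContDiff.sum fun b _ => (contDiff_fst.pow _).smul ?_).sub
      (hc.contDiff_forcing hW)
    exact ((hc.smooth_e a).fderiv.1.comp contDiff_snd).clm_apply
      ((hc.smooth_f b).1.comp contDiff_snd)
  obtain ⟨C, hC⟩ := exists_uniform_bound_of_iteratedDeriv_eq_zero hΨ isCompact_box M
    fun φ _ k hk => by
      rcases Nat.eq_zero_or_pos k with rfl | hpos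
      · rw [iteratedDeriv_zero]
        exact hc.defectFin_zero M φ
      · rw [hc.iteratedDeriv_defectFin hpos hk, (h k hpos hk).1 φ, sub_self, smul_zero]
  exact ⟨C, fun ε hε => (hc.defectFin_periodic M ε).forall
    (p := fun v => ‖v‖ ≤ C * |ε| ^ (M + 1)) (hC ε hε)⟩

theorem Admissible.exists_bound_defectTr (hc : c.Admissible) {M : ℕ}
    (h : ∀ ℓ, 1 ≤ ℓ → ℓ ≤ M → c.Homological ℓ) :
    ∃ C, ∀ ε : ℝ, |ε| ≤ 1 → ∀ φ, ∀ s ∈ Icc (-S.τ) 0,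
      ‖S.defectTr (c.fTrunc M ε) (c.ETrunc M ε) φ s‖ ≤ C * |ε| ^ (M + 1) := by
  have hW := hc.exists_extends (ℓ := M + 1) fun k hk hkM => h k hk (Nat.lt_succ_iff.1 hkM)
  choose! W hW using hW
  -- The defect rewritten through the extensions is smooth on the whole space, which the compactness
  -- estimate requires.
  set Ψ : ℝ × ((Fin m → ℝ) × ℝ) → S.State := fun p =>
    (∑ a ∈ Finset.range (M + 1), ∑ b ∈ Finset.range (M + 1),
        p.1 ^ (a + b) • fderiv ℝ (W a) p.2 (c.f b p.2.1, 0)) -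
      ∑ k ∈ Finset.range (M + 1), p.1 ^ k • fderiv ℝ (W k) p.2 (0, 1) with hΨ
  have hΨs : ContDiff ℝ ∞ Ψ := by
    have hd : ∀ a ∈ Finset.range (M + 1),
        ContDiff ℝ ∞ fun p : ℝ × ((Fin m → ℝ) × ℝ) => fderiv ℝ (W a) p.2 := fun a ha =>
      ((hW a (Finset.mem_range.1 ha)).1.fderiv_right (m := ∞) (by simp)).comp contDiff_snd
    refine (ContDiff.sum fun a ha => ContDiff.sum fun b _ => (contDiff_fst.pow _).smul ?_).sub
      (ContDiff.sum fun k hk => (contDiff_fst.pow _).smul ((hd k hk).clm_apply contDiff_const))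
    have hf : ContDiff ℝ ∞ fun p : ℝ × ((Fin m → ℝ) × ℝ) => c.f b p.2.1 :=
      (hc.smooth_f b).1.comp (contDiff_fst.comp contDiff_snd)
    exact (hd a ha).clm_apply (hf.prodMk contDiff_const)
  have hΨeq : ∀ ε φ, ∀ s ∈ Icc (-S.τ) 0,
      Ψ (ε, (φ, s)) = S.defectTr (c.fTrunc M ε) (c.ETrunc M ε) φ s := by
    intro ε φ s hs
    rw [hc.defectTr_eq _ _ _ hs]
    have hd := fun a (ha : a ∈ Finset.range (M + 1)) =>
      (hW a (Finset.mem_range.1 ha)).hasFDerivWithinAt φ hs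
    simp only [hΨ]
    congr 1
    · exact Finset.sum_congr rfl fun a ha => Finset.sum_congr rfl fun b _ => by
        rw [fderiv_slice hs _ (hd a ha)]
    · exact Finset.sum_congr rfl fun a ha => by rw [derivWithin_slice hs (hd a ha)]
  obtain ⟨C, hC⟩ := exists_uniform_bound_of_iteratedDeriv_eq_zero hΨs
    (isCompact_box.prod isCompact_Icc) M (K := _ ×ˢ Icc (-S.τ) 0) fun q hq k hk => by
      obtain ⟨φ, s⟩ := q
      have hs : s ∈ Icc (-S.τ) 0 := hq.2
      simp only [fun ε => hΨeq ε φ s hs]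
      rcases Nat.eq_zero_or_pos k with rfl | hpos
      · rw [iteratedDeriv_zero]
        exact hc.defectTr_zero M φ hs
      · rw [hc.iteratedDeriv_defectTr hpos hk φ hs, (h k hpos hk).2.1 φ s hs, sub_self, smul_zero]
  refine ⟨C, fun ε hε φ s hs => ?_⟩
  refine (hc.defectTr_periodic M ε hs).forall (p := fun v => ‖v‖ ≤ C * |ε| ^ (M + 1))
    (fun ψ hψ => ?_) φ
  rw [← hΨeq ε ψ s hs]
  exact hC ε hε (ψ, s) ⟨hψ, hs⟩

theorem Admissible.solvesUpTo_of_homological (hc : c.Admissible) {M : ℕ}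
    (h : ∀ ℓ, 1 ≤ ℓ → ℓ ≤ M → c.Homological ℓ) : c.SolvesUpTo M := by
  obtain ⟨C₁, h₁⟩ := hc.exists_bound_defectFin h
  obtain ⟨C₂, h₂⟩ := hc.exists_bound_defectTr h
  refine ⟨max C₁ C₂, 1, one_pos, fun ε hε φ => ?_⟩
  have hF := (h₁ ε hε.le φ).trans
    (mul_le_mul_of_nonneg_right (le_max_left C₁ C₂) (pow_nonneg (abs_nonneg ε) (M + 1)))
  refine ⟨hF, fun s hs => (h₂ ε hε.le φ s hs).trans
    (mul_le_mul_of_nonneg_right (le_max_right C₁ C₂) (pow_nonneg (abs_nonneg ε) (M + 1))), ?_⟩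
  -- The boundary condition is linear and holds at each order, so its defect vanishes exactly.
  have hB : S.defectBc (c.eTrunc M ε) (c.ETrunc M ε) φ = 0 := by
    rw [defectBc_eq]
    refine Finset.sum_eq_zero fun k hk => ?_
    rcases Nat.eq_zero_or_pos k with rfl | hpos
    · rw [hc.e_zero, hc.E_zero φ 0 zero_mem_Icc, sub_eq_zero.1 (defectBc_e₀ φ), sub_self,
        smul_zero]
    · rw [(h k hpos (Nat.lt_succ_iff.1 (Finset.mem_range.1 hk))).2.2 φ, sub_self, smul_zero]
  rw [hB, norm_zero]
  exact (norm_nonneg _).trans hF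

theorem Admissible.solvesUpTo_iff (hc : c.Admissible) (M : ℕ) :
    c.SolvesUpTo M ↔ ∀ ℓ, 1 ≤ ℓ → ℓ ≤ M → c.Homological ℓ :=
  ⟨fun h _ hℓ hM => hc.homological_of_solvesUpTo h hℓ hM, hc.solvesUpTo_of_homological⟩

/-! ### Existence of expansions in normal form -/

/-- `f⁰, e⁰, E⁰` without higher-order terms. -/
noncomputable def base (S : DelaySystem m) : S.Expansion where
  f ℓ := if ℓ = 0 then fun _ => S.freq else 0
  e ℓ := if ℓ = 0 then S.e₀ else 0
  E ℓ := if ℓ = 0 then S.E₀ else 0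

theorem admissible_base (S : DelaySystem m) : (base S).Admissible where
  smooth_f ℓ := by
    rcases eq_or_ne ℓ 0 with rfl | h
    · exact SmoothTorus.const _
    · simp only [base, if_neg h]
      exact SmoothTorus.const 0
  smooth_e ℓ := by
    rcases eq_or_ne ℓ 0 with rfl | h
    · exact S.smoothTorus_e₀
    · simp only [base, if_neg h]
      exact SmoothTorus.const 0
  smooth_E ℓ := by
    rcases eq_or_ne ℓ 0 with rfl | h
    · exact S.smoothTorusHist_E₀
    · simp only [base, if_neg h]
      exact ⟨contDiffOn_const, fun _ _ _ _ => rfl⟩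
  f_zero _ := rfl
  e_zero _ := rfl
  E_zero _ _ _ := rfl

/-- The expansions agree below order `n`. -/
def AgreesBelow (n : ℕ) (c c' : S.Expansion) : Prop :=
  ∀ k < n, c'.f k = c.f k ∧ c'.e k = c.e k ∧ c'.E k = c.E k

theorem AgreesBelow.homological {c' : S.Expansion} {n : ℕ} (h : AgreesBelow n c c') {ℓ : ℕ}
    (hℓ : ℓ < n) (hc : c.Homological ℓ) : c'.Homological ℓ := by
  have hlow : ∀ k < ℓ, c'.f k = c.f k ∧ c'.e k = c.e k ∧ c'.E k = c.E k := fun k hk =>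
    h k (hk.trans hℓ)
  rw [Homological, eta_congr (fun k hk => (hlow k hk).1) (fun k hk => (hlow k hk).2.1)
    (fun k hk => (hlow k hk).2.2), Hrhs_congr (fun k hk => (hlow k hk).1)
    (fun k hk => (hlow k hk).2.2), (h ℓ hℓ).1, (h ℓ hℓ).2.1, (h ℓ hℓ).2.2]
  exact hc

/-- All coefficients of orders `1, …, n - 1` solve the homological equations in normal form. -/
def SolvedBelow (K n : ℕ) (c : S.Expansion) : Prop :=
  c.Admissible ∧ ∀ k, 1 ≤ k → k < n → c.Homological k ∧ InNormalForm S.freq K (c.f k)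

theorem SolvedBelow.exists_succ {K n : ℕ} (hn : 1 ≤ n) (h : SolvedBelow K n c) :
    ∃ c', SolvedBelow K (n + 1) c' ∧ AgreesBelow n c c' := by
  obtain ⟨hc, hk⟩ := h
  have hhom : ∀ k, 1 ≤ k → k < n → c.Homological k := fun k h1 h2 => (hk k h1 h2).1
  obtain ⟨A⟩ := S.nonempty_floquetFrame
  have hη := hc.smoothTorus_eta (hc.exists_extends hhom)
  obtain ⟨g, f, hg, hf, hT, hnf, -⟩ := A.exists_homTangent hη K
  obtain ⟨h', hh', hN, -⟩ := A.exists_homNormal hη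
  obtain ⟨c', hc', hlow, hfn, -, -, hhom'⟩ := hc.recursion hn hhom A hg hf hh' hT hN
  refine ⟨c', ⟨hc', fun k h1 h2 => ?_⟩, hlow⟩
  rcases (Nat.lt_succ_iff.1 h2).lt_or_eq with h3 | rfl
  · refine ⟨AgreesBelow.homological hlow h3 (hhom k h1 h3), ?_⟩
    rw [(hlow k h3).1]
    exact (hk k h1 h3).2
  · exact ⟨hhom', hfn ▸ hnf⟩

/-- Each step of the recursion produces a new expansion that agrees with the previous one at lower
orders. The diagonal of this sequence satisfies all orders, since the order-`ℓ` equations involve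
only coefficients up to `ℓ`. -/
theorem exists_homological (S : DelaySystem m) (K : ℕ) : ∃ c : S.Expansion, c.Admissible ∧
    ∀ ℓ, 1 ≤ ℓ → c.Homological ℓ ∧ InNormalForm S.freq K (c.f ℓ) := by
  have hstep : ∀ (n : ℕ) (c : {c : S.Expansion // SolvedBelow K (n + 1) c}),
      ∃ c' : {c : S.Expansion // SolvedBelow K (n + 2) c}, AgreesBelow (n + 1) c.1 c'.1 := by
    rintro n ⟨c, hc⟩
    obtain ⟨c', hc', h⟩ := hc.exists_succ (by omega)
    exact ⟨⟨c', hc'⟩, h⟩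
  choose next hnext using hstep
  -- With the index shift `n + 1`, the condition for the initial expansion `base S` concerns no
  -- order at all.
  let C : (n : ℕ) → {c : S.Expansion // SolvedBelow K (n + 1) c} := fun n =>
    Nat.rec ⟨base S, admissible_base S, fun k h1 h2 => absurd h2 (not_lt.2 h1)⟩ next n
  have hC : ∀ n, AgreesBelow (n + 1) (C n).1 (C (n + 1)).1 := fun n => hnext n (C n)
  have hC' : ∀ d n, AgreesBelow (n + 1) (C n).1 (C (n + d)).1 := by
    intro d n
    induction d with
    | zero => exact fun k _ => ⟨rfl, rfl, rfl⟩
    | succ d ih =>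
      intro k hk
      obtain ⟨h1, h2, h3⟩ := hC (n + d) k (by omega)
      obtain ⟨h4, h5, h6⟩ := ih k hk
      exact ⟨h1.trans h4, h2.trans h5, h3.trans h6⟩
  let c : S.Expansion := ⟨fun n => (C n).1.f n, fun n => (C n).1.e n, fun n => (C n).1.E n⟩
  have hc : ∀ n, AgreesBelow (n + 1) (C n).1 c := by
    intro n k hk
    obtain ⟨d, rfl⟩ := Nat.exists_eq_add_of_le (Nat.lt_succ_iff.1 hk)
    obtain ⟨h1, h2, h3⟩ := hC' d k k (by omega)
    exact ⟨h1.symm, h2.symm, h3.symm⟩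
  refine ⟨c, ⟨fun n => (C n).2.1.smooth_f n, fun n => (C n).2.1.smooth_e n,
    fun n => (C n).2.1.smooth_E n, (C 0).2.1.f_zero, (C 0).2.1.e_zero, (C 0).2.1.E_zero⟩,
    fun ℓ hℓ => ?_⟩
  obtain ⟨h1, h2⟩ := (C ℓ).2.2 ℓ hℓ (by omega)
  exact ⟨(hc ℓ).homological (by omega) h1, h2⟩

end Expansion

end DelaySystem

end DelayPhase

theorem mainTheorem1 {m : ℕ} (S : DelayPhase.DelaySystem m) :
    -- the conjugacy equations can be solved to every order, with `f^ℓ` in normal form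
    (∀ K : ℕ, ∃ c : S.Expansion, c.Admissible ∧
      (∀ ℓ, 1 ≤ ℓ → c.Homological ℓ ∧ DelayPhase.InNormalForm S.freq K (c.f ℓ)) ∧
      ∀ M : ℕ, c.SolvesUpTo M) ∧
    -- the zeroth-order solution: the conjugacy equations hold exactly for `ε = 0`
    (DelayPhase.SmoothTorus S.e₀ ∧ DelayPhase.SmoothTorusHist S.τ S.E₀ ∧
      ∀ φ, S.defectFin 0 (fun _ => S.freq) S.e₀ S.E₀ φ = 0 ∧
        (∀ s ∈ Set.Icc (-S.τ) 0, S.defectTr (fun _ => S.freq) S.E₀ φ s = 0) ∧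
        S.defectBc S.e₀ S.E₀ φ = 0) ∧
    -- solving up to order `M` is the same as solving the homological equations up to order `M`
    (∀ c : S.Expansion, c.Admissible → ∀ M : ℕ,
      (c.SolvesUpTo M ↔ ∀ ℓ, 1 ≤ ℓ → ℓ ≤ M → c.Homological ℓ)) ∧
    -- a Floquet frame exists
    Nonempty S.FloquetFrame ∧
    -- for every Floquet frame and every right-hand side:
    (∀ (A : S.FloquetFrame) (η : (Fin m → ℝ) → S.State), DelayPhase.SmoothTorus η →
      -- splitting into a tangential and a normal equation
      (∀ (f g : (Fin m → ℝ) → (Fin m → ℝ)) (h : (Fin m → ℝ) → (Fin S.codim → ℂ))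
          (e : (Fin m → ℝ) → S.State),
        DelayPhase.SmoothTorus f → DelayPhase.SmoothTorus g → DelayPhase.SmoothTorus h →
        DelayPhase.SmoothTorus e → A.Decomposes e g h →
        (S.HomFin f e η ↔ A.HomTangent g f η ∧ A.HomNormal h η)) ∧
      -- solution of the tangential equation in normal form
      (∀ K : ℕ, ∃ g f : (Fin m → ℝ) → (Fin m → ℝ),
        DelayPhase.SmoothTorus g ∧ DelayPhase.SmoothTorus f ∧ A.HomTangent g f η ∧
        DelayPhase.InNormalForm S.freq K f ∧
        ∀ k : Fin m → ℤ,
          ((∑ j, |k j| ≤ (K : ℤ) ∧ DelayPhase.resonance S.freq k ≠ 0) →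
            DelayPhase.torusFourierCoeff (fun φ => DelayPhase.toC (g φ)) k =
              (Complex.I * (DelayPhase.resonance S.freq k : ℂ))⁻¹ • A.zetaHat η k ∧
            DelayPhase.torusFourierCoeff (fun φ => DelayPhase.toC (f φ)) k = 0) ∧
          (¬(∑ j, |k j| ≤ (K : ℤ) ∧ DelayPhase.resonance S.freq k ≠ 0) →
            DelayPhase.torusFourierCoeff (fun φ => DelayPhase.toC (g φ)) k = 0 ∧
            DelayPhase.torusFourierCoeff (fun φ => DelayPhase.toC (f φ)) k =
              A.zetaHat η k)) ∧
      -- unique solution of the normal equation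
      (∃ h : (Fin m → ℝ) → (Fin S.codim → ℂ),
        DelayPhase.SmoothTorus h ∧ A.HomNormal h η ∧
        (∀ h' : (Fin m → ℝ) → (Fin S.codim → ℂ),
          DelayPhase.SmoothTorus h' → A.HomNormal h' η → h' = h) ∧
        ∀ k : Fin m → ℤ,
          IsUnit ((Complex.I * (DelayPhase.resonance S.freq k : ℂ)) •
            (1 : Matrix (Fin S.codim) (Fin S.codim) ℂ) - A.L) ∧
          DelayPhase.torusFourierCoeff h k =
            ((Complex.I * (DelayPhase.resonance S.freq k : ℂ)) •
              (1 : Matrix (Fin S.codim) (Fin S.codim) ℂ) - A.L)⁻¹.mulVec (A.kappaHat η k))) ∧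
    -- the recursion: let the homological equations be solved up to order `ℓ - 1`
    (∀ (c : S.Expansion) (ℓ : ℕ), c.Admissible → 1 ≤ ℓ →
      (∀ k, 1 ≤ k → k < ℓ → c.Homological k) →
      DelayPhase.SmoothTorus (c.eta ℓ) ∧
      -- the integral formula solves the transport equation
      (∀ (f : (Fin m → ℝ) → (Fin m → ℝ)) (e : (Fin m → ℝ) → S.State),
        DelayPhase.SmoothTorus f → DelayPhase.SmoothTorus e → S.HomFin f e (c.eta ℓ) →
        DelayPhase.SmoothTorusHist S.τ (S.transportSolution f e (c.Hrhs ℓ)) ∧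
        S.HomTr f (S.transportSolution f e (c.Hrhs ℓ)) (c.Hrhs ℓ) ∧
        ∀ φ, e φ = S.transportSolution f e (c.Hrhs ℓ) φ 0) ∧
      -- solutions of the tangential and normal equations give the coefficients of order `ℓ`
      (∀ (A : S.FloquetFrame) (g f : (Fin m → ℝ) → (Fin m → ℝ))
          (h : (Fin m → ℝ) → (Fin S.codim → ℂ)),
        DelayPhase.SmoothTorus g → DelayPhase.SmoothTorus f → DelayPhase.SmoothTorus h →
        A.HomTangent g f (c.eta ℓ) → A.HomNormal h (c.eta ℓ) →
        ∃ c' : S.Expansion, c'.Admissible ∧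
          (∀ k, k < ℓ → c'.f k = c.f k ∧ c'.e k = c.e k ∧ c'.E k = c.E k) ∧
          c'.f ℓ = f ∧ A.Decomposes (c'.e ℓ) g h ∧
          c'.E ℓ = S.transportSolution f (c'.e ℓ) (c.Hrhs ℓ) ∧
          c'.Homological ℓ)) := by
  open DelayPhase DelaySystem Expansion in
  refine ⟨fun K => ?_, ⟨S.smoothTorus_e₀, S.smoothTorusHist_E₀, fun φ =>
    ⟨defectFin_e₀ φ, fun s hs => defectTr_E₀ φ hs, defectBc_e₀ φ⟩⟩,
    fun c hc M => hc.solvesUpTo_iff M, S.nonempty_floquetFrame,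
    fun A η hη => ⟨fun f g h e _ hg hh he hd => A.homFin_iff hg hh he hd,
      fun K => A.exists_homTangent hη K, A.exists_homNormal hη⟩,
    fun c ℓ hc hℓ hk => ⟨hc.smoothTorus_eta (hc.exists_extends hk), fun f e hf he _ => ?_,
      fun A g f h hg hf hh hT hN => hc.recursion hℓ hk A hg hf hh hT hN⟩⟩
  · obtain ⟨c, hc, h⟩ := exists_homological S K
    exact ⟨c, hc, h, fun M => (hc.solvesUpTo_iff M).2 fun ℓ hℓ _ => (h ℓ hℓ).1⟩
  · obtain ⟨W, hW⟩ := hc.exists_extends_Hrhs (hc.exists_extends hk)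
    exact ⟨smoothTorusHist_transportSolution hf he hW fun s hs => hc.periodic_Hrhs ℓ hs,
      homTr_transportSolution hf he hW, fun φ => (transportSolution_zero φ).symm⟩
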